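/- **Setting.** Let $S(x)\in\mathbb R^{3\times 3}$ be the skew-symmetric matrix with $S(x)y=x\times y$. Consider $N$ rigid bodies with poses $x_i=(p_i,R_i)\in\mathbb{SE}(3)=\mathbb R^3\times\mathbb{SO}(3)$ and body-frame velocities $v_i=[v_{i,L}^\top,\omega_i^\top]^\top\in\mathbb R^6$, satisfying for $t\ge 0$ $$\dot p_i=R_iv_{i,L},\qquad \dot R_i=R_iS(\omega_i),\qquad u_i=M_i\dot v_i+C_i(v_i)v_i+g_i(x_i)+w_i(x_i,v_i,t).$$ Here $M_i\in\mathbb R^{6\times6}$ is symmetric positive definite; $C_i:\mathbb R^6\to\mathbb R^{6\times 6}$ is continuous; $g_i:\mathbb{SE}(3)\to\mathbb R^6$ is continuous and bounded; $w_i:\mathbb{SE}(3)\times\mathbb R^6\times\mathbb R_{\ge0}\to\mathbb R^6$ is continuous and bounded uniformly in $(x_i,t)$ and locally uniformly in $v_i$. Agent $i$ measures $\widetilde v_i=v_i+n_i(x_i,t)$, where $n_i$ is continuous and bounded, and along differentiable curves in $\mathbb{SE}(3)$ it is differentiable with $\dot n_i=n_{i,d}(x_i,\dot x_i,t)$, where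 $n_{i,d}$ is continuous in $\dot x_i$ and bounded uniformly in $(x_i,t)$, locally uniformly in the body velocity representing $\dot x_i$. (The functions $M_i,C_i,g_i,w_i,n_i$ are unknown: they do not enter the control law, except through $\widetilde v_i$.) The agents have radii $r_i>0$ and sensing ranges $s_i$. The sensing graph is a static tree on the $N$ agents with edges numbered $k=1,\dots,K$ and arbitrarily oriented, $k_1$ being the tail and $k_2$ the head of edge $k$. Put $d_{k,\mathrm{col}}=r_{k_1}+r_{k_2}$, $d_{k,\mathrm{con}}=\min\{s_{k_1},s_{k_2}\}$, and let $d_{k,\mathrm{des}}\in(d_{k,\mathrm{col}},d_{k,\mathrm{con}})$ and $R_{k,\mathrm{des}}\in\mathbb{SO}(3)$ be given. With $\widetilde p_k=p_{k_2}-p_{k_1}$ define $$e_k=\|\widetilde p_k\|^2-d_{k,\mathrm{des}}^2,\quad \psi_k=\tfrac12\operatorname{tr}\big[I_3-R_{k,\mathrm{des}}^\top R_{k_2}^\top R_{k_1}\big],\quad e_{R_k}=S^{-1}\big(R_{k_1}^\top R_{k_2}R_{k,\mathrm{des}}-R_{k,\mathrm{des}}^\top R_{k_2}^\top R_{k_1}\big),$$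 $C_{k,\mathrm{col}}=d_{k,\mathrm{des}}^2-d_{k,\mathrm{col}}^2$, $C_{k,\mathrm{con}}=d_{k,\mathrm{con}}^2-d_{k,\mathrm{des}}^2$ and $C_k=\max\{C_{k,\mathrm{con}},C_{k,\mathrm{col}}\}$. **Protocol.** The performance functions are $$\rho_{e_k}(t)=\big(1-\tfrac{\rho_{e_k,\infty}}{C_k}\big)e^{-l_{e_k}t}+\tfrac{\rho_{e_k,\infty}}{C_k},\quad \rho_{\psi_k}(t)=(\rho_{\psi_k,0}-\rho_{\psi_k,\infty})e^{-l_{\psi_k}t}+\rho_{\psi_k,\infty},\quad \rho_{v_{i,\ell}}(t)=(\rho_{v_{i,\ell}^0}-\rho_{v_{i,\ell}^\infty})e^{-l_{v_{i,\ell}}t}+\rho_{v_{i,\ell}^\infty},$$ with $l_{e_k},l_{\psi_k},l_{v_{i,\ell}}>0$, $\rho_{e_k,\infty}\in(0,C_k)$, $\rho_{\psi_k,\infty}\in(0,\rho_{\psi_k,0})$, $\rho_{v_{i,\ell}^\infty}\in(0,\rho_{v_{i,\ell}^0})$. Let $T_{e_k}(y)=\ln\frac{1+y/C_{k,\mathrm{col}}}{1-y/C_{k,\mathrm{con}}}$,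 $T_\psi(y)=\ln\frac1{1-y}$, $T_v(y)=\ln\frac{1+y}{1-y}$, and let $r_{e_k},r_\psi,r_v$ be their derivatives. Put $\xi_{e_k}=e_k/\rho_{e_k}$, $\xi_{\psi_k}=\psi_k/\rho_{\psi_k}$, $\varepsilon_{e_k}=T_{e_k}(\xi_{e_k})$, $\varepsilon_{\psi_k}=T_\psi(\xi_{\psi_k})$, and, with gains $\delta_i,\gamma_i>0$, $$v_{i,\mathrm{des}}=-\delta_i\begin{bmatrix}2\sum_k\alpha_{ik}\frac{r_{e_k}(\xi_{e_k})}{\rho_{e_k}(t)}\varepsilon_{e_k}R_{k_1}^\top\widetilde p_k\\[2pt] \sum_k\alpha_{ik}\frac{r_\psi(\xi_{\psi_k})}{\rho_{\psi_k}(t)}e_{R_k}\end{bmatrix},\qquad \alpha_{ik}=\begin{cases}-I_3,&i=k_1,\\ R_{k_2}^\top R_{k_1},&i=k_2,\\ 0,&\text{otherwise.}\end{cases}$$ Finally put $e_{v_i}=\widetilde v_i-v_{i,\mathrm{des}}$, $\xi_{v_{i,\ell}}=e_{v_{i,\ell}}/\rho_{v_{i,\ell}}$, $\varepsilon_{v_{i,\ell}}=T_v(\xi_{v_{i,\ell}})$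 and $$u_{i,\ell}=-\gamma_i\,\rho_{v_{i,\ell}}(t)^{-1}\,r_v(\xi_{v_{i,\ell}})\,\varepsilon_{v_{i,\ell}},\qquad \ell=1,\dots,6.$$ **Theorem.** Consider any initial condition with $\psi_k(0)<2$ and $d_{k,\mathrm{col}}<\|p_{k_2}(0)-p_{k_1}(0)\|<d_{k,\mathrm{con}}$ for all $k$, and let the design constants satisfy $\rho_{\psi_k,0}\in(\psi_k(0),2)$ and $\rho_{v_{i,\ell}^0}>|e_{v_{i,\ell}}(0)|$ for all $k,i,\ell$. Then the closed-loop system has a solution on $[0,\infty)$ with this initial condition, every solution with this initial condition on an interval $[0,T)$ extends to a solution on $[0,\infty)$, and every solution on $[0,\infty)$ with this initial condition satisfies, for all $t\ge0$ and all $k,i,\ell$: 1. $-C_{k,\mathrm{col}}\rho_{e_k}(t)<e_k(t)<C_{k,\mathrm{con}}\rho_{e_k}(t)$ and $0\le\psi_k(t)<\rho_{\psi_k}(t)$; 2. consequently $d_{k,\mathrm{col}}<\|p_{k_2}(t)-p_{k_1}(t)\|<d_{k,\mathrm{con}}$ (collision avoidance and connectivity maintenance along the edges) and $\psi_k(t)<2$;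 moreover, for every $\eta>0$, $|e_k(t)|<\rho_{e_k,\infty}+\eta$ and $\psi_k(t)<\rho_{\psi_k,\infty}+\eta$ for all sufficiently large $t$; 3. $|e_{v_{i,\ell}}(t)|<\rho_{v_{i,\ell}}(t)$, and the closed-loop signals are bounded on $[0,\infty)$: all relative positions $p_i-p_j$, and $v_i,\widetilde v_i,\dot v_i,v_{i,\mathrm{des}},\dot v_{i,\mathrm{des}},u_i$, $\varepsilon_{e_k},\varepsilon_{\psi_k},\varepsilon_{v_{i,\ell}}$, $r_{e_k}(\xi_{e_k}),r_\psi(\xi_{\psi_k}),r_v(\xi_{v_{i,\ell}})$. -/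

import Mathlib

open Set Filter Topology Matrix

noncomputable section

/-- Euclidean three-space. -/
abbrev E3 : Type := EuclideanSpace ℝ (Fin 3)

/-- Indices of a stacked vector `[linear part; angular part]`. -/
abbrev Idx6 : Type := Fin 3 ⊕ Fin 3

/-- Stacked (linear, angular) vectors, i.e. `ℝ⁶` with the Euclidean norm. -/
abbrev V6 : Type := EuclideanSpace ℝ Idx6

/-- The rotation group `SO(3)`. -/
abbrev SO3 : Type := Matrix.specialOrthogonalGroup (Fin 3) ℝ

/-- Poses `(p, R)`, i.e. `SE(3)`, with the product topology. -/
abbrev SE3 : Type := E3 × SO3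

/-- Position of a pose. -/
abbrev pos (x : SE3) : E3 := x.1

/-- Rotation matrix of a pose. -/
abbrev rot (x : SE3) : Matrix (Fin 3) (Fin 3) ℝ := x.2.1

/-- A matrix acting on a Euclidean vector. -/
def act {ι : Type} [Fintype ι] (A : Matrix ι ι ℝ) (y : EuclideanSpace ℝ ι) :
    EuclideanSpace ℝ ι :=
  WithLp.toLp 2 (A *ᵥ y.ofLp)

/-- Linear part `v_L` of `v = [v_L; ω]`. -/
def lin (v : V6) : E3 := WithLp.toLp 2 (fun a => v (Sum.inl a))

/-- Angular part `ω` of `v = [v_L; ω]`. -/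
def ang (v : V6) : E3 := WithLp.toLp 2 (fun a => v (Sum.inr a))

/-- The stacked vector `[a; b]`. -/
def stack (a b : E3) : V6 := WithLp.toLp 2 (Sum.elim a.ofLp b.ofLp)

/-- The skew-symmetric matrix `S(x)`, with `S(x) y = x × y`. -/
def skew (x : E3) : Matrix (Fin 3) (Fin 3) ℝ :=
  !![0, -x 2, x 1; x 2, 0, -x 0; -x 1, x 0, 0]

/-- The inverse `S⁻¹` of `skew`; it is only applied to skew-symmetric matrices. -/
def vee (A : Matrix (Fin 3) (Fin 3) ℝ) : E3 := !₂[A 2 1, A 0 2, A 1 0]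

theorem skew_mulVec (x y : E3) : skew x *ᵥ y.ofLp = crossProduct x.ofLp y.ofLp := by
  ext a
  fin_cases a <;> simp [skew, cross_apply, Matrix.mulVec, dotProduct, Fin.sum_univ_three] <;> ring

theorem vee_skew (x : E3) : vee (skew x) = x := by
  ext a
  fin_cases a <;> simp [vee, skew]

theorem skew_vee (A : Matrix (Fin 3) (Fin 3) ℝ) (hA : Aᵀ = -A) : skew (vee A) = A := by
  have h : ∀ a b, A b a = -A a b := fun a b => by
    have := congrFun (congrFun hA a) b
    simpa using this
  have h0 := h 0 0
  have h1 := h 1 1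
  have h2 := h 2 2
  have h3 := h 0 1
  have h4 := h 0 2
  have h5 := h 1 2
  ext a b
  fin_cases a <;> fin_cases b <;> simp [vee, skew] <;> linarith

/-- The curve `x` in `SE(3)` has body velocity `v` at time `t`:
`ẋ(t) = (R v_L, R S(ω))` (a one-sided derivative at `t = 0`). -/
def HasBodyVelocity (x : ℝ → SE3) (v : V6) (t : ℝ) : Prop :=
  HasDerivWithinAt (fun s => pos (x s)) (act (rot (x t)) (lin v)) (Ici 0) t ∧
  ∀ a b, HasDerivWithinAt (fun s => rot (x s) a b) ((rot (x t) * skew (ang v)) a b) (Ici 0) t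

/-- The data of one rigid body: inertia matrix `M`, Coriolis matrix `C`, gravity `g`,
uncertainty/disturbance `w`, and velocity measurement noise `n`. Times are `t ≥ 0`. -/
structure RigidBody where
  M : Matrix Idx6 Idx6 ℝ
  C : V6 → Matrix Idx6 Idx6 ℝ
  g : SE3 → V6
  w : SE3 → V6 → ℝ → V6
  n : SE3 → ℝ → V6

/-- Standing assumptions on one rigid body. The bounds on `w` and on the rate of the noise are
uniform in pose and time, and locally uniform in the velocity. -/
structure RigidBody.Admissible (B : RigidBody) : Prop where
  M_posDef : B.M.PosDef
  C_cont : Continuous B.C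
  g_cont : Continuous B.g
  g_bdd : ∃ c, ∀ x, ‖B.g x‖ ≤ c
  w_cont : ContinuousOn (fun q : SE3 × V6 × ℝ => B.w q.1 q.2.1 q.2.2) {q | 0 ≤ q.2.2}
  w_bdd : ∀ b, ∃ c, ∀ x v t, 0 ≤ t → ‖v‖ ≤ b → ‖B.w x v t‖ ≤ c
  n_cont : ContinuousOn (fun q : SE3 × ℝ => B.n q.1 q.2) {q | 0 ≤ q.2}
  n_bdd : ∃ c, ∀ x t, 0 ≤ t → ‖B.n x t‖ ≤ c
  /-- The noise is differentiable along curves in `SE(3)`, and its rate `nd` is a function of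
  pose, pose velocity and time. -/
  n_deriv : ∃ nd : SE3 → V6 → ℝ → V6,
    (∀ (x : ℝ → SE3) (v : V6) (t : ℝ), 0 ≤ t → HasBodyVelocity x v t →
      HasDerivWithinAt (fun s => B.n (x s) s) (nd (x t) v t) (Ici 0) t) ∧
    (∀ x t, 0 ≤ t → Continuous fun v => nd x v t) ∧
    (∀ b, ∃ c, ∀ x v t, 0 ≤ t → ‖v‖ ≤ b → ‖nd x v t‖ ≤ c)

/-- Geometry of the task: agents `Fin N` with radii and sensing ranges, numbered oriented edges
`k : Fin K` from `tail k` to `head k`, and the desired distance and relative orientation of each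
edge. -/
structure Formation (N K : ℕ) where
  tail : Fin K → Fin N
  head : Fin K → Fin N
  radius : Fin N → ℝ
  range : Fin N → ℝ
  dDes : Fin K → ℝ
  RDes : Fin K → SO3

/-- Design parameters of the protocol: performance functions of the distance errors, of the
orientation errors and of the velocity errors, and the gains `δ`, `γ`. -/
structure Design (N K : ℕ) where
  rhoEInf : Fin K → ℝ
  lE : Fin K → ℝ
  rhoPsi0 : Fin K → ℝ
  rhoPsiInf : Fin K → ℝ
  lPsi : Fin K → ℝ
  rhoV0 : Fin N → Idx6 → ℝ
  rhoVInf : Fin N → Idx6 → ℝ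
  lV : Fin N → Idx6 → ℝ
  delta : Fin N → ℝ
  gamma : Fin N → ℝ

namespace Formation

variable {N K : ℕ} (F : Formation N K)

/-- `k ↦ {tail k, head k}` numbers the edges of `G`, each exactly once. -/
def Orients (G : SimpleGraph (Fin N)) : Prop :=
  Function.Injective (fun k => s(F.tail k, F.head k)) ∧
  Set.range (fun k => s(F.tail k, F.head k)) = G.edgeSet

/-- Collision distance of an edge. -/
def dCol (k : Fin K) : ℝ := F.radius (F.tail k) + F.radius (F.head k)

/-- Connectivity distance of an edge. -/
def dCon (k : Fin K) : ℝ := min (F.range (F.tail k)) (F.range (F.head k))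

/-- Radii are positive, and the desired distances respect the constraints. -/
structure Admissible : Prop where
  radius_pos : ∀ i, 0 < F.radius i
  dCol_lt : ∀ k, F.dCol k < F.dDes k
  lt_dCon : ∀ k, F.dDes k < F.dCon k

/-- The constant `C_{k,col}`. -/
def CCol (k : Fin K) : ℝ := F.dDes k ^ 2 - F.dCol k ^ 2

/-- The constant `C_{k,con}`. -/
def CCon (k : Fin K) : ℝ := F.dCon k ^ 2 - F.dDes k ^ 2

/-- The relative position `p_{k₂} - p_{k₁}` of an edge. -/
def rel (x : Fin N → SE3) (k : Fin K) : E3 := pos (x (F.head k)) - pos (x (F.tail k))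

/-- The distance error `e_k`. -/
def e (x : Fin N → SE3) (k : Fin K) : ℝ := ‖F.rel x k‖ ^ 2 - F.dDes k ^ 2

/-- The orientation error `ψ_k`. -/
def psi (x : Fin N → SE3) (k : Fin K) : ℝ :=
  (1 / 2) * Matrix.trace
    (1 - (F.RDes k).1ᵀ * (rot (x (F.head k)))ᵀ * rot (x (F.tail k)))

/-- The vector `e_{R_k}`. -/
def eR (x : Fin N → SE3) (k : Fin K) : E3 :=
  vee ((rot (x (F.tail k)))ᵀ * rot (x (F.head k)) * (F.RDes k).1 -
    (F.RDes k).1ᵀ * (rot (x (F.head k)))ᵀ * rot (x (F.tail k)))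

/-- The matrix `α(i, k, R_{k₁}, R_{k₂})`. -/
def alpha (x : Fin N → SE3) (i : Fin N) (k : Fin K) : Matrix (Fin 3) (Fin 3) ℝ :=
  if i = F.tail k then -1
  else if i = F.head k then (rot (x (F.head k)))ᵀ * rot (x (F.tail k))
  else 0

/-- The transformation `T_{e_k}`, used on `(-C_{k,col}, C_{k,con})`. -/
def TE (k : Fin K) (y : ℝ) : ℝ := Real.log ((1 + y / F.CCol k) / (1 - y / F.CCon k))

/-- `r_{e_k}`, the derivative of `T_{e_k}`. -/
def rE (k : Fin K) (y : ℝ) : ℝ := deriv (F.TE k) y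

end Formation

/-- The transformation `T_ψ`, used on `[0, 1)`. -/
def TPsi (y : ℝ) : ℝ := Real.log (1 / (1 - y))

/-- `r_ψ`, the derivative of `T_ψ`. -/
def rPsi (y : ℝ) : ℝ := deriv TPsi y

/-- The transformation `T_v`, used on `(-1, 1)`. -/
def TV (y : ℝ) : ℝ := Real.log ((1 + y) / (1 - y))

/-- `r_v`, the derivative of `T_v`. -/
def rV (y : ℝ) : ℝ := deriv TV y

namespace Design

variable {N K : ℕ} (D : Design N K) (F : Formation N K)

/-- Constraints on the design parameters that do not involve the initial state. -/
structure Admissible : Prop where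
  rhoEInf_pos : ∀ k, 0 < D.rhoEInf k
  rhoEInf_lt : ∀ k, D.rhoEInf k < max (F.CCon k) (F.CCol k)
  lE_pos : ∀ k, 0 < D.lE k
  rhoPsiInf_pos : ∀ k, 0 < D.rhoPsiInf k
  rhoPsiInf_lt : ∀ k, D.rhoPsiInf k < D.rhoPsi0 k
  lPsi_pos : ∀ k, 0 < D.lPsi k
  rhoVInf_pos : ∀ i l, 0 < D.rhoVInf i l
  rhoVInf_lt : ∀ i l, D.rhoVInf i l < D.rhoV0 i l
  lV_pos : ∀ i l, 0 < D.lV i l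
  delta_pos : ∀ i, 0 < D.delta i
  gamma_pos : ∀ i, 0 < D.gamma i

/-- The performance function `ρ_{e_k}`. -/
def rhoE (k : Fin K) (t : ℝ) : ℝ :=
  (1 - D.rhoEInf k / max (F.CCon k) (F.CCol k)) * Real.exp (-D.lE k * t) +
    D.rhoEInf k / max (F.CCon k) (F.CCol k)

/-- The performance function `ρ_{ψ_k}`. -/
def rhoPsi (k : Fin K) (t : ℝ) : ℝ :=
  (D.rhoPsi0 k - D.rhoPsiInf k) * Real.exp (-D.lPsi k * t) + D.rhoPsiInf k

/-- The performance function `ρ_{v_{i,ℓ}}`. -/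
def rhoV (i : Fin N) (l : Idx6) (t : ℝ) : ℝ :=
  (D.rhoV0 i l - D.rhoVInf i l) * Real.exp (-D.lV i l * t) + D.rhoVInf i l

/-- The normalized distance error `ξ_{e_k}`. -/
def xiE (x : Fin N → SE3) (t : ℝ) (k : Fin K) : ℝ := (D.rhoE F k t)⁻¹ * F.e x k

/-- The normalized orientation error `ξ_{ψ_k}`. -/
def xiPsi (x : Fin N → SE3) (t : ℝ) (k : Fin K) : ℝ := (D.rhoPsi k t)⁻¹ * F.psi x k

/-- The transformed distance error `ε_{e_k}`. -/
def epsE (x : Fin N → SE3) (t : ℝ) (k : Fin K) : ℝ := F.TE k (D.xiE F x t k)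

/-- The transformed orientation error `ε_{ψ_k}`. -/
def epsPsi (x : Fin N → SE3) (t : ℝ) (k : Fin K) : ℝ := TPsi (D.xiPsi F x t k)

/-- The desired linear velocity `v_{i,L des}`. -/
def vLDes (x : Fin N → SE3) (t : ℝ) (i : Fin N) : E3 :=
  -(D.delta i) • (2 : ℝ) • ∑ k, (F.rE k (D.xiE F x t k) / D.rhoE F k t * D.epsE F x t k) •
    act (F.alpha x i k) (act (rot (x (F.tail k)))ᵀ (F.rel x k))

/-- The desired angular velocity `ω_{i,des}`. -/
def omegaDes (x : Fin N → SE3) (t : ℝ) (i : Fin N) : E3 :=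
  -(D.delta i) • ∑ k, (rPsi (D.xiPsi F x t k) / D.rhoPsi k t) • act (F.alpha x i k) (F.eR x k)

/-- The desired velocity `v_{i,des}`. -/
def vDes (x : Fin N → SE3) (t : ℝ) (i : Fin N) : V6 :=
  stack (D.vLDes F x t i) (D.omegaDes F x t i)

/-- The velocity error `e_{v_i}`, from the measured velocity `vm` of agent `i`. -/
def eV (x : Fin N → SE3) (vm : V6) (t : ℝ) (i : Fin N) : V6 := vm - D.vDes F x t i

/-- The normalized velocity error `ξ_{v_{i,ℓ}}`. -/
def xiV (x : Fin N → SE3) (vm : V6) (t : ℝ) (i : Fin N) (l : Idx6) : ℝ :=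
  (D.rhoV i l t)⁻¹ * D.eV F x vm t i l

/-- The transformed velocity error `ε_{v_{i,ℓ}}`. -/
def epsV (x : Fin N → SE3) (vm : V6) (t : ℝ) (i : Fin N) (l : Idx6) : ℝ :=
  TV (D.xiV F x vm t i l)

/-- The control input `u_i`, from the measured velocity `vm` of agent `i`. -/
def u (x : Fin N → SE3) (vm : V6) (t : ℝ) (i : Fin N) : V6 :=
  WithLp.toLp 2 fun l =>
    -(D.gamma i) * ((D.rhoV i l t)⁻¹ * (rV (D.xiV F x vm t i l) * D.epsV F x vm t i l))

end Design

/-- The measured velocity `ṽ_i = v_i + n_i(x_i, t)`. -/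
def RigidBody.meas (B : RigidBody) (x : SE3) (v : V6) (t : ℝ) : V6 := v + B.n x t

/-- `(x, v)` solves the closed-loop system at all times in `J`, where `J` is `[0, T)` or `[0, ∞)`:
`ẋ_i = (R_i v_{i,L}, R_i S(ω_i))` and `M_i v̇_i + C_i(v_i) v_i + g_i(x_i) + w_i(x_i, v_i, t) = u_i`.
It is not required that the errors stay in the domains of the transformations. -/
def IsClosedLoopSolution {N K : ℕ} (B : Fin N → RigidBody) (F : Formation N K) (D : Design N K)
    (J : Set ℝ) (x : ℝ → Fin N → SE3) (v : ℝ → Fin N → V6) : Prop :=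
  ∀ t ∈ J, ∀ i,
    HasBodyVelocity (fun s => x s i) (v t i) t ∧
    ∃ a : V6, HasDerivWithinAt (fun s => v s i) a (Ici 0) t ∧
      D.u F (x t) ((B i).meas (x t i) (v t i) t) t i =
        act (B i).M a + act ((B i).C (v t i)) (v t i) + (B i).g (x t i) +
          (B i).w (x t i) (v t i) t

end

/-! The proof nests two Lyapunov estimates. Their constants depend on the data and the initial state
but not on the length of the time interval.

Kinematic loop. While the normalized errors lie in the domains of the transformations, the velocity
funnel and the bounded noise keep each velocity within a fixed distance of the desired one. In the
world frame the desired velocity is a negative multiple of a signed sum of weighted edge vectors,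
with the incidence numbers as signs (`act_rot_vLDes`, `act_rot_omegaDes`). The same sum occurs in
the derivatives of the potentials `½ ∑ ε_e²` and `∑ ε_ψ`. On an acyclic graph the incidence map is
injective, hence bounded below (`exists_inc_coercive`), so up to a constant both potentials
dissipate the squared weighted edge vectors (`exists_dissipation`). These vectors do not degenerate:
a distance stays above the collision distance, and `‖e_R‖² = 4ψ(2 - ψ)` with `ψ < ρ_{ψ,0} < 2`.
Hence `V' ≤ -a V + b`, the transformed errors are bounded, and a bounded logarithm means a positive
distance to the boundary of the domain (`Design.exists_kinMargin`).

Velocity loop. With that margin the velocities and the derivatives of the desired velocities are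
bounded, so all terms in the derivative of the velocity error except `M⁻¹ u` are bounded. Since
`M⁻¹` is positive definite and `u` is `-γ` times the gradient of `½ ∑ ε_v²` in the velocity error,
this potential satisfies the same type of inequality (`Traj.exists_bound_epsV`). Continuous
induction then gives every solution a uniform margin, without assuming that it stays in the domains
(`IsClosedLoopSolution.exists_margin`). Performance and boundedness follow.

Existence. The right-hand side is only continuous, and only on the domain of the transformations.
The acceleration is extended from a closed set of safe states by Tietze's theorem, and the whole
field is multiplied by a scalar cutoff that makes it bounded (`exists_flatField`). Peano's theorem
gives a global solution, which may start with any prescribed solution on `[0, T)`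
(`exists_extension_of_bounded`). The rotations stay in `SO(3)` because the cutoff only rescales `R
S(ω)`. The a priori margin exceeds the one at which the field was modified, so the solution never
notices the modification and solves the original system (`exists_closedLoopSolution_extension`). -/

noncomputable section

/-! ### Peano's theorem for bounded continuous fields: global existence and extension. -/

section Peano

variable {E : Type*} [NormedAddCommGroup E] [NormedSpace ℝ E]

/-- Nodes of the explicit Euler scheme with step `h`. -/
def eulerNode (f : ℝ × E → E) (t₀ : ℝ) (z₀ : E) (h : ℝ) : ℕ → E
  | 0 => z₀
  | k + 1 => eulerNode f t₀ z₀ h k + h • f (t₀ + k * h, eulerNode f t₀ z₀ h k)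

/-- An increment of the Euler polygon is a sum of slopes times `h`, so slopes close to `c` give an
increment close to the linear one. With `c = 0` this is the Lipschitz bound, and with `c` the value
of the field at a limit point it gives the derivative. -/
theorem eulerNode_sub_le (f : ℝ × E → E) (t₀ : ℝ) (z₀ : E) {h : ℝ} (hh : 0 ≤ h) (c : E) {ε : ℝ}
    {m M : ℕ} (hmM : m ≤ M)
    (hc : ∀ k, m ≤ k → k < M → ‖f (t₀ + k * h, eulerNode f t₀ z₀ h k) - c‖ ≤ ε) :
    ‖eulerNode f t₀ z₀ h M - eulerNode f t₀ z₀ h m - (((M : ℝ) - m) * h) • c‖ ≤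
      ε * (((M : ℝ) - m) * h) := by
  induction M, hmM using Nat.le_induction with
  | base => simp
  | succ M hM ih =>
    have h1 := ih fun k hk hk' => hc k hk (hk'.trans M.lt_succ_self)
    have h2 := hc M hM M.lt_succ_self
    have : eulerNode f t₀ z₀ h (M + 1) - eulerNode f t₀ z₀ h m -
        ((((M + 1 : ℕ) : ℝ) - m) * h) • c =
        (eulerNode f t₀ z₀ h M - eulerNode f t₀ z₀ h m - (((M : ℝ) - m) * h) • c) +
        h • (f (t₀ + M * h, eulerNode f t₀ z₀ h M) - c) := by
      rw [eulerNode]; push_cast; module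
    rw [this]
    refine (norm_add_le _ _).trans ?_
    rw [norm_smul, Real.norm_of_nonneg hh]
    have := mul_le_mul_of_nonneg_left h2 hh
    push_cast
    nlinarith

/-- The Euler polygons lie in a compact ball at each time, so their limit along one fixed
ultrafilter exists at all times simultaneously. This replaces the extraction of a subsequence by
Arzelà–Ascoli. -/
theorem exists_solution_of_bounded [ProperSpace E] {f : ℝ × E → E} (hf : Continuous f) {M : ℝ}
    (hM : ∀ q, ‖f q‖ ≤ M) (t₀ : ℝ) (z₀ : E) :
    ∃ z : ℝ → E, z t₀ = z₀ ∧ ∀ t, t₀ ≤ t → HasDerivWithinAt z (f (t, z t)) (Ici t₀) t := by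
  have hM0 : 0 ≤ M := (norm_nonneg _).trans (hM (0, 0))
  set h : ℕ → ℝ := fun n => ((n : ℝ) + 1)⁻¹ with hh
  have hpos : ∀ n, 0 < h n := fun n => by positivity
  have hlim : Tendsto h atTop (𝓝 0) := by
    simpa [hh, one_div] using tendsto_one_div_add_atTop_nhds_zero_nat (𝕜 := ℝ)
  set y : ℕ → ℕ → E := fun n => eulerNode f t₀ z₀ (h n) with hy
  -- The number of steps of length `h n` that fit between `t₀` and `t`.
  set φ : ℕ → ℝ → ℕ := fun n t => ⌊(t - t₀) * ((n : ℝ) + 1)⌋₊ with hφ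
  have hφlim : ∀ t, t₀ ≤ t → Tendsto (fun n => (φ n t : ℝ) * h n) atTop (𝓝 (t - t₀)) := by
    intro t ht
    have := (tendsto_nat_floor_mul_div_atTop (R := ℝ) (sub_nonneg.2 ht)).comp
      (tendsto_natCast_atTop_atTop (R := ℝ) |>.comp (tendsto_add_atTop_nat 1))
    refine this.congr fun n => ?_
    simp [hφ, hh, div_eq_mul_inv]
  have hφle : ∀ n t, t₀ ≤ t → (φ n t : ℝ) * h n ≤ t - t₀ := by
    intro n t ht
    have := Nat.floor_le (a := (t - t₀) * ((n : ℝ) + 1))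
      (mul_nonneg (sub_nonneg.2 ht) (by positivity))
    calc (φ n t : ℝ) * h n ≤ (t - t₀) * ((n : ℝ) + 1) * h n :=
          mul_le_mul_of_nonneg_right this (hpos n).le
      _ = t - t₀ := by simp only [hh]; field_simp
  have hφge : ∀ n t, t - t₀ - h n ≤ (φ n t : ℝ) * h n := by
    intro n t
    have := (Nat.lt_floor_add_one ((t - t₀) * ((n : ℝ) + 1))).le
    have h2 := mul_le_mul_of_nonneg_right this (hpos n).le
    have h3 : (t - t₀) * ((n : ℝ) + 1) * h n = t - t₀ := by simp only [hh]; field_simp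
    rw [h3] at h2
    simp only [hφ]
    linarith
  have hlip : ∀ n a b, a ≤ b → ‖y n b - y n a‖ ≤ M * (((b : ℝ) - a) * h n) := by
    intro n a b hab
    simpa using eulerNode_sub_le f t₀ z₀ (hpos n).le 0 (ε := M) hab
      (fun k _ _ => by simpa using hM _)
  have hex : ∀ t, ∃ x, t₀ ≤ t → Tendsto (fun n => y n (φ n t)) (hyperfilter ℕ) (𝓝 x) := by
    intro t
    by_cases ht : t₀ ≤ t
    · obtain ⟨x, -, hx⟩ := (isCompact_closedBall z₀ (M * (t - t₀))).ultrafilter_le_nhds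
        ((hyperfilter ℕ).map fun n => y n (φ n t)) (by
          rw [le_principal_iff, Ultrafilter.coe_map, mem_map]
          refine Filter.mem_of_superset univ_mem fun n _ => ?_
          have := hlip n 0 (φ n t) (Nat.zero_le _)
          rw [Set.mem_preimage, Metric.mem_closedBall, dist_eq_norm]
          refine this.trans ?_
          have := hφle n t ht
          simpa using mul_le_mul_of_nonneg_left this hM0)
      exact ⟨x, fun _ => hx⟩
    · exact ⟨0, fun h => absurd h ht⟩
  choose z hz using hex
  have hz0 : z t₀ = z₀ := by
    refine tendsto_nhds_unique (hz t₀ le_rfl) ?_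
    simp only [hφ, sub_self, zero_mul, Nat.floor_zero]
    exact tendsto_const_nhds
  refine ⟨z, hz0, fun t ht => ?_⟩
  set c := f (t, z t) with hc
  -- Near `(t, z t)` all Euler slopes are within `ε` of `c`, and the resulting estimate for
  -- increments passes to the limit. Both endpoints are free because `s` may lie on either side of
  -- `t`.
  have key : ∀ ε > 0, ∃ δ > 0, ∀ a b, t₀ ≤ a → a ≤ b → |a - t| < δ → |b - t| < δ →
      ‖z b - z a - (b - a) • c‖ ≤ ε * (b - a) := by
    intro ε hε
    obtain ⟨δ₁, hδ₁, hδ⟩ := Metric.continuous_iff.1 hf (t, z t) ε hε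
    -- The nodes involved are within `2δ` of `t` in time, so within `2Mδ < δ₁/2` of the node for
    -- `t`, which in turn is within `δ₁/2` of `z t`.
    refine ⟨δ₁ / (4 * (M + 1)), by positivity, fun a b ha hab hat hbt => ?_⟩
    set δ := δ₁ / (4 * (M + 1)) with hδd
    have hδpos : 0 < δ := by positivity
    have hδM : 4 * (M + 1) * δ = δ₁ := by rw [hδd]; field_simp
    have hb : t₀ ≤ b := ha.trans hab
    have hU := Nat.hyperfilter_le_atTop
    have hτ := ((hφlim b hb).mono_left hU).sub ((hφlim a ha).mono_left hU)
    have hL := (((hz b hb).sub (hz a ha)).sub (hτ.smul_const c)).norm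
    have hR := hτ.const_mul ε
    have hba : b - t₀ - (a - t₀) = b - a := by ring
    rw [hba] at hL hR
    refine le_of_tendsto_of_tendsto hL hR ?_
    have e1 : ∀ᶠ n in (hyperfilter ℕ : Filter ℕ), h n < δ / 2 :=
      hU (hlim.eventually (gt_mem_nhds (by positivity)))
    have e2 : ∀ᶠ n in (hyperfilter ℕ : Filter ℕ), dist (y n (φ n t)) (z t) < δ₁ / 2 :=
      (hz t ht).eventually (Metric.ball_mem_nhds _ (by positivity))
    filter_upwards [e1, e2] with n hn1 hn2
    have hmono : φ n a ≤ φ n b := by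
      apply Nat.floor_le_floor
      exact mul_le_mul_of_nonneg_right (by linarith) (by positivity)
    have := eulerNode_sub_le f t₀ z₀ (hpos n).le c (ε := ε) hmono (fun k hk hk' => ?_)
    · have e : ((φ n b : ℝ) - φ n a) * h n = φ n b * h n - φ n a * h n := by ring
      rw [e] at this
      exact this
    · rw [abs_lt] at hat hbt
      have hkl : (φ n a : ℝ) * h n ≤ k * h n :=
        mul_le_mul_of_nonneg_right (by exact_mod_cast hk) (hpos n).le
      have hku : (k : ℝ) * h n ≤ φ n b * h n :=
        mul_le_mul_of_nonneg_right (by exact_mod_cast hk'.le) (hpos n).le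
      have hb' := hφle n b hb
      have ha' := hφge n a
      have ht1 := hφle n t ht
      have ht2 := hφge n t
      have hn0 := hpos n
      have hk1 : |t₀ + k * h n - t| < 2 * δ := abs_lt.2 ⟨by linarith, by linarith⟩
      have hyk : ‖y n k - y n (φ n t)‖ ≤ M * (2 * δ) := by
        rcases le_total (φ n t) k with hle | hle
        · refine (hlip n _ _ hle).trans (mul_le_mul_of_nonneg_left ?_ hM0)
          rw [sub_mul]; linarith
        · rw [norm_sub_rev]
          refine (hlip n _ _ hle).trans (mul_le_mul_of_nonneg_left ?_ hM0)
          rw [sub_mul]; linarith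
      have := hδ (t₀ + k * h n, y n k) (by
        rw [Prod.dist_eq, max_lt_iff]
        constructor
        · rw [Real.dist_eq]; nlinarith
        · refine (dist_triangle _ (y n (φ n t)) _).trans_lt ?_
          rw [dist_eq_norm (y n k)]
          nlinarith)
      rw [dist_eq_norm] at this
      exact this.le
  rw [hasDerivWithinAt_iff_isLittleO, Asymptotics.isLittleO_iff]
  intro ε hε
  obtain ⟨δ, hδ, H⟩ := key ε hε
  rw [eventually_nhdsWithin_iff]
  filter_upwards [Metric.ball_mem_nhds t hδ] with s hs hs0
  rw [Metric.mem_ball, Real.dist_eq] at hs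
  have htt : |t - t| < δ := by simpa using hδ
  rcases le_total t s with hle | hle
  · have := H t s ht hle htt hs
    rwa [Real.norm_of_nonneg (sub_nonneg.2 hle)]
  · have := H s t hs0 hle hs htt
    have e : z s - z t - (s - t) • c = -(z t - z s - (t - s) • c) := by module
    rwa [Real.norm_of_nonpos (sub_nonpos.2 hle), e, norm_neg, neg_sub]

theorem exists_extension_of_bounded [FiniteDimensional ℝ E] {f : ℝ × E → E} (hf : Continuous f)
    {M : ℝ} (hM : ∀ q, ‖f q‖ ≤ M) {T : ℝ} (hT : 0 ≤ T) {z₁ : ℝ → E}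
    (h₁ : ∀ t ∈ Ico 0 T, HasDerivWithinAt z₁ (f (t, z₁ t)) (Ici 0) t) :
    ∃ z : ℝ → E, z 0 = z₁ 0 ∧ EqOn z z₁ (Ico 0 T) ∧
      ∀ t, 0 ≤ t → HasDerivWithinAt z (f (t, z t)) (Ici 0) t := by
  have : ProperSpace E := FiniteDimensional.proper ℝ E
  rcases hT.eq_or_lt with rfl | hT
  · obtain ⟨z, hz0, hz⟩ := exists_solution_of_bounded hf hM 0 (z₁ 0)
    exact ⟨z, hz0, by simp, hz⟩
  -- A bounded derivative makes the given solution Lipschitz, so it has a limit at `T`, from which a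
  -- new solution is started.
  have hlip : LipschitzOnWith M.toNNReal z₁ (Ico 0 T) :=
    (convex_Ico 0 T).lipschitzOnWith_of_nnnorm_hasDerivWithin_le
      (fun t ht => (h₁ t ht).mono Ico_subset_Ici_self) (fun t ht => by
        rw [← norm_toNNReal]; exact Real.toNNReal_le_toNNReal (hM _))
  obtain ⟨g, hg, hgz⟩ := hlip.extend_finite_dimension
  obtain ⟨z₂, hz₂T, hz₂⟩ := exists_solution_of_bounded hf hM T (g T)
  set z : ℝ → E := fun t => if t < T then g t else z₂ t with hz
  have hzl : ∀ t, t < T → z t = g t := fun t ht => if_pos ht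
  have hzr : ∀ t, T ≤ t → z t = z₂ t := fun t ht => if_neg ht.not_gt
  have hleft : ∀ t ∈ Ico 0 T, HasDerivWithinAt z (f (t, z t)) (Ici 0) t := by
    intro t ht
    have e : z t = z₁ t := (hzl t ht.2).trans (hgz ht).symm
    rw [e]
    refine (h₁ t ht).congr_of_eventuallyEq ?_ e
    filter_upwards [self_mem_nhdsWithin, mem_nhdsWithin_of_mem_nhds (Iio_mem_nhds ht.2)]
      with s hs hs'
    exact (hzl s hs').trans (hgz ⟨hs, hs'⟩).symm
  have hright : ∀ t, T ≤ t → HasDerivWithinAt z (f (t, z t)) (Ici T) t := by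
    intro t ht
    rw [hzr t ht]
    exact (hz₂ t ht).congr (fun s hs => hzr s hs) (hzr t ht)
  have hzT : z T = g T := (hzr T le_rfl).trans hz₂T
  have hcont : ContinuousWithinAt z (Iio T) T :=
    (hg.continuous.continuousWithinAt (s := Iio T) (x := T)).congr (fun s hs => hzl s hs) hzT
  -- At the junction the left derivative is the limit of the derivatives before `T`, by continuity
  -- of `f`.
  have hT' : HasDerivWithinAt z (f (T, z T)) (Iic T) T := by
    refine hasDerivWithinAt_Iic_of_tendsto_deriv (s := Ioo 0 T) ?_
      (hcont.mono fun s hs => hs.2) (Ioo_mem_nhdsLT hT) ?_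
    · intro t ht
      exact ((hleft t ⟨ht.1.le, ht.2⟩).differentiableWithinAt).mono
        (fun s hs => hs.1.le)
    · have : Tendsto (fun t => f (t, z t)) (𝓝[<] T) (𝓝 (f (T, z T))) :=
        (hf.tendsto _).comp (Tendsto.prodMk_nhds
          (tendsto_id.mono_left nhdsWithin_le_nhds) hcont)
      refine this.congr' ?_
      filter_upwards [Ioo_mem_nhdsLT hT] with t ht
      exact ((hleft t ⟨ht.1.le, ht.2⟩).hasDerivAt (Ici_mem_nhds ht.1)).deriv.symm
  refine ⟨z, (hzl 0 hT).trans (hgz ⟨le_rfl, hT⟩).symm,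
    fun t ht => (hzl t ht.2).trans (hgz ht).symm, fun t ht => ?_⟩
  rcases lt_trichotomy t T with h | rfl | h
  · exact hleft t ⟨ht, h⟩
  · exact (hT'.union (hright t le_rfl)).mono fun s _ => le_total s t
  · exact ((hright t h.le).hasDerivAt (Ici_mem_nhds h)).hasDerivWithinAt

end Peano

/-! ### A scalar comparison lemma and continuous induction on an interval. -/

theorem le_max_of_deriv_le {V V' : ℝ → ℝ} {τ a b : ℝ} (ha : 0 < a)
    (hV : ∀ t ∈ Ico 0 τ, HasDerivWithinAt V (V' t) (Ici 0) t)
    (hle : ∀ t ∈ Ico 0 τ, V' t ≤ -a * V t + b) :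
    ∀ t ∈ Ico 0 τ, V t ≤ max (V 0) (b / a) + 1 := by
  intro t ht
  have hsub : ∀ s ∈ Icc 0 t, s ∈ Ico 0 τ := fun s hs => ⟨hs.1, hs.2.trans_lt ht.2⟩
  -- The summand `1` puts the barrier strictly above `b / a`, so `V' < 0` wherever `V` meets it.
  refine image_le_of_deriv_right_lt_deriv_boundary' (f := V) (f' := V') (a := 0) (b := t)
    (B := fun _ => max (V 0) (b / a) + 1) (B' := fun _ => 0) ?_ ?_ ?_ continuousOn_const
    (fun _ _ => hasDerivWithinAt_const ..) ?_ ⟨ht.1, le_rfl⟩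
  · exact fun s hs => ((hV s (hsub s hs)).continuousWithinAt).mono Icc_subset_Ici_self
  · exact fun s hs => (hV s (hsub s (Ico_subset_Icc_self hs))).mono (Ici_subset_Ici.2 hs.1)
  · linarith [le_max_left (V 0) (b / a)]
  · intro s hs hVs
    have h1 := hle s (hsub s (Ico_subset_Icc_self hs))
    have h2 := le_max_right (V 0) (b / a)
    have h3 : b / a < V s := by linarith
    rw [div_lt_iff₀ ha] at h3
    linarith

theorem forall_Ico_of_continuous_induction {P : ℝ → Prop} {T : ℝ} (h0 : P 0)
    (hstep : ∀ t ∈ Ioo 0 T, (∀ s ∈ Ico 0 t, P s) → P t)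
    (hopen : ∀ t ∈ Ico 0 T, P t → ∀ᶠ s in 𝓝[Ici 0] t, P s) : ∀ t ∈ Ico 0 T, P t := by
  by_contra! H
  obtain ⟨t₁, ht₁, hPt₁⟩ := H
  set A : Set ℝ := {t | t ∈ Ico 0 T ∧ ¬ P t} with hA
  have hbdd : BddBelow A := ⟨0, fun t ht => ht.1.1⟩
  have hne : A.Nonempty := ⟨t₁, ht₁, hPt₁⟩
  -- At the first failure time, `hstep` gives `P` there and `hopen` a little beyond, which
  -- contradicts the infimum.
  set τ := sInf A with hτ
  have hτ0 : 0 ≤ τ := le_csInf hne fun t ht => ht.1.1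
  have hτT : τ < T := (csInf_le hbdd ⟨ht₁, hPt₁⟩).trans_lt ht₁.2
  have hlt : ∀ s ∈ Ico 0 τ, P s := fun s hs => by
    by_contra h
    exact (csInf_le hbdd ⟨⟨hs.1, hs.2.trans hτT⟩, h⟩).not_gt hs.2
  have hPτ : P τ := by
    rcases hτ0.eq_or_lt with h | h
    · rwa [← h]
    · exact hstep τ ⟨h, hτT⟩ hlt
  have hev := hopen τ ⟨hτ0, hτT⟩ hPτ
  rw [eventually_nhdsWithin_iff, Metric.eventually_nhds_iff] at hev
  obtain ⟨δ, hδ, hev⟩ := hev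
  obtain ⟨s, hs, hsδ⟩ := exists_lt_of_csInf_lt hne (lt_add_of_pos_right τ hδ)
  have hτs : τ ≤ s := csInf_le hbdd hs
  refine hs.2 (hev ?_ hs.1.1)
  rw [Real.dist_eq, abs_lt]
  constructor <;> linarith

/-! ### Matrices acting on Euclidean vectors, and identities for rotations. -/

section Act

variable {ι : Type} [Fintype ι]

theorem act_add (A : Matrix ι ι ℝ) (y z : EuclideanSpace ℝ ι) :
    act A (y + z) = act A y + act A z := by
  ext a; simp [act, Matrix.mulVec_add]

theorem act_smul (A : Matrix ι ι ℝ) (c : ℝ) (y : EuclideanSpace ℝ ι) :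
    act A (c • y) = c • act A y := by
  ext a; simp [act, Matrix.mulVec_smul]

theorem act_zero (A : Matrix ι ι ℝ) : act A (0 : EuclideanSpace ℝ ι) = 0 := by
  ext a; simp [act]

theorem act_neg (A : Matrix ι ι ℝ) (y : EuclideanSpace ℝ ι) : act A (-y) = -act A y := by
  ext a; simp [act, Matrix.mulVec_neg]

theorem act_sub (A : Matrix ι ι ℝ) (y z : EuclideanSpace ℝ ι) :
    act A (y - z) = act A y - act A z := by
  rw [sub_eq_add_neg, act_add, act_neg, ← sub_eq_add_neg]

theorem act_sum {κ : Type*} (A : Matrix ι ι ℝ) (s : Finset κ) (y : κ → EuclideanSpace ℝ ι) :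
    act A (∑ k ∈ s, y k) = ∑ k ∈ s, act A (y k) := by
  classical
  induction s using Finset.induction_on with
  | empty => simp [act_zero]
  | insert a s ha ih => rw [Finset.sum_insert ha, Finset.sum_insert ha, act_add, ih]

theorem act_act (A B : Matrix ι ι ℝ) (y : EuclideanSpace ℝ ι) :
    act A (act B y) = act (A * B) y := by
  ext a; simp [act]

theorem act_one [DecidableEq ι] (y : EuclideanSpace ℝ ι) : act (1 : Matrix ι ι ℝ) y = y := by
  ext a; simp [act]

theorem act_apply (A : Matrix ι ι ℝ) (y : EuclideanSpace ℝ ι) (a : ι) :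
    act A y a = ∑ b, A a b * y b := rfl

theorem inner_act (A : Matrix ι ι ℝ) (y z : EuclideanSpace ℝ ι) :
    inner ℝ (act A y) z = inner ℝ y (act Aᵀ z) := by
  simp only [PiLp.inner_apply, act_apply, RCLike.inner_apply, conj_trivial, Finset.mul_sum,
    Finset.sum_mul, Matrix.transpose_apply]
  rw [Finset.sum_comm]
  exact Finset.sum_congr rfl fun _ _ => Finset.sum_congr rfl fun _ _ => by ring

end Act

theorem norm_sq_V6 (v : V6) : ‖v‖ ^ 2 = ‖lin v‖ ^ 2 + ‖ang v‖ ^ 2 := by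
  simp [EuclideanSpace.norm_sq_eq, lin, ang]

theorem norm_lin_le (v : V6) : ‖lin v‖ ≤ ‖v‖ := by
  have := norm_sq_V6 v
  exact abs_le_of_sq_le_sq' (by nlinarith [sq_nonneg ‖ang v‖]) (norm_nonneg _) |>.2

theorem norm_ang_le (v : V6) : ‖ang v‖ ≤ ‖v‖ := by
  have := norm_sq_V6 v
  exact abs_le_of_sq_le_sq' (by nlinarith [sq_nonneg ‖lin v‖]) (norm_nonneg _) |>.2

namespace SO3

variable (R : SO3)

theorem mul_transpose : R.1 * R.1ᵀ = 1 :=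
  (Matrix.mem_orthogonalGroup_iff (Fin 3) ℝ).1 (Matrix.mem_specialOrthogonalGroup_iff.1 R.2).1

theorem transpose_mul : R.1ᵀ * R.1 = 1 :=
  mul_eq_one_comm.1 (mul_transpose R)

theorem det_eq_one : R.1.det = 1 := (Matrix.mem_specialOrthogonalGroup_iff.1 R.2).2

theorem norm_act (y : E3) : ‖act R.1 y‖ = ‖y‖ := by
  have : ‖act R.1 y‖ ^ 2 = ‖y‖ ^ 2 := by
    rw [← real_inner_self_eq_norm_sq, inner_act, act_act, transpose_mul, act_one,
      real_inner_self_eq_norm_sq]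
  exact (sq_eq_sq₀ (norm_nonneg _) (norm_nonneg _)).1 this

theorem adjugate_eq : R.1.adjugate = R.1ᵀ := by
  have h := Matrix.mul_adjugate R.1
  rw [det_eq_one, one_smul] at h
  calc R.1.adjugate = R.1ᵀ * R.1 * R.1.adjugate := by rw [transpose_mul, one_mul]
    _ = R.1ᵀ := by rw [mul_assoc, h, mul_one]

theorem row_sq (a : Fin 3) : R.1 a 0 ^ 2 + R.1 a 1 ^ 2 + R.1 a 2 ^ 2 = 1 := by
  have := congrFun (congrFun (mul_transpose R) a) a
  simp only [Matrix.mul_apply, Fin.sum_univ_three, Matrix.transpose_apply,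
    Matrix.one_apply_eq] at this
  linarith

theorem abs_apply_le (a b : Fin 3) : |R.1 a b| ≤ 1 := by
  have := row_sq R a
  rw [abs_le_one_iff_mul_self_le_one]
  fin_cases b <;> simp <;> nlinarith [sq_nonneg (R.1 a 0), sq_nonneg (R.1 a 1), sq_nonneg (R.1 a 2)]

theorem abs_mul_skew_apply_le {w : E3} {b : ℝ} (hw : ‖w‖ ≤ b) (a a' : Fin 3) :
    |(R.1 * skew w) a a'| ≤ 2 * b := by
  have hm : ∀ c d, |R.1 a c * w d| ≤ b := fun c d => by
    rw [abs_mul]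
    simpa using mul_le_mul (abs_apply_le R a c) ((PiLp.norm_apply_le w d).trans hw) (abs_nonneg _)
      zero_le_one
  rw [Matrix.mul_apply, Fin.sum_univ_three]
  have h00 := fun c d => abs_le.1 (hm c d)
  fin_cases a' <;> simp [skew] <;> rw [abs_le] <;>
  · constructor <;> linarith [(h00 0 1).1, (h00 0 2).1, (h00 1 0).1, (h00 1 2).1, (h00 2 0).1,
      (h00 2 1).1, (h00 0 1).2, (h00 0 2).2, (h00 1 0).2, (h00 1 2).2, (h00 2 0).2, (h00 2 1).2]

theorem cofactor (a b : Fin 3) : R.1.adjugate b a = R.1 a b := by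
  rw [adjugate_eq]; rfl

/-- The off-diagonal entries are cross products of rows of `R` paired with `x`. For a rotation these
cross products are again rows, since the cofactor matrix equals `R`. -/
theorem conj_skew (x : E3) : R.1 * skew x * R.1ᵀ = skew (act R.1 x) := by
  have h := cofactor R
  simp only [Matrix.adjugate_fin_three] at h
  have h00 := h 0 0
  have h01 := h 0 1
  have h02 := h 0 2
  have h10 := h 1 0
  have h11 := h 1 1
  have h12 := h 1 2
  have h20 := h 2 0
  have h21 := h 2 1
  have h22 := h 2 2
  simp at h00 h01 h02 h10 h11 h12 h20 h21 h22
  have e0 : act R.1 x 0 = R.1 0 0 * x 0 + R.1 0 1 * x 1 + R.1 0 2 * x 2 := by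
    simp [act_apply, Fin.sum_univ_three]
  have e1 : act R.1 x 1 = R.1 1 0 * x 0 + R.1 1 1 * x 1 + R.1 1 2 * x 2 := by
    simp [act_apply, Fin.sum_univ_three]
  have e2 : act R.1 x 2 = R.1 2 0 * x 0 + R.1 2 1 * x 1 + R.1 2 2 * x 2 := by
    simp [act_apply, Fin.sum_univ_three]
  ext a b
  fin_cases a <;> fin_cases b <;>
    simp [skew, Matrix.mul_apply, Fin.sum_univ_three, e0, e1, e2]
  · ring
  · linear_combination (-x 0) * h20 - x 1 * h21 - x 2 * h22
  · linear_combination x 0 * h10 + x 1 * h11 + x 2 * h12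
  · linear_combination x 0 * h20 + x 1 * h21 + x 2 * h22
  · ring
  · linear_combination (-x 0) * h00 - x 1 * h01 - x 2 * h02
  · linear_combination (-x 0) * h10 - x 1 * h11 - x 2 * h12
  · linear_combination x 0 * h00 + x 1 * h01 + x 2 * h02
  · ring

theorem vee_conj {A : Matrix (Fin 3) (Fin 3) ℝ} (hA : Aᵀ = -A) :
    vee (R.1 * A * R.1ᵀ) = act R.1 (vee A) := by
  conv_lhs => rw [← skew_vee A hA]
  rw [conj_skew, vee_skew]

/-- With rotation angle `θ` the trace is `1 + 2 cos θ` and both sides are `4 sin² θ`. Algebraically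
it follows from the unit rows and the diagonal cofactor identities. -/
theorem norm_sq_vee : ‖vee (R.1ᵀ - R.1)‖ ^ 2 = (3 - R.1.trace) * (1 + R.1.trace) := by
  have h := cofactor R
  simp only [Matrix.adjugate_fin_three] at h
  have h00 := h 0 0
  have h11 := h 1 1
  have h22 := h 2 2
  simp at h00 h11 h22
  simp only [EuclideanSpace.norm_sq_eq, Fin.sum_univ_three, vee, Matrix.trace_fin_three]
  simp
  linear_combination row_sq R 0 + row_sq R 1 + row_sq R 2 + 2 * h00 + 2 * h11 + 2 * h22

theorem trace_le : R.1.trace ≤ 3 := by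
  rw [Matrix.trace_fin_three]
  linarith [(abs_le.1 (abs_apply_le R 0 0)).2, (abs_le.1 (abs_apply_le R 1 1)).2,
    (abs_le.1 (abs_apply_le R 2 2)).2]

/-- The transpose of a rotation matrix, as a rotation. -/
def tr (R : SO3) : SO3 := ⟨R.1ᵀ, Matrix.mem_specialOrthogonalGroup_iff.2
  ⟨(Matrix.mem_orthogonalGroup_iff (Fin 3) ℝ).2 (by
    exact (Matrix.transpose_transpose R.1).symm ▸ transpose_mul R),
    by rw [Matrix.det_transpose]; exact det_eq_one R⟩⟩

end SO3

theorem trace_mul_skew (A : Matrix (Fin 3) (Fin 3) ℝ) (w : E3) :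
    (A * skew w).trace = inner ℝ (vee (Aᵀ - A)) w := by
  simp [Matrix.trace_fin_three, Matrix.mul_apply, Fin.sum_univ_three, skew, vee,
    PiLp.inner_apply]
  ring

theorem transpose_skew (w : E3) : (skew w)ᵀ = -skew w := by
  ext a b
  fin_cases a <;> fin_cases b <;> simp [skew]

/-! ### The incidence map of a tree and its coercivity. -/

namespace Formation

variable {N K : ℕ} (F : Formation N K)

/-- The entries of the incidence matrix of the oriented sensing graph. -/
def inc (i : Fin N) (k : Fin K) : ℝ :=
  (if i = F.head k then 1 else 0) - (if i = F.tail k then 1 else 0)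

theorem sum_inc_smul {E : Type*} [AddCommGroup E] [Module ℝ E] (k : Fin K) (z : Fin N → E) :
    ∑ i, F.inc i k • z i = z (F.head k) - z (F.tail k) := by
  simp [inc, sub_smul, Finset.sum_sub_distrib, ite_smul]

theorem tail_ne_head {G : SimpleGraph (Fin N)} (hFG : F.Orients G) (k : Fin K) :
    F.tail k ≠ F.head k := by
  have : s(F.tail k, F.head k) ∈ G.edgeSet := hFG.2 ▸ ⟨k, rfl⟩
  exact G.ne_of_adj this

/-- Think of `y` as a flow that is conserved at each vertex. Every edge of an acyclic graph is a
bridge, and the net flow out of one side of a bridge is the flow through the bridge alone, so it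
vanishes. -/
theorem eq_zero_of_inc {G : SimpleGraph (Fin N)} (hG : G.IsAcyclic) (hFG : F.Orients G)
    (y : Fin K → E3) (hy : ∀ i, ∑ k, F.inc i k • y k = 0) (k₀ : Fin K) : y k₀ = 0 := by
  classical
  set G' := G.deleteEdges {s(F.tail k₀, F.head k₀)} with hG'
  have hmem : ∀ k, s(F.tail k, F.head k) ∈ G.edgeSet := fun k => hFG.2 ▸ ⟨k, rfl⟩
  have hbr : ¬ G'.Reachable (F.tail k₀) (F.head k₀) :=
    SimpleGraph.isBridge_iff.1 (SimpleGraph.isAcyclic_iff_forall_isBridge.1 hG (hmem k₀))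
  -- The indicator of the component of `head k₀` after `k₀` is removed. It is constant along all
  -- other edges, so testing the conservation law with it leaves only the term of `k₀`.
  set φ : Fin N → ℝ := fun i => if G'.Reachable (F.head k₀) i then 1 else 0 with hφ
  have h1 : ∑ i, φ i • ∑ k, F.inc i k • y k = 0 := by simp [hy]
  have h2 : ∑ i, φ i • ∑ k, F.inc i k • y k = ∑ k, (φ (F.head k) - φ (F.tail k)) • y k := by
    simp only [Finset.smul_sum]
    rw [Finset.sum_comm]
    refine Finset.sum_congr rfl fun k _ => ?_
    rw [← F.sum_inc_smul k φ, Finset.sum_smul]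
    exact Finset.sum_congr rfl fun i _ => by rw [smul_smul, smul_eq_mul, mul_comm]
  rw [h2, Finset.sum_eq_single k₀] at h1
  · have e1 : φ (F.head k₀) = 1 := if_pos (SimpleGraph.Reachable.refl _)
    have e2 : φ (F.tail k₀) = 0 := if_neg fun h => hbr h.symm
    simpa [e1, e2] using h1
  · intro k _ hk
    have hadj : G'.Adj (F.tail k) (F.head k) := by
      rw [hG', SimpleGraph.deleteEdges_adj]
      exact ⟨hmem k, fun h => hk (hFG.1 h)⟩
    have : φ (F.head k) = φ (F.tail k) := by
      simp only [hφ]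
      congr 1
      exact propext ⟨fun h => h.trans hadj.reachable.symm, fun h => h.trans hadj.reachable⟩
    rw [this, sub_self, zero_smul]
  · simp

theorem exists_inc_coercive {G : SimpleGraph (Fin N)} (hG : G.IsAcyclic) (hFG : F.Orients G) :
    ∃ c > 0, ∀ y : Fin K → E3,
      c * ∑ k, ‖y k‖ ^ 2 ≤ ∑ i, ‖∑ k, F.inc i k • y k‖ ^ 2 := by
  set L : (Fin K → E3) →ₗ[ℝ] (Fin N → E3) :=
    LinearMap.pi fun i => ∑ k, F.inc i k • LinearMap.proj k with hL
  have hLa : ∀ y i, L y i = ∑ k, F.inc i k • y k := fun y i => by simp [hL]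
  have hker : LinearMap.ker L = ⊥ := by
    rw [LinearMap.ker_eq_bot']
    intro y hy
    funext k
    exact F.eq_zero_of_inc hG hFG y (fun i => by rw [← hLa, hy]; rfl) k
  obtain ⟨C, hC, hanti⟩ := L.exists_antilipschitzWith hker
  have hC' : (0 : ℝ) < C := hC
  -- The norm on `Fin K → E3` is the supremum norm, so passing to the sum of squares costs a factor
  -- `K`. Using `K + 1` keeps the constant positive when there are no edges.
  refine ⟨((K + 1) * C ^ 2 : ℝ)⁻¹, by positivity, fun y => ?_⟩
  rw [inv_mul_le_iff₀ (by positivity)]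
  have h1 : ‖y‖ ≤ C * ‖L y‖ := by simpa [dist_eq_norm] using hanti.le_mul_dist y 0
  have h2 : ∑ k, ‖y k‖ ^ 2 ≤ (K + 1) * ‖y‖ ^ 2 := by
    calc ∑ k, ‖y k‖ ^ 2 ≤ ∑ _k : Fin K, ‖y‖ ^ 2 :=
          Finset.sum_le_sum fun k _ => by gcongr; exact norm_le_pi_norm y k
      _ = K * ‖y‖ ^ 2 := by simp
      _ ≤ _ := by nlinarith [sq_nonneg ‖y‖]
  have h3 : ‖L y‖ ^ 2 ≤ ∑ i, ‖L y i‖ ^ 2 := by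
    have hs : 0 ≤ ∑ i, ‖L y i‖ ^ 2 := Finset.sum_nonneg fun i _ => sq_nonneg _
    rw [← Real.le_sqrt (norm_nonneg _) , pi_norm_le_iff_of_nonneg (Real.sqrt_nonneg _)]
    · intro i
      exact Real.le_sqrt_of_sq_le
        (Finset.single_le_sum (f := fun i => ‖L y i‖ ^ 2) (fun i _ => sq_nonneg _)
          (Finset.mem_univ i))
    · exact hs
  simp only [hLa] at h3
  calc ∑ k, ‖y k‖ ^ 2 ≤ (K + 1) * ‖y‖ ^ 2 := h2
    _ ≤ (K + 1) * (C * ‖L y‖) ^ 2 := by gcongr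
    _ = (K + 1) * C ^ 2 * ‖L y‖ ^ 2 := by ring
    _ ≤ _ := by gcongr

end Formation

theorem exists_pos_forall_le {ι : Type*} [Finite ι] (f : ι → ℝ) (hf : ∀ i, 0 < f i) :
    ∃ c > 0, ∀ i, c ≤ f i := by
  cases isEmpty_or_nonempty ι
  · exact ⟨1, one_pos, fun i => isEmptyElim i⟩
  · obtain ⟨i, hi⟩ := Finite.exists_min f
    exact ⟨f i, hf i, hi⟩

theorem exists_forall_le {ι : Type*} [Finite ι] (f : ι → ℝ) : ∃ c, ∀ i, f i ≤ c := by
  cases isEmpty_or_nonempty ι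
  · exact ⟨1, fun i => isEmptyElim i⟩
  · obtain ⟨i, hi⟩ := Finite.exists_max f
    exact ⟨f i, hi⟩

/-! ### Dissipation, and the orientation error as a function of one relative rotation. -/

namespace Formation

variable {N K : ℕ} (F : Formation N K)

/-- The form in which coercivity is used: `-a i` times the incidence sum is the desired velocity in
the world frame, and `β` is the bounded deviation from it. Young's inequality absorbs `β` into half
of the quadratic term. -/
theorem exists_dissipation {G : SimpleGraph (Fin N)} (hG : G.IsAcyclic) (hFG : F.Orients G)
    {a : Fin N → ℝ} (ha : ∀ i, 0 < a i) (b : ℝ) :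
    ∃ c > 0, ∃ d, ∀ (y : Fin K → E3) (β : Fin N → E3), (∀ i, ‖β i‖ ≤ b) →
      ∑ i, inner ℝ (∑ k, F.inc i k • y k) (-a i • (∑ k, F.inc i k • y k) + β i) ≤
        -c * ∑ k, ‖y k‖ ^ 2 + d := by
  obtain ⟨c, hc, H⟩ := F.exists_inc_coercive hG hFG
  obtain ⟨a₀, ha₀, ha'⟩ := exists_pos_forall_le a ha
  refine ⟨a₀ / 2 * c, by positivity, N * (b ^ 2 / (2 * a₀)), fun y β hβ => ?_⟩
  have key : ∀ i, inner ℝ (∑ k, F.inc i k • y k) (-a i • (∑ k, F.inc i k • y k) + β i) ≤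
      -(a₀ / 2) * ‖∑ k, F.inc i k • y k‖ ^ 2 + b ^ 2 / (2 * a₀) := by
    intro i
    set g := ∑ k, F.inc i k • y k
    rw [inner_add_right, inner_smul_right, real_inner_self_eq_norm_sq]
    have h1 : inner ℝ g (β i) ≤ ‖g‖ * b :=
      (real_inner_le_norm _ _).trans (mul_le_mul_of_nonneg_left (hβ i) (norm_nonneg _))
    have h2 : ‖g‖ * b ≤ a₀ / 2 * ‖g‖ ^ 2 + b ^ 2 / (2 * a₀) := by
      have : a₀ / 2 * ‖g‖ ^ 2 + b ^ 2 / (2 * a₀) - ‖g‖ * b = (a₀ * ‖g‖ - b) ^ 2 / (2 * a₀) := by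
        field_simp; ring
      have h3 : 0 ≤ (a₀ * ‖g‖ - b) ^ 2 / (2 * a₀) := by positivity
      linarith
    have h3 : a₀ * ‖g‖ ^ 2 ≤ a i * ‖g‖ ^ 2 := mul_le_mul_of_nonneg_right (ha' i) (sq_nonneg _)
    linarith
  refine (Finset.sum_le_sum fun i _ => key i).trans ?_
  rw [Finset.sum_add_distrib, ← Finset.mul_sum]
  have := mul_le_mul_of_nonneg_left (H y) (by positivity : 0 ≤ a₀ / 2)
  simp
  linarith

variable (x : Fin N → SE3)

/-- The role of `α`: after rotation to the world frame the two end agents of an edge receive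
opposite vectors, which is what makes the incidence map appear. -/
theorem act_rot_alpha {k : Fin K} (i : Fin N) (y : E3) (hk : F.tail k ≠ F.head k) :
    act (rot (x i)) (act (F.alpha x i k) y) = F.inc i k • act (rot (x (F.tail k))) y := by
  by_cases h1 : i = F.tail k
  · subst h1
    have : F.alpha x (F.tail k) k = -1 := by simp [alpha]
    rw [this]
    have e : act (-1 : Matrix (Fin 3) (Fin 3) ℝ) y = -y := by
      ext a; simp [act, Matrix.neg_mulVec]
    rw [e, act_neg]
    simp [inc, hk]
  · by_cases h2 : i = F.head k
    · subst h2
      have : F.alpha x (F.head k) k = (rot (x (F.head k)))ᵀ * rot (x (F.tail k)) := by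
        simp [alpha, hk.symm]
      rw [this, act_act, ← mul_assoc, SO3.mul_transpose (x (F.head k)).2, one_mul]
      simp [inc, hk.symm]
    · have : F.alpha x i k = 0 := by simp [alpha, h1, h2]
      rw [this]
      have e : act (0 : Matrix (Fin 3) (Fin 3) ℝ) y = 0 := by ext a; simp [act]
      rw [e, act_zero]
      simp [inc, h1, h2]

/-- The relative orientation error of an edge, as a rotation. -/
def relRot (k : Fin K) : SO3 :=
  SO3.tr (F.RDes k) * SO3.tr (x (F.head k)).2 * (x (F.tail k)).2

theorem relRot_coe (k : Fin K) :
    (F.relRot x k).1 = (F.RDes k).1ᵀ * (rot (x (F.head k)))ᵀ * rot (x (F.tail k)) := rfl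

theorem psi_eq (k : Fin K) : F.psi x k = (3 - (F.relRot x k).1.trace) / 2 := by
  rw [psi, ← relRot_coe, Matrix.trace_sub, Matrix.trace_one]
  simp
  ring

theorem eR_eq (k : Fin K) : F.eR x k = vee ((F.relRot x k).1ᵀ - (F.relRot x k).1) := by
  rw [eR, relRot_coe]
  simp only [Matrix.transpose_mul, Matrix.transpose_transpose, mul_assoc]

theorem psi_nonneg (k : Fin K) : 0 ≤ F.psi x k := by
  rw [psi_eq]
  linarith [SO3.trace_le (F.relRot x k)]

/-- The orientation feedback vanishes exactly at `ψ = 0` and at the undesired value `ψ = 2`, which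
explains the requirement `ρ_{ψ,0} < 2`. -/
theorem norm_sq_eR (k : Fin K) : ‖F.eR x k‖ ^ 2 = 4 * F.psi x k * (2 - F.psi x k) := by
  rw [eR_eq, SO3.norm_sq_vee, psi_eq]
  ring

end Formation

/-! ### Derivatives of the distance and orientation errors along the motion. -/

section Derivatives

variable {N K : ℕ} (F : Formation N K) {x : ℝ → Fin N → SE3} {v : Fin N → V6} {t : ℝ}

theorem hasDerivWithinAt_e (hx : ∀ i, HasBodyVelocity (fun s => x s i) (v i) t) (k : Fin K) :
    HasDerivWithinAt (fun s => F.e (x s) k)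
      (2 * ∑ i, F.inc i k * inner ℝ (F.rel (x t) k) (act (rot (x t i)) (lin (v i))))
      (Ici 0) t := by
  have h := (((hx (F.head k)).1.sub (hx (F.tail k)).1).norm_sq).sub_const (F.dDes k ^ 2)
  refine h.congr_deriv ?_
  have := F.sum_inc_smul k fun i => inner ℝ (F.rel (x t) k) (act (rot (x t i)) (lin (v i)))
  simp only [smul_eq_mul] at this
  rw [this, ← inner_sub_right]
  rfl

theorem hasDerivWithinAt_mul_apply {A B : ℝ → Matrix (Fin 3) (Fin 3) ℝ}
    {A' B' : Matrix (Fin 3) (Fin 3) ℝ} {s : Set ℝ}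
    (hA : ∀ a b, HasDerivWithinAt (fun s => A s a b) (A' a b) s t)
    (hB : ∀ a b, HasDerivWithinAt (fun s => B s a b) (B' a b) s t) (a b : Fin 3) :
    HasDerivWithinAt (fun s => (A s * B s) a b) ((A' * B t + A t * B') a b) s t := by
  simp only [Matrix.mul_apply, Matrix.add_apply]
  rw [← Finset.sum_add_distrib]
  exact HasDerivWithinAt.fun_sum fun c _ => (hA a c).mul (hB c b)

theorem hasDerivWithinAt_psi (hx : ∀ i, HasBodyVelocity (fun s => x s i) (v i) t) (k : Fin K) :
    HasDerivWithinAt (fun s => F.psi (x s) k)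
      (1 / 2 * ∑ i, F.inc i k * inner ℝ (act (rot (x t (F.tail k))) (F.eR (x t) k))
        (act (rot (x t i)) (ang (v i)))) (Ici 0) t := by
  set i := F.tail k with hi
  set j := F.head k with hj
  have hD : ∀ a b, HasDerivWithinAt (fun _ : ℝ => (F.RDes k).1ᵀ a b)
      ((0 : Matrix (Fin 3) (Fin 3) ℝ) a b) (Ici 0) t := fun a b => hasDerivWithinAt_const ..
  have hRj : ∀ a b, HasDerivWithinAt (fun s => (rot (x s j))ᵀ a b)
      ((rot (x t j) * skew (ang (v j)))ᵀ a b) (Ici 0) t := fun a b => (hx j).2 b a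
  have hQ := hasDerivWithinAt_mul_apply (hasDerivWithinAt_mul_apply hD hRj) (hx i).2
  have htr : HasDerivWithinAt
      (fun s => ((F.RDes k).1ᵀ * (rot (x s j))ᵀ * rot (x s i)).trace) _ (Ici 0) t :=
    HasDerivWithinAt.fun_sum fun a (_ : a ∈ Finset.univ) => hQ a a
  have h := (htr.const_sub 3).const_mul (1 / 2)
  have e : (fun s => F.psi (x s) k) =
      fun s => 1 / 2 * (3 - ((F.RDes k).1ᵀ * (rot (x s j))ᵀ * rot (x s i)).trace) := by
    funext s
    rw [Formation.psi, Matrix.trace_sub, Matrix.trace_one]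
    simp [hi, hj]
  rw [e]
  refine h.congr_deriv ?_
  have hs := F.sum_inc_smul k fun l =>
    inner ℝ (act (rot (x t i)) (F.eR (x t) k)) (act (rot (x t l)) (ang (v l)))
  simp only [smul_eq_mul] at hs
  rw [hs, ← hi, ← hj]
  change 1 / 2 * -((0 * (rot (x t j))ᵀ + (F.RDes k).1ᵀ * (rot (x t j) * skew (ang (v j)))ᵀ) *
    rot (x t i) + (F.RDes k).1ᵀ * (rot (x t j))ᵀ * (rot (x t i) * skew (ang (v i)))).trace = _
  have t1 : ((F.RDes k).1ᵀ * (rot (x t j))ᵀ * (rot (x t i) * skew (ang (v i)))).trace =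
      inner ℝ (act (rot (x t i)) (F.eR (x t) k)) (act (rot (x t i)) (ang (v i))) := by
    rw [← mul_assoc, trace_mul_skew, inner_act, act_act, SO3.transpose_mul (x t i).2, act_one,
      F.eR_eq, F.relRot_coe]
  -- Here the skew factor stands between `R_des` and the rotation of the tail. Moving it to the end
  -- by cyclicity of the trace conjugates `Qᵀ - Q` by `U`, and `vee` turns conjugation into the
  -- action of `U`.
  have t2 : ((F.RDes k).1ᵀ * (rot (x t j) * skew (ang (v j)))ᵀ * rot (x t i)).trace =
      -inner ℝ (act (rot (x t i)) (F.eR (x t) k)) (act (rot (x t j)) (ang (v j))) := by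
    set U : SO3 := SO3.tr (x t j).2 * (x t i).2 with hU
    have hU1 : U.1 = (rot (x t j))ᵀ * rot (x t i) := rfl
    have hQU : (F.relRot (x t) k).1 = (F.RDes k).1ᵀ * U.1 := by
      rw [F.relRot_coe, hU1, mul_assoc]
    have hA : ((F.relRot (x t) k).1ᵀ - (F.relRot (x t) k).1)ᵀ =
        -((F.relRot (x t) k).1ᵀ - (F.relRot (x t) k).1) := by simp
    have hv := SO3.vee_conj U hA
    rw [← F.eR_eq] at hv
    have hc : U.1 * ((F.relRot (x t) k).1ᵀ - (F.relRot (x t) k).1) * U.1ᵀ =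
        (U.1 * (F.RDes k).1ᵀ)ᵀ - U.1 * (F.RDes k).1ᵀ := by
      rw [hQU]
      simp only [Matrix.transpose_mul, Matrix.transpose_transpose, mul_sub, sub_mul]
      rw [← mul_assoc U.1 U.1ᵀ, SO3.mul_transpose, one_mul, ← mul_assoc U.1, mul_assoc _ U.1,
        SO3.mul_transpose, mul_one]
    have hr : inner ℝ (act (rot (x t i)) (F.eR (x t) k)) (act (rot (x t j)) (ang (v j))) =
        inner ℝ (act U.1 (F.eR (x t) k)) (ang (v j)) := by
      rw [hU1, ← act_act, inner_act, inner_act, inner_act, Matrix.transpose_transpose]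
    rw [hr, ← hv, hc, ← trace_mul_skew, Matrix.transpose_mul, transpose_skew, neg_mul, mul_neg,
      neg_mul, Matrix.trace_neg, mul_assoc, mul_assoc, ← hU1, ← mul_assoc, Matrix.trace_mul_comm,
      ← mul_assoc]
  rw [zero_mul, zero_add, Matrix.trace_add, t1, t2]
  ring

end Derivatives

/-! ### The logarithmic transformations and their bounds. -/

/-- The common form of the transformations `T_{e_k}` and `T_v`. -/
def logRatio (a b y : ℝ) : ℝ := Real.log ((1 + y / a) / (1 - y / b))

section Transformations

variable {a b y : ℝ}

theorem TV_eq : TV = logRatio 1 1 := by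
  funext y; simp [TV, logRatio]

theorem hasDerivAt_logRatio (ha : 0 < a) (hb : 0 < b) (h1 : 0 < 1 + y / a) (h2 : 0 < 1 - y / b) :
    HasDerivAt (logRatio a b) (1 / (a + y) + 1 / (b - y)) y := by
  have d1 : HasDerivAt (fun y => 1 + y / a) (1 / a) y := ((hasDerivAt_id y).div_const a).const_add 1
  have d2 : HasDerivAt (fun y => 1 - y / b) (-(1 / b)) y :=
    ((hasDerivAt_id y).div_const b).const_sub 1
  have h := (d1.div d2 h2.ne').log (div_pos h1 h2).ne'
  refine h.congr_deriv ?_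
  have e1 : a * (1 + y / a) = a + y := by field_simp
  have e2 : b * (1 - y / b) = b - y := by field_simp
  have p1 : 0 < a + y := e1 ▸ mul_pos ha h1
  have p2 : 0 < b - y := e2 ▸ mul_pos hb h2
  rw [← e1, ← e2]
  simp only [Pi.div_apply]
  field_simp
  ring

theorem deriv_logRatio (ha : 0 < a) (hb : 0 < b) (h1 : 0 < 1 + y / a) (h2 : 0 < 1 - y / b) :
    deriv (logRatio a b) y = 1 / (a + y) + 1 / (b - y) :=
  (hasDerivAt_logRatio ha hb h1 h2).deriv

theorem le_deriv_logRatio (ha : 0 < a) (hb : 0 < b) (h1 : 0 < 1 + y / a) (h2 : 0 < 1 - y / b) :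
    1 / (a + b) ≤ deriv (logRatio a b) y := by
  rw [deriv_logRatio ha hb h1 h2]
  have e1 : a * (1 + y / a) = a + y := by field_simp
  have e2 : b * (1 - y / b) = b - y := by field_simp
  have p1 : 0 < a + y := e1 ▸ mul_pos ha h1
  have p2 : 0 < b - y := e2 ▸ mul_pos hb h2
  have : 1 / (a + b) ≤ 1 / (a + y) := one_div_le_one_div_of_le p1 (by linarith)
  have : 0 < 1 / (b - y) := by positivity
  linarith

/-- According to the sign of `y`, one of the two factors is at least `1`; the bound on the ratio
then controls the other one. This is how a bounded transformed error becomes a distance to the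
boundary. -/
theorem logRatio_margin (ha : 0 < a) (hb : 0 < b) (h1 : 0 < 1 + y / a) (h2 : 0 < 1 - y / b) {c : ℝ}
    (hc : |logRatio a b y| ≤ c) : Real.exp (-c) ≤ 1 + y / a ∧ Real.exp (-c) ≤ 1 - y / b := by
  have hc0 : 0 ≤ c := (abs_nonneg _).trans hc
  have hexp : Real.exp (-c) ≤ 1 := Real.exp_le_one_iff.2 (by linarith)
  obtain ⟨l, u⟩ := abs_le.1 hc
  rw [logRatio, Real.le_log_iff_exp_le (div_pos h1 h2), le_div_iff₀ h2] at l
  rw [logRatio, Real.log_le_iff_le_exp (div_pos h1 h2), div_le_iff₀ h2] at u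
  rcases le_total 0 y with hy | hy
  · have : 0 ≤ y / a := div_nonneg hy ha.le
    refine ⟨by linarith, ?_⟩
    have h3 : Real.exp (-c) * Real.exp c = 1 := by rw [← Real.exp_add]; simp
    have := mul_le_mul_of_nonneg_left u (Real.exp_pos (-c)).le
    rw [← mul_assoc, h3, one_mul] at this
    nlinarith [Real.exp_pos (-c)]
  · have : y / b ≤ 0 := div_nonpos_of_nonpos_of_nonneg hy hb.le
    refine ⟨?_, by linarith⟩
    nlinarith [Real.exp_pos (-c)]

theorem exists_bound_logRatio (ha : 0 < a) (hb : 0 < b) {κ : ℝ} (hκ : 0 < κ) :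
    ∃ c, ∀ y, κ < 1 + y / a → κ < 1 - y / b →
      |logRatio a b y| ≤ c ∧ |deriv (logRatio a b) y| ≤ c := by
  have hdom : ∀ y ∈ Icc (a * (κ - 1)) (b * (1 - κ)), 0 < 1 + y / a ∧ 0 < 1 - y / b := by
    intro y hy
    have h1 : κ - 1 ≤ y / a := (le_div_iff₀ ha).2 (by linarith [hy.1])
    have h2 : y / b ≤ 1 - κ := (div_le_iff₀ hb).2 (by linarith [hy.2])
    constructor <;> linarith
  obtain ⟨c₁, hc₁⟩ := (isCompact_Icc (a := a * (κ - 1)) (b := b * (1 - κ))).exists_bound_of_continuousOn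
    (f := logRatio a b) fun y hy =>
      (hasDerivAt_logRatio ha hb (hdom y hy).1 (hdom y hy).2).continuousAt.continuousWithinAt
  refine ⟨max c₁ (1 / (a * κ) + 1 / (b * κ)), fun y h1 h2 => ⟨?_, ?_⟩⟩
  · refine le_max_of_le_left (hc₁ y ⟨?_, ?_⟩)
    · have : κ - 1 ≤ y / a := by linarith
      rw [le_div_iff₀ ha] at this
      linarith
    · have : y / b ≤ 1 - κ := by linarith
      rw [div_le_iff₀ hb] at this
      linarith
  · refine le_max_of_le_right ?_
    have e1 : a * (1 + y / a) = a + y := by field_simp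
    have e2 : b * (1 - y / b) = b - y := by field_simp
    have p1 : a * κ ≤ a + y := e1 ▸ mul_le_mul_of_nonneg_left h1.le ha.le
    have p2 : b * κ ≤ b - y := e2 ▸ mul_le_mul_of_nonneg_left h2.le hb.le
    have q1 : 0 < a * κ := by positivity
    have q2 : 0 < b * κ := by positivity
    rw [deriv_logRatio ha hb (hκ.trans h1) (hκ.trans h2), abs_of_nonneg]
    · exact add_le_add (one_div_le_one_div_of_le q1 p1) (one_div_le_one_div_of_le q2 p2)
    · have := q1.trans_le p1
      have := q2.trans_le p2
      positivity

theorem hasDerivAt_TPsi (h : 0 < 1 - y) : HasDerivAt TPsi (1 / (1 - y)) y := by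
  have d : HasDerivAt (fun y : ℝ => 1 - y) (-1) y := by simpa using (hasDerivAt_id y).const_sub 1
  have h' := (d.log h.ne').neg
  have e : TPsi = fun y => -Real.log (1 - y) := by
    funext y; simp [TPsi]
  rw [e]
  refine h'.congr_deriv ?_
  field_simp

theorem rPsi_eq (h : 0 < 1 - y) : rPsi y = 1 / (1 - y) := (hasDerivAt_TPsi h).deriv

theorem TPsi_eq (y : ℝ) : TPsi y = -Real.log (1 - y) := by simp [TPsi]

theorem exists_bound_TPsi {κ : ℝ} (hκ : 0 < κ) :
    ∃ c, ∀ y, 0 ≤ y → κ < 1 - y → |TPsi y| ≤ c ∧ |rPsi y| ≤ c := by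
  refine ⟨max (-Real.log κ) (1 / κ), fun y h0 h1 => ⟨le_max_of_le_left ?_, le_max_of_le_right ?_⟩⟩
  · rw [TPsi_eq, abs_neg, abs_of_nonpos (Real.log_nonpos (by linarith) (by linarith))]
    exact neg_le_neg (Real.log_le_log hκ h1.le)
  · have : 0 < 1 - y := hκ.trans h1
    rw [rPsi_eq this, abs_of_nonneg (by positivity)]
    exact one_div_le_one_div_of_le hκ h1.le

end Transformations

/-! ### Performance functions and positivity of the design constants. -/

/-- An exponentially decaying performance function. -/
def perf (a b l t : ℝ) : ℝ := (a - b) * Real.exp (-l * t) + b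

section Perf

variable {a b l t : ℝ}

theorem le_perf (hab : b < a) : b < perf a b l t := by
  have := Real.exp_pos (-l * t)
  rw [perf]
  nlinarith

theorem perf_le (hab : b < a) (hl : 0 < l) (ht : 0 ≤ t) : perf a b l t ≤ a := by
  have : Real.exp (-l * t) ≤ 1 := Real.exp_le_one_iff.2 (by nlinarith)
  rw [perf]
  nlinarith

theorem hasDerivAt_perf (a b l t : ℝ) :
    HasDerivAt (perf a b l) (-l * (perf a b l t - b)) t := by
  have h := (((hasDerivAt_id t).const_mul (-l)).exp.const_mul (a - b)).add_const b
  refine h.congr_deriv ?_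
  simp [perf]
  ring

theorem continuous_perf : Continuous (perf a b l) := by
  unfold perf; fun_prop

theorem tendsto_perf (hl : 0 < l) : Tendsto (perf a b l) atTop (𝓝 b) := by
  have h1 : Tendsto (fun t : ℝ => -l * t) atTop atBot :=
    tendsto_id.const_mul_atTop_of_neg (by linarith)
  change Tendsto (fun t => (a - b) * Real.exp (-l * t) + b) atTop (𝓝 b)
  simpa using ((Real.tendsto_exp_atBot.comp h1).const_mul (a - b)).add_const b

end Perf

namespace Formation

variable {N K : ℕ} {F : Formation N K}

theorem Admissible.dCol_pos (hF : F.Admissible) (k : Fin K) : 0 < F.dCol k :=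
  add_pos (hF.radius_pos _) (hF.radius_pos _)

theorem Admissible.CCol_pos (hF : F.Admissible) (k : Fin K) : 0 < F.CCol k := by
  have := hF.dCol_pos k
  have := hF.dCol_lt k
  rw [CCol]; nlinarith

theorem Admissible.CCon_pos (hF : F.Admissible) (k : Fin K) : 0 < F.CCon k := by
  have := hF.dCol_pos k
  have := hF.dCol_lt k
  have := hF.lt_dCon k
  rw [CCon]; nlinarith

end Formation

namespace Design

variable {N K : ℕ} (D : Design N K) (F : Formation N K)

/-- The limit of `ρ_{e_k}`. -/
def rhoEMin (k : Fin K) : ℝ := D.rhoEInf k / max (F.CCon k) (F.CCol k)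

theorem rhoE_eq (k : Fin K) : D.rhoE F k = perf 1 (D.rhoEMin F k) (D.lE k) := rfl

theorem rhoPsi_eq (k : Fin K) : D.rhoPsi k = perf (D.rhoPsi0 k) (D.rhoPsiInf k) (D.lPsi k) := rfl

theorem rhoV_eq (i : Fin N) (l : Idx6) :
    D.rhoV i l = perf (D.rhoV0 i l) (D.rhoVInf i l) (D.lV i l) := rfl

variable {D F}

theorem Admissible.rhoEMin_pos (hD : D.Admissible F) (hF : F.Admissible) (k : Fin K) :
    0 < D.rhoEMin F k :=
  div_pos (hD.rhoEInf_pos k) (lt_max_of_lt_left (hF.CCon_pos k))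

theorem Admissible.rhoEMin_lt (hD : D.Admissible F) (hF : F.Admissible) (k : Fin K) :
    D.rhoEMin F k < 1 :=
  (div_lt_one (lt_max_of_lt_left (hF.CCon_pos k))).2 (hD.rhoEInf_lt k)

theorem Admissible.rhoE_pos (hD : D.Admissible F) (hF : F.Admissible) (k : Fin K) (t : ℝ) :
    0 < D.rhoE F k t :=
  (hD.rhoEMin_pos hF k).trans (le_perf (hD.rhoEMin_lt hF k))

theorem Admissible.rhoE_le (hD : D.Admissible F) (hF : F.Admissible) (k : Fin K) {t : ℝ}
    (ht : 0 ≤ t) : D.rhoE F k t ≤ 1 :=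
  perf_le (hD.rhoEMin_lt hF k) (hD.lE_pos k) ht

theorem Admissible.rhoPsi_pos (hD : D.Admissible F) (k : Fin K) (t : ℝ) : 0 < D.rhoPsi k t :=
  (hD.rhoPsiInf_pos k).trans (le_perf (hD.rhoPsiInf_lt k))

theorem Admissible.rhoPsi_le (hD : D.Admissible F) (k : Fin K) {t : ℝ} (ht : 0 ≤ t) :
    D.rhoPsi k t ≤ D.rhoPsi0 k :=
  perf_le (hD.rhoPsiInf_lt k) (hD.lPsi_pos k) ht

theorem Admissible.rhoV_pos (hD : D.Admissible F) (i : Fin N) (l : Idx6) (t : ℝ) :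
    0 < D.rhoV i l t :=
  (hD.rhoVInf_pos i l).trans (le_perf (hD.rhoVInf_lt i l))

theorem Admissible.rhoV_le (hD : D.Admissible F) (i : Fin N) (l : Idx6) {t : ℝ} (ht : 0 ≤ t) :
    D.rhoV i l t ≤ D.rhoV0 i l :=
  perf_le (hD.rhoVInf_lt i l) (hD.lV_pos i l) ht

/-! ### Lyapunov estimates for the distance and orientation errors. -/

variable (D F)

/-- The normalized distance and orientation errors keep distance `κ` from the boundary of the
domain of the transformations. -/
def KinMargin (κ : ℝ) (x : Fin N → SE3) (t : ℝ) : Prop :=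
  ∀ k, κ < 1 + D.xiE F x t k / F.CCol k ∧ κ < 1 - D.xiE F x t k / F.CCon k ∧
    κ < 1 - D.xiPsi F x t k

/-- A trajectory of the kinematics on `[0, τ)` that starts in `x₀`, stays in the domain of the
transformations, and whose velocities are within `b` of the desired ones. -/
structure KinTraj (x₀ : Fin N → SE3) (b τ : ℝ) (x : ℝ → Fin N → SE3) (v : ℝ → Fin N → V6) :
    Prop where
  init : x 0 = x₀
  vel : ∀ t ∈ Ico 0 τ, ∀ i, HasBodyVelocity (fun s => x s i) (v t i) t
  margin : ∀ t ∈ Ico 0 τ, D.KinMargin F 0 (x t) t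
  near : ∀ t ∈ Ico 0 τ, ∀ i, ‖v t i - D.vDes F (x t) t i‖ ≤ b

/-- The weight of the edge `k` in `v_{i,L des}`. -/
def cE (x : Fin N → SE3) (t : ℝ) (k : Fin K) : ℝ :=
  F.rE k (D.xiE F x t k) / D.rhoE F k t * D.epsE F x t k

/-- The weight of the edge `k` in `ω_{i,des}`. -/
def cPsi (x : Fin N → SE3) (t : ℝ) (k : Fin K) : ℝ := rPsi (D.xiPsi F x t k) / D.rhoPsi k t

variable {D F}

theorem act_rot_vLDes {G : SimpleGraph (Fin N)} (hFG : F.Orients G) (x : Fin N → SE3) (t : ℝ)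
    (i : Fin N) : act (rot (x i)) (D.vLDes F x t i) =
      -(2 * D.delta i) • ∑ k, F.inc i k • D.cE F x t k • F.rel x k := by
  rw [vLDes, smul_smul, act_smul, act_sum]
  congr 1
  · ring
  · refine Finset.sum_congr rfl fun k _ => ?_
    rw [act_smul, F.act_rot_alpha x i _ (F.tail_ne_head hFG k), act_act,
      SO3.mul_transpose (x (F.tail k)).2, act_one, smul_comm]
    rfl

theorem act_rot_omegaDes {G : SimpleGraph (Fin N)} (hFG : F.Orients G) (x : Fin N → SE3) (t : ℝ)
    (i : Fin N) : act (rot (x i)) (D.omegaDes F x t i) =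
      -D.delta i • ∑ k, F.inc i k • D.cPsi F x t k • act (rot (x (F.tail k))) (F.eR x k) := by
  rw [omegaDes, act_smul, act_sum]
  congr 1
  refine Finset.sum_congr rfl fun k _ => ?_
  rw [act_smul, F.act_rot_alpha x i _ (F.tail_ne_head hFG k), smul_comm]
  rfl

theorem lin_sub (a b : V6) : lin (a - b) = lin a - lin b := rfl

theorem ang_sub (a b : V6) : ang (a - b) = ang a - ang b := rfl

theorem lin_vDes (x : Fin N → SE3) (t : ℝ) (i : Fin N) : lin (D.vDes F x t i) = D.vLDes F x t i :=
  rfl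

theorem ang_vDes (x : Fin N → SE3) (t : ℝ) (i : Fin N) :
    ang (D.vDes F x t i) = D.omegaDes F x t i := rfl

/-- Exchanging the sums over edges and agents turns the derivative of a potential into the
expression bounded by `exists_dissipation`. -/
theorem sum_mul_sum_inc (c : Fin K → ℝ) (y : Fin K → E3) (z : Fin N → E3) :
    ∑ k, c k * ∑ i, F.inc i k * inner ℝ (y k) (z i) =
      ∑ i, inner ℝ (∑ k, F.inc i k • c k • y k) (z i) := by
  simp only [Finset.mul_sum, sum_inner]
  rw [Finset.sum_comm]
  refine Finset.sum_congr rfl fun i _ => Finset.sum_congr rfl fun k _ => ?_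
  rw [real_inner_smul_left, real_inner_smul_left]
  ring

theorem hasDerivWithinAt_inv_mul {ρ f : ℝ → ℝ} {ρ' f' t : ℝ} {s : Set ℝ}
    (hρ : HasDerivWithinAt ρ ρ' s t) (hf : HasDerivWithinAt f f' s t) (h0 : ρ t ≠ 0) :
    HasDerivWithinAt (fun s => (ρ s)⁻¹ * f s) ((ρ t)⁻¹ * (f' - ρ' * ((ρ t)⁻¹ * f t))) s t := by
  refine ((hρ.fun_inv h0).mul hf).congr_deriv ?_
  field_simp
  ring

/-- The weight of an edge in the desired linear velocity is `r ε / ρ`, so the matching potential is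
`½ ∑ ε²`. The bound depends only on `x₀` and `b`, not on `τ` or the trajectory. -/
theorem exists_bound_epsE (hD : D.Admissible F) (hF : F.Admissible) {G : SimpleGraph (Fin N)}
    (hG : G.IsAcyclic) (hFG : F.Orients G) (x₀ : Fin N → SE3) (b : ℝ) :
    ∃ c, ∀ τ x v, D.KinTraj F x₀ b τ x v → ∀ t ∈ Ico 0 τ, ∀ k, |D.epsE F (x t) t k| ≤ c := by
  obtain ⟨q, hq, d, H⟩ := F.exists_dissipation hG hFG (a := fun i => 2 * D.delta i)
    (fun i => by have := hD.delta_pos i; positivity) b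
  have hCs : ∀ k, 0 < F.CCol k + F.CCon k := fun k => add_pos (hF.CCol_pos k) (hF.CCon_pos k)
  -- From `r ≥ 1 / (C_col + C_con)`, `ρ ≤ 1` and `‖rel‖ ≥ d_col`, half of the dissipation `2q ‖c •
  -- rel‖²` is at least `A k * (½ ε²)`. The other half absorbs the drift of the performance
  -- function, bounded through `m`.
  set A : Fin K → ℝ := fun k => 2 * (q * F.dCol k ^ 2 * (1 / (F.CCol k + F.CCon k)) ^ 2) with hA
  obtain ⟨a, ha, haA⟩ := exists_pos_forall_le A fun k => by
    have := hF.dCol_pos k; have := hCs k; positivity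
  set m : Fin K → ℝ := fun k => D.lE k * (F.CCol k + F.CCon k) with hm
  set β : ℝ := 2 * d + ∑ k, m k ^ 2 / (4 * (q * F.dCol k ^ 2)) with hβ
  set W : (Fin N → SE3) → ℝ → ℝ := fun x t => ∑ k, 1 / 2 * D.epsE F x t k ^ 2 with hW
  set M := max (W x₀ 0) (β / a) + 1 with hM
  refine ⟨2 * M + 1, fun τ x v h => ?_⟩
  have hdom : ∀ t ∈ Ico 0 τ, ∀ k, 0 < 1 + D.xiE F (x t) t k / F.CCol k ∧
      0 < 1 - D.xiE F (x t) t k / F.CCon k := fun t ht k =>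
    ⟨(h.margin t ht k).1, (h.margin t ht k).2.1⟩
  set e' : ℝ → Fin K → ℝ := fun t k => 2 * ∑ i, F.inc i k *
    inner ℝ (F.rel (x t) k) (act (rot (x t i)) (lin (v t i))) with he'
  set ρ' : ℝ → Fin K → ℝ := fun t k => -D.lE k * (D.rhoE F k t - D.rhoEMin F k) with hρ'
  have hder : ∀ t ∈ Ico 0 τ, HasDerivWithinAt (fun s => W (x s) s)
      (∑ k, D.cE F (x t) t k * (e' t k - ρ' t k * D.xiE F (x t) t k)) (Ici 0) t := by
    intro t ht
    refine HasDerivWithinAt.fun_sum fun k _ => ?_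
    have h1 := hasDerivWithinAt_inv_mul
      (hasDerivAt_perf 1 (D.rhoEMin F k) (D.lE k) t).hasDerivWithinAt
      (hasDerivWithinAt_e F (h.vel t ht) k) (hD.rhoE_pos hF k t).ne'
    have h2 : HasDerivAt (F.TE k) (F.rE k (D.xiE F (x t) t k)) (D.xiE F (x t) t k) :=
      (hasDerivAt_logRatio (hF.CCol_pos k) (hF.CCon_pos k) (hdom t ht k).1
        (hdom t ht k).2).differentiableAt.hasDerivAt
    have h3 : HasDerivWithinAt (fun s => D.epsE F (x s) s k) _ (Ici 0) t :=
      h2.comp_hasDerivWithinAt t h1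
    refine ((h3.pow 2).const_mul (1 / 2)).congr_deriv ?_
    change 1 / 2 * (_ * _ ^ (2 - 1) * (F.rE k (D.xiE F (x t) t k) *
      ((D.rhoE F k t)⁻¹ * (e' t k - ρ' t k * D.xiE F (x t) t k)))) = _
    simp only [cE, div_eq_mul_inv]
    ring
  have hle : ∀ t ∈ Ico 0 τ, ∑ k, D.cE F (x t) t k * (e' t k - ρ' t k * D.xiE F (x t) t k) ≤
      -a * W (x t) t + β := by
    intro t ht
    have hs1 : ∑ k, D.cE F (x t) t k * e' t k ≤
        2 * (-q * ∑ k, ‖D.cE F (x t) t k • F.rel (x t) k‖ ^ 2 + d) := by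
      have := H (fun k => D.cE F (x t) t k • F.rel (x t) k)
        (fun i => act (rot (x t i)) (lin (v t i - D.vDes F (x t) t i))) (fun i => by
          rw [SO3.norm_act (x t i).2]
          exact (norm_lin_le _).trans (h.near t ht i))
      refine le_trans (le_of_eq ?_) (mul_le_mul_of_nonneg_left this zero_le_two)
      have e1 : ∀ i, -(2 * D.delta i) • (∑ k, F.inc i k • D.cE F (x t) t k • F.rel (x t) k) +
          act (rot (x t i)) (lin (v t i - D.vDes F (x t) t i)) =
          act (rot (x t i)) (lin (v t i)) := by
        intro i
        rw [← act_rot_vLDes hFG, ← act_add, lin_sub, lin_vDes, add_sub_cancel]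
      simp only [e1]
      rw [← sum_mul_sum_inc, Finset.mul_sum]
      exact Finset.sum_congr rfl fun k _ => by simp only [he']; ring
    have hk : ∀ k, -(2 * q) * ‖D.cE F (x t) t k • F.rel (x t) k‖ ^ 2 -
        D.cE F (x t) t k * (ρ' t k * D.xiE F (x t) t k) ≤
        -a * (1 / 2 * D.epsE F (x t) t k ^ 2) + m k ^ 2 / (4 * (q * F.dCol k ^ 2)) := by
      intro k
      obtain ⟨d1, d2⟩ := hdom t ht k
      have hC1 := hF.CCol_pos k
      have hC2 := hF.CCon_pos k
      have hρ := hD.rhoE_pos hF k t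
      have hρ1 := hD.rhoE_le hF k ht.1
      have hdc := hF.dCol_pos k
      set ξ := D.xiE F (x t) t k with hξ
      set c := D.cE F (x t) t k with hc
      set ε := D.epsE F (x t) t k with hε
      have x1 : -F.CCol k < ξ := by
        have : -1 < ξ / F.CCol k := by linarith
        rw [lt_div_iff₀ hC1] at this; linarith
      have x2 : ξ < F.CCon k := by
        have : ξ / F.CCon k < 1 := by linarith
        rw [div_lt_iff₀ hC2] at this; linarith
      -- Being in the domain already excludes collision, so the edge vector cannot degenerate.
      have hrel : F.dCol k ^ 2 ≤ ‖F.rel (x t) k‖ ^ 2 := by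
        have h1 : F.e (x t) k = D.rhoE F k t * ξ := by rw [hξ, xiE]; field_simp
        rw [Formation.e] at h1
        have h2 : -F.CCol k ≤ D.rhoE F k t * ξ := by nlinarith
        rw [Formation.CCol] at h2
        linarith
      have hr : 1 / (F.CCol k + F.CCon k) ≤ F.rE k ξ := le_deriv_logRatio hC1 hC2 d1 d2
      have hCs0 : 0 < 1 / (F.CCol k + F.CCon k) := by have := hCs k; positivity
      have hcε : (1 / (F.CCol k + F.CCon k)) ^ 2 * ε ^ 2 ≤ c ^ 2 := by
        rw [hc, cE, mul_pow]
        refine mul_le_mul_of_nonneg_right (pow_le_pow_left₀ hCs0.le ?_ 2) (sq_nonneg _)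
        rw [le_div_iff₀ hρ]
        nlinarith
      have hρm : |ρ' t k * ξ| ≤ m k := by
        rw [abs_mul]
        have hl := hD.lE_pos k
        have h0 := hD.rhoEMin_pos hF k
        have h1 : D.rhoEMin F k ≤ D.rhoE F k t := (le_perf (hD.rhoEMin_lt hF k)).le
        have h2 : |ρ' t k| ≤ D.lE k := by
          rw [hρ', abs_le]; constructor <;> nlinarith
        have h3 : |ξ| ≤ F.CCol k + F.CCon k := abs_le.2 ⟨by linarith, by linarith⟩
        exact mul_le_mul h2 h3 (abs_nonneg _) hl.le
      have hcm : -(c * (ρ' t k * ξ)) ≤ |c| * m k := by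
        refine (neg_le_abs _).trans ?_
        rw [abs_mul]
        exact mul_le_mul_of_nonneg_left hρm (abs_nonneg _)
      set Q := q * F.dCol k ^ 2 with hQ
      have hQ0 : 0 < Q := by positivity
      have hyoung : |c| * m k ≤ Q * c ^ 2 + m k ^ 2 / (4 * Q) := by
        have : Q * c ^ 2 + m k ^ 2 / (4 * Q) - |c| * m k = (2 * Q * |c| - m k) ^ 2 / (4 * Q) := by
          rw [← sq_abs c]; field_simp; ring
        have h3 : 0 ≤ (2 * Q * |c| - m k) ^ 2 / (4 * Q) := by positivity
        linarith
      have hn : Q * c ^ 2 ≤ q * ‖c • F.rel (x t) k‖ ^ 2 := by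
        rw [norm_smul, mul_pow, Real.norm_eq_abs, sq_abs, hQ]
        have := mul_le_mul_of_nonneg_left hrel (mul_nonneg hq.le (sq_nonneg c))
        linarith
      have hfin : a * (1 / 2 * ε ^ 2) ≤ Q * c ^ 2 := by
        have h1 := mul_le_mul_of_nonneg_right (haA k) (sq_nonneg ε)
        have h2 := mul_le_mul_of_nonneg_left hcε hQ0.le
        have h3 : A k = 2 * (Q * (1 / (F.CCol k + F.CCon k)) ^ 2) := rfl
        rw [h3] at h1
        linarith
      linarith
    have hs2 := Finset.sum_le_sum fun k (_ : k ∈ Finset.univ) => hk k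
    rw [Finset.sum_sub_distrib, Finset.sum_add_distrib, ← Finset.mul_sum, ← Finset.mul_sum] at hs2
    simp only [mul_sub, Finset.sum_sub_distrib]
    simp only [hW, hβ]
    linarith
  have hmain := le_max_of_deriv_le ha hder hle
  rw [h.init] at hmain
  intro t ht k
  have h1 := hmain t ht
  have h2 : 1 / 2 * D.epsE F (x t) t k ^ 2 ≤ W (x t) t :=
    Finset.single_le_sum (f := fun k => 1 / 2 * D.epsE F (x t) t k ^ 2)
      (fun k _ => by positivity) (Finset.mem_univ k)
  rw [abs_le]
  constructor <;> nlinarith [sq_nonneg (D.epsE F (x t) t k - 1), sq_nonneg (D.epsE F (x t) t k + 1)]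

/-- The weight `r / ρ` in the desired angular velocity contains no `ε`, so the potential is `∑ ε_ψ`
itself, which is nonnegative. With `ξ` the normalized error and `r = 1 / (1 - ξ)`, the dissipation
dominates `r² ξ`, which controls both `ε_ψ = log r` and `(r ξ)²`. -/
theorem exists_bound_epsPsi (hD : D.Admissible F) {G : SimpleGraph (Fin N)}
    (hG : G.IsAcyclic) (hFG : F.Orients G) (hρ2 : ∀ k, D.rhoPsi0 k < 2) (x₀ : Fin N → SE3) (b : ℝ) :
    ∃ c, ∀ τ x v, D.KinTraj F x₀ b τ x v → ∀ t ∈ Ico 0 τ, ∀ k, |D.epsPsi F (x t) t k| ≤ c := by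
  obtain ⟨q, hq, d, H⟩ := F.exists_dissipation hG hFG hD.delta_pos b
  have hρ0 : ∀ k, 0 < D.rhoPsi0 k := fun k => (hD.rhoPsiInf_pos k).trans (hD.rhoPsiInf_lt k)
  -- A lower bound for `q (2 - ψ) / ρ_ψ`; it is positive only because `ρ_{ψ,0} < 2`. Of the
  -- resulting `2 A k r² ξ`, one half bounds `ε_ψ` and the other absorbs the drift `l r ξ`.
  set A : Fin K → ℝ := fun k => q * ((2 - D.rhoPsi0 k) / D.rhoPsi0 k) with hA
  have hApos : ∀ k, 0 < A k := fun k => by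
    have := hρ0 k
    have : 0 < 2 - D.rhoPsi0 k := sub_pos.2 (hρ2 k)
    positivity
  obtain ⟨a, ha, haA⟩ := exists_pos_forall_le A hApos
  set β : ℝ := d / 2 + ∑ k, D.lPsi k ^ 2 / (4 * A k) with hβ
  set W : (Fin N → SE3) → ℝ → ℝ := fun x t => ∑ k, D.epsPsi F x t k with hW
  set M := max (W x₀ 0) (β / a) + 1 with hM
  refine ⟨M, fun τ x v h => ?_⟩
  have hdom : ∀ t ∈ Ico 0 τ, ∀ k, 0 < 1 - D.xiPsi F (x t) t k := fun t ht k =>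
    (h.margin t ht k).2.2
  have hξ0 : ∀ t k, 0 ≤ D.xiPsi F (x t) t k := fun t k =>
    mul_nonneg (inv_nonneg.2 (hD.rhoPsi_pos k t).le) (F.psi_nonneg _ k)
  set e' : ℝ → Fin K → ℝ := fun t k => 1 / 2 * ∑ i, F.inc i k *
    inner ℝ (act (rot (x t (F.tail k))) (F.eR (x t) k)) (act (rot (x t i)) (ang (v t i))) with he'
  set ρ' : ℝ → Fin K → ℝ := fun t k => -D.lPsi k * (D.rhoPsi k t - D.rhoPsiInf k) with hρ'
  have hder : ∀ t ∈ Ico 0 τ, HasDerivWithinAt (fun s => W (x s) s)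
      (∑ k, D.cPsi F (x t) t k * (e' t k - ρ' t k * D.xiPsi F (x t) t k)) (Ici 0) t := by
    intro t ht
    refine HasDerivWithinAt.fun_sum fun k _ => ?_
    have h1 := hasDerivWithinAt_inv_mul
      (hasDerivAt_perf (D.rhoPsi0 k) (D.rhoPsiInf k) (D.lPsi k) t).hasDerivWithinAt
      (hasDerivWithinAt_psi F (h.vel t ht) k) (hD.rhoPsi_pos k t).ne'
    have h2 : HasDerivAt TPsi (rPsi (D.xiPsi F (x t) t k)) (D.xiPsi F (x t) t k) :=
      (hasDerivAt_TPsi (hdom t ht k)).differentiableAt.hasDerivAt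
    refine (h2.comp_hasDerivWithinAt t h1).congr_deriv ?_
    change rPsi (D.xiPsi F (x t) t k) *
      ((D.rhoPsi k t)⁻¹ * (e' t k - ρ' t k * D.xiPsi F (x t) t k)) = _
    simp only [cPsi, div_eq_mul_inv]
    ring
  have heps : ∀ t ∈ Ico 0 τ, ∀ k, 0 ≤ D.epsPsi F (x t) t k := fun t ht k => by
    rw [epsPsi, TPsi_eq]
    have := hξ0 t k
    have := hdom t ht k
    exact neg_nonneg.2 (Real.log_nonpos (by linarith) (by linarith))
  have hle : ∀ t ∈ Ico 0 τ, ∑ k, D.cPsi F (x t) t k * (e' t k - ρ' t k * D.xiPsi F (x t) t k) ≤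
      -a * W (x t) t + β := by
    intro t ht
    set Y : Fin K → E3 := fun k => act (rot (x t (F.tail k))) (F.eR (x t) k) with hY
    have hs1 : ∑ k, D.cPsi F (x t) t k * e' t k ≤
        1 / 2 * (-q * ∑ k, ‖D.cPsi F (x t) t k • Y k‖ ^ 2 + d) := by
      have := H (fun k => D.cPsi F (x t) t k • Y k)
        (fun i => act (rot (x t i)) (ang (v t i - D.vDes F (x t) t i))) (fun i => by
          rw [SO3.norm_act (x t i).2]
          exact (norm_ang_le _).trans (h.near t ht i))
      refine le_trans (le_of_eq ?_) (mul_le_mul_of_nonneg_left this one_half_pos.le)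
      have e1 : ∀ i, -D.delta i • (∑ k, F.inc i k • D.cPsi F (x t) t k • Y k) +
          act (rot (x t i)) (ang (v t i - D.vDes F (x t) t i)) =
          act (rot (x t i)) (ang (v t i)) := by
        intro i
        rw [← act_rot_omegaDes hFG, ← act_add, ang_sub, ang_vDes, add_sub_cancel]
      simp only [e1]
      rw [← sum_mul_sum_inc, Finset.mul_sum]
      exact Finset.sum_congr rfl fun k _ => by simp only [he']; ring
    have hk : ∀ k, -(q / 2) * ‖D.cPsi F (x t) t k • Y k‖ ^ 2 -
        D.cPsi F (x t) t k * (ρ' t k * D.xiPsi F (x t) t k) ≤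
        -a * D.epsPsi F (x t) t k + D.lPsi k ^ 2 / (4 * A k) := by
      intro k
      have hd := hdom t ht k
      have hξ := hξ0 t k
      have hρ := hD.rhoPsi_pos k t
      have hρ1 := hD.rhoPsi_le k ht.1
      have hr := rPsi_eq hd
      have hψ : F.psi (x t) k = D.rhoPsi k t * D.xiPsi F (x t) t k := by
        rw [xiPsi]; field_simp
      have hε : D.epsPsi F (x t) t k = Real.log (rPsi (D.xiPsi F (x t) t k)) := by
        rw [hr]; rfl
      set ξ := D.xiPsi F (x t) t k with hξd
      set r := rPsi ξ with hrd
      set ρ := D.rhoPsi k t with hρd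
      have hr1 : 1 ≤ r := by rw [hr, le_div_iff₀ hd]; linarith
      have hrξ : r - 1 = r * ξ := by rw [hr]; field_simp; ring
      -- This is `log r ≤ r - 1 = r ξ ≤ r² ξ`, using `r ≥ 1`.
      have hεle : D.epsPsi F (x t) t k ≤ r ^ 2 * ξ := by
        rw [hε]
        have h1 := Real.log_le_sub_one_of_pos (by linarith : 0 < r)
        have h2 : r * ξ ≤ r * (r * ξ) := le_mul_of_one_le_left (by positivity) hr1
        nlinarith
      have hA0 := hApos k
      have hn : 4 * A k * (r ^ 2 * ξ) ≤ q * ‖D.cPsi F (x t) t k • Y k‖ ^ 2 := by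
        rw [norm_smul, mul_pow, Real.norm_eq_abs, sq_abs, hY, SO3.norm_act (x t (F.tail k)).2,
          F.norm_sq_eR, hψ]
        have e : q * (D.cPsi F (x t) t k ^ 2 * (4 * (ρ * ξ) * (2 - ρ * ξ))) =
            4 * (q * ((2 - ρ * ξ) / ρ)) * (r ^ 2 * ξ) := by
          simp only [cPsi]
          rw [← hξd, ← hrd, ← hρd]
          field_simp
        rw [e]
        have : (2 - D.rhoPsi0 k) / D.rhoPsi0 k ≤ (2 - ρ * ξ) / ρ := by
          have : 0 ≤ 2 - D.rhoPsi0 k := (sub_pos.2 (hρ2 k)).le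
          refine div_le_div₀ ?_ ?_ hρ hρ1
          · nlinarith
          · nlinarith
        have h0 : 0 ≤ r ^ 2 * ξ := by positivity
        refine mul_le_mul_of_nonneg_right ?_ h0
        exact mul_le_mul_of_nonneg_left (mul_le_mul_of_nonneg_left this hq.le) (by norm_num)
      have hc : -(D.cPsi F (x t) t k * (ρ' t k * ξ)) ≤ D.lPsi k * (r * ξ) := by
        have e : -(D.cPsi F (x t) t k * (ρ' t k * ξ)) =
            (D.lPsi k * (r * ξ)) * ((ρ - D.rhoPsiInf k) / ρ) := by
          simp only [cPsi, hρ']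
          rw [← hξd, ← hrd, ← hρd]
          ring
        rw [e]
        have hl := hD.lPsi_pos k
        refine mul_le_of_le_one_right (by positivity) ?_
        rw [div_le_one hρ]
        linarith [hD.rhoPsiInf_pos k]
      have hyoung : D.lPsi k * (r * ξ) ≤ A k * (r * ξ) ^ 2 + D.lPsi k ^ 2 / (4 * A k) := by
        have : A k * (r * ξ) ^ 2 + D.lPsi k ^ 2 / (4 * A k) - D.lPsi k * (r * ξ) =
            (2 * A k * (r * ξ) - D.lPsi k) ^ 2 / (4 * A k) := by
          field_simp; ring
        have h3 : 0 ≤ (2 * A k * (r * ξ) - D.lPsi k) ^ 2 / (4 * A k) := by positivity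
        linarith
      have hsq : (r * ξ) ^ 2 ≤ r ^ 2 * ξ := by
        have : r ^ 2 * ξ * ξ ≤ r ^ 2 * ξ * 1 :=
          mul_le_mul_of_nonneg_left (by linarith) (by positivity)
        linarith [mul_pow r ξ 2]
      have h1 := mul_le_mul_of_nonneg_left hsq hA0.le
      have h2 := mul_le_mul_of_nonneg_right (haA k) (heps t ht k)
      have h3 := mul_le_mul_of_nonneg_left hεle hA0.le
      linarith
    have hs2 := Finset.sum_le_sum fun k (_ : k ∈ Finset.univ) => hk k
    rw [Finset.sum_sub_distrib, Finset.sum_add_distrib, ← Finset.mul_sum, ← Finset.mul_sum] at hs2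
    simp only [mul_sub, Finset.sum_sub_distrib]
    simp only [hW, hβ]
    linarith
  have hmain := le_max_of_deriv_le ha hder hle
  rw [h.init] at hmain
  intro t ht k
  have h1 := hmain t ht
  have h2 : D.epsPsi F (x t) t k ≤ W (x t) t :=
    Finset.single_le_sum (f := fun k => D.epsPsi F (x t) t k)
      (fun k _ => heps t ht k) (Finset.mem_univ k)
  rw [abs_of_nonneg (heps t ht k)]
  exact h2.trans h1

theorem exists_kinMargin (hD : D.Admissible F) (hF : F.Admissible) {G : SimpleGraph (Fin N)}
    (hG : G.IsAcyclic) (hFG : F.Orients G) (hρ2 : ∀ k, D.rhoPsi0 k < 2) (x₀ : Fin N → SE3) (b : ℝ) :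
    ∃ κ > 0, ∀ τ x v, D.KinTraj F x₀ b τ x v → ∀ t ∈ Ico 0 τ, D.KinMargin F κ (x t) t := by
  obtain ⟨c₁, h₁⟩ := exists_bound_epsE hD hF hG hFG x₀ b
  obtain ⟨c₂, h₂⟩ := exists_bound_epsPsi hD hG hFG hρ2 x₀ b
  -- Halving makes the margins strict.
  refine ⟨min (Real.exp (-c₁)) (Real.exp (-c₂)) / 2, by positivity, fun τ x v h t ht k => ?_⟩
  obtain ⟨m1, m2, m3⟩ := h.margin t ht k
  have p1 := Real.exp_pos (-c₁)
  have p2 := Real.exp_pos (-c₂)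
  have q1 := min_le_left (Real.exp (-c₁)) (Real.exp (-c₂))
  have q2 := min_le_right (Real.exp (-c₁)) (Real.exp (-c₂))
  obtain ⟨g1, g2⟩ := logRatio_margin (hF.CCol_pos k) (hF.CCon_pos k) m1 m2 (h₁ τ x v h t ht k)
  have g3 : Real.exp (-c₂) ≤ 1 - D.xiPsi F (x t) t k := by
    have := (abs_le.1 (h₂ τ x v h t ht k)).2
    rw [epsPsi, TPsi_eq] at this
    rw [← Real.le_log_iff_exp_le m3]
    linarith
  refine ⟨?_, ?_, ?_⟩ <;> linarith

end Design

theorem hasDerivWithinAt_euclidean_iff {ι : Type} [Fintype ι] {f : ℝ → EuclideanSpace ℝ ι}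
    {f' : EuclideanSpace ℝ ι} {s : Set ℝ} {t : ℝ} :
    HasDerivWithinAt f f' s t ↔ ∀ i, HasDerivWithinAt (fun s => f s i) (f' i) s t := by
  simp only [hasDerivWithinAt_iff_hasFDerivWithinAt]
  rw [hasFDerivWithinAt_euclidean]
  refine forall_congr' fun i => ?_
  have : (PiLp.proj 2 (fun _ : ι => ℝ) i : EuclideanSpace ℝ ι →L[ℝ] ℝ) ∘L
      ContinuousLinearMap.toSpanSingleton ℝ f' = ContinuousLinearMap.toSpanSingleton ℝ (f' i) := by
    ext; simp
  rw [this]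

theorem norm_le_sum_abs {ι : Type} [Fintype ι] (y : EuclideanSpace ℝ ι) : ‖y‖ ≤ ∑ i, |y i| := by
  have h0 : 0 ≤ ∑ i, |y i| := Finset.sum_nonneg fun i _ => abs_nonneg _
  refine le_of_sq_le_sq ?_ h0
  rw [EuclideanSpace.norm_sq_eq, sq, Finset.sum_mul]
  refine Finset.sum_le_sum fun i hi => ?_
  rw [sq]
  exact mul_le_mul_of_nonneg_left
    (Finset.single_le_sum (f := fun i => |y i|) (fun i _ => abs_nonneg _) hi) (abs_nonneg _)

/-! ### A calculus of uniformly bounded functions with uniformly bounded derivatives. -/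

/-- A family of functions on the intervals `[0, τ j)` that is uniformly bounded, with uniformly
bounded derivatives. -/
def BddC1 {ι : Type*} (τ : ι → ℝ) (f : ι → ℝ → ℝ) : Prop :=
  ∃ c, ∀ j, ∀ t ∈ Ico 0 (τ j), |f j t| ≤ c ∧
    ∃ f', |f'| ≤ c ∧ HasDerivWithinAt (f j) f' (Ici 0) t

namespace BddC1

variable {ι : Type*} {τ : ι → ℝ} {f g : ι → ℝ → ℝ}

theorem of_bounds (c d : ℝ) (h : ∀ j, ∀ t ∈ Ico 0 (τ j), |f j t| ≤ c ∧
    ∃ f', |f'| ≤ d ∧ HasDerivWithinAt (f j) f' (Ici 0) t) : BddC1 τ f :=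
  ⟨max c d, fun j t ht => by
    obtain ⟨h1, f', h2, h3⟩ := h j t ht
    exact ⟨le_max_of_le_left h1, f', le_max_of_le_right h2, h3⟩⟩

theorem const (τ : ι → ℝ) (a : ℝ) : BddC1 τ fun _ _ => a :=
  of_bounds |a| 0 fun _ _ _ => ⟨le_rfl, 0, by simp, hasDerivWithinAt_const ..⟩

theorem add (hf : BddC1 τ f) (hg : BddC1 τ g) : BddC1 τ fun j t => f j t + g j t := by
  obtain ⟨c, hc⟩ := hf
  obtain ⟨d, hd⟩ := hg
  refine ⟨c + d, fun j t ht => ?_⟩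
  obtain ⟨h1, f', h2, h3⟩ := hc j t ht
  obtain ⟨k1, g', k2, k3⟩ := hd j t ht
  exact ⟨(abs_add_le _ _).trans (add_le_add h1 k1), f' + g',
    (abs_add_le _ _).trans (add_le_add h2 k2), h3.add k3⟩

theorem neg (hf : BddC1 τ f) : BddC1 τ fun j t => -f j t := by
  obtain ⟨c, hc⟩ := hf
  refine ⟨c, fun j t ht => ?_⟩
  obtain ⟨h1, f', h2, h3⟩ := hc j t ht
  exact ⟨by rwa [abs_neg], -f', by rwa [abs_neg], h3.neg⟩

theorem sub (hf : BddC1 τ f) (hg : BddC1 τ g) : BddC1 τ fun j t => f j t - g j t := by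
  simpa only [sub_eq_add_neg] using hf.add hg.neg

theorem mul (hf : BddC1 τ f) (hg : BddC1 τ g) : BddC1 τ fun j t => f j t * g j t := by
  obtain ⟨c, hc⟩ := hf
  obtain ⟨d, hd⟩ := hg
  refine of_bounds (c * d) (c * d + c * d) fun j t ht => ?_
  obtain ⟨h1, f', h2, h3⟩ := hc j t ht
  obtain ⟨k1, g', k2, k3⟩ := hd j t ht
  have hc0 : 0 ≤ c := (abs_nonneg _).trans h1
  refine ⟨?_, f' * g j t + f j t * g', ?_, h3.mul k3⟩
  · rw [abs_mul]; exact mul_le_mul h1 k1 (abs_nonneg _) hc0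
  · refine (abs_add_le _ _).trans ?_
    rw [abs_mul, abs_mul]
    exact add_le_add (mul_le_mul h2 k1 (abs_nonneg _) hc0) (mul_le_mul h1 k2 (abs_nonneg _) hc0)

theorem sum {κ : Type*} [Fintype κ] {f : κ → ι → ℝ → ℝ} (hf : ∀ k, BddC1 τ (f k)) :
    BddC1 τ fun j t => ∑ k, f k j t := by
  classical
  suffices ∀ s : Finset κ, BddC1 τ fun j t => ∑ k ∈ s, f k j t from this _
  intro s
  induction s using Finset.induction_on with
  | empty => simpa using const τ 0
  | insert a s ha ih => simpa only [Finset.sum_insert ha] using (hf a).add ih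

theorem comp {φ φ' : ℝ → ℝ} {c d : ℝ} (hf : BddC1 τ f)
    (hφ : ∀ j, ∀ t ∈ Ico 0 (τ j), |φ (f j t)| ≤ c ∧ |φ' (f j t)| ≤ d ∧
      HasDerivAt φ (φ' (f j t)) (f j t)) : BddC1 τ fun j t => φ (f j t) := by
  obtain ⟨b, hb⟩ := hf
  refine of_bounds c (d * b) fun j t ht => ?_
  obtain ⟨h1, f', h2, h3⟩ := hb j t ht
  obtain ⟨k1, k2, k3⟩ := hφ j t ht
  refine ⟨k1, _, ?_, k3.comp_hasDerivWithinAt t h3⟩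
  rw [abs_mul]
  exact mul_le_mul k2 h2 (abs_nonneg _) ((abs_nonneg _).trans k2)

theorem inv_perf {a b l : ℝ} (hb : 0 < b) (hab : b < a) (hl : 0 < l) (τ : ι → ℝ) :
    BddC1 τ fun _ t => (perf a b l t)⁻¹ := by
  refine of_bounds b⁻¹ (l / b) fun j t ht => ?_
  have h1 := le_perf (l := l) (t := t) hab
  have h0 : 0 < perf a b l t := hb.trans h1
  refine ⟨?_, _, ?_, ((hasDerivAt_perf a b l t).fun_inv h0.ne').hasDerivWithinAt⟩
  · rw [abs_of_pos (inv_pos.2 h0)]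
    exact inv_anti₀ hb h1.le
  · have e : -(-l * (perf a b l t - b)) / perf a b l t ^ 2 =
        l * ((perf a b l t - b) / perf a b l t) * (perf a b l t)⁻¹ := by
      field_simp
    have h2 : (perf a b l t - b) / perf a b l t ≤ 1 := (div_le_one h0).2 (by linarith)
    have h3 : 0 ≤ (perf a b l t - b) / perf a b l t := div_nonneg (by linarith) h0.le
    have h4 : (perf a b l t)⁻¹ ≤ b⁻¹ := inv_anti₀ hb h1.le
    rw [e, abs_of_nonneg (by positivity), div_eq_mul_inv]
    have h5 : l * ((perf a b l t - b) / perf a b l t) ≤ l := mul_le_of_le_one_right hl.le h2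
    exact mul_le_mul h5 h4 (by positivity) hl.le

theorem matrix_mul {A B : ι → ℝ → Matrix (Fin 3) (Fin 3) ℝ}
    (hA : ∀ a b, BddC1 τ fun j t => A j t a b) (hB : ∀ a b, BddC1 τ fun j t => B j t a b)
    (a b : Fin 3) : BddC1 τ fun j t => (A j t * B j t) a b := by
  simp only [Matrix.mul_apply]
  exact sum fun c => (hA a c).mul (hB c b)

theorem act {A : ι → ℝ → Matrix (Fin 3) (Fin 3) ℝ} {y : ι → ℝ → E3}
    (hA : ∀ a b, BddC1 τ fun j t => A j t a b) (hy : ∀ a, BddC1 τ fun j t => y j t a)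
    (a : Fin 3) : BddC1 τ fun j t => _root_.act (A j t) (y j t) a := by
  simp only [act_apply]
  exact sum fun c => (hA a c).mul (hy c)

end BddC1

section

variable {a b y : ℝ}

theorem hasDerivAt_deriv_logRatio (ha : 0 < a) (hb : 0 < b) (h1 : 0 < 1 + y / a)
    (h2 : 0 < 1 - y / b) :
    HasDerivAt (deriv (logRatio a b)) (-(1 / (a + y) ^ 2) + 1 / (b - y) ^ 2) y := by
  have e1 : a * (1 + y / a) = a + y := by field_simp
  have e2 : b * (1 - y / b) = b - y := by field_simp
  have p1 : 0 < a + y := e1 ▸ mul_pos ha h1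
  have p2 : 0 < b - y := e2 ▸ mul_pos hb h2
  have d1 : HasDerivAt (fun y => a + y) 1 y := (hasDerivAt_id y).const_add a
  have d2 : HasDerivAt (fun y => b - y) (-1) y := (hasDerivAt_id y).const_sub b
  have h : HasDerivAt (fun y => 1 / (a + y) + 1 / (b - y))
      (-(1 / (a + y) ^ 2) + 1 / (b - y) ^ 2) y := by
    have := (d1.fun_inv p1.ne').fun_add (d2.fun_inv p2.ne')
    simp only [one_div]
    refine this.congr_deriv ?_
    field_simp
  refine h.congr_of_eventuallyEq ?_
  have o1 : ∀ᶠ z in 𝓝 y, 0 < 1 + z / a :=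
    (by fun_prop : Continuous fun z : ℝ => 1 + z / a).continuousAt.eventually (lt_mem_nhds h1)
  have o2 : ∀ᶠ z in 𝓝 y, 0 < 1 - z / b :=
    (by fun_prop : Continuous fun z : ℝ => 1 - z / b).continuousAt.eventually (lt_mem_nhds h2)
  filter_upwards [o1, o2] with z z1 z2 using deriv_logRatio ha hb z1 z2

theorem abs_deriv_deriv_logRatio_le (ha : 0 < a) (hb : 0 < b) {κ : ℝ} (hκ : 0 < κ)
    (h1 : κ < 1 + y / a) (h2 : κ < 1 - y / b) :
    |-(1 / (a + y) ^ 2) + 1 / (b - y) ^ 2| ≤ 1 / (a * κ) ^ 2 + 1 / (b * κ) ^ 2 := by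
  have e1 : a * (1 + y / a) = a + y := by field_simp
  have e2 : b * (1 - y / b) = b - y := by field_simp
  have p1 : a * κ ≤ a + y := e1 ▸ mul_le_mul_of_nonneg_left h1.le ha.le
  have p2 : b * κ ≤ b - y := e2 ▸ mul_le_mul_of_nonneg_left h2.le hb.le
  have q1 : 0 < a * κ := by positivity
  have q2 : 0 < b * κ := by positivity
  refine (abs_add_le _ _).trans ?_
  rw [abs_neg, abs_of_nonneg (by positivity), abs_of_nonneg (by positivity)]
  exact add_le_add (one_div_le_one_div_of_le (by positivity) (by gcongr))
    (one_div_le_one_div_of_le (by positivity) (by gcongr))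

theorem hasDerivAt_rPsi (h : 0 < 1 - y) : HasDerivAt rPsi (1 / (1 - y) ^ 2) y := by
  have d2 : HasDerivAt (fun y : ℝ => 1 - y) (-1) y := (hasDerivAt_id y).const_sub 1
  have h' : HasDerivAt (fun y : ℝ => 1 / (1 - y)) (1 / (1 - y) ^ 2) y := by
    simp only [one_div]
    refine (d2.fun_inv h.ne').congr_deriv ?_
    field_simp
  refine h'.congr_of_eventuallyEq ?_
  filter_upwards [(by fun_prop : Continuous fun z : ℝ => 1 - z).continuousAt.eventually
    (lt_mem_nhds h)] with z hz using rPsi_eq hz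

end

/-! ### Consequences of a kinematic margin; the desired velocity has bounded derivative. -/

namespace Design

variable {N K : ℕ} {D : Design N K} {F : Formation N K}

theorem KinMargin.mono {κ κ' : ℝ} {x : Fin N → SE3} {t : ℝ} (h : D.KinMargin F κ x t)
    (hκ : κ' ≤ κ) : D.KinMargin F κ' x t := fun k =>
  ⟨hκ.trans_lt (h k).1, hκ.trans_lt (h k).2.1, hκ.trans_lt (h k).2.2⟩

theorem xiPsi_nonneg (hD : D.Admissible F) (x : Fin N → SE3) (t : ℝ) (k : Fin K) :
    0 ≤ D.xiPsi F x t k :=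
  mul_nonneg (inv_nonneg.2 (hD.rhoPsi_pos k t).le) (F.psi_nonneg _ k)

theorem KinMargin.e_bounds (hD : D.Admissible F) (hF : F.Admissible) {x : Fin N → SE3} {t : ℝ}
    (h : D.KinMargin F 0 x t) (k : Fin K) :
    -F.CCol k * D.rhoE F k t < F.e x k ∧ F.e x k < F.CCon k * D.rhoE F k t := by
  have hC1 := hF.CCol_pos k
  have hC2 := hF.CCon_pos k
  have hρ := hD.rhoE_pos hF k t
  obtain ⟨h1, h2, -⟩ := h k
  have he : F.e x k = D.rhoE F k t * D.xiE F x t k := by rw [xiE]; field_simp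
  have x1 : -F.CCol k < D.xiE F x t k := by
    have : -1 < D.xiE F x t k / F.CCol k := by linarith
    rw [lt_div_iff₀ hC1] at this; linarith
  have x2 : D.xiE F x t k < F.CCon k := by
    have : D.xiE F x t k / F.CCon k < 1 := by linarith
    rw [div_lt_iff₀ hC2] at this; linarith
  rw [he]
  constructor <;> nlinarith

theorem KinMargin.psi_lt (hD : D.Admissible F) {x : Fin N → SE3} {t : ℝ}
    (h : D.KinMargin F 0 x t) (k : Fin K) : F.psi x k < D.rhoPsi k t := by
  have hρ := hD.rhoPsi_pos k t
  have he : F.psi x k = D.rhoPsi k t * D.xiPsi F x t k := by rw [xiPsi]; field_simp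
  have := (h k).2.2
  rw [he]
  nlinarith

theorem KinMargin.rel_bounds (hD : D.Admissible F) (hF : F.Admissible) {x : Fin N → SE3} {t : ℝ}
    (ht : 0 ≤ t) (h : D.KinMargin F 0 x t) (k : Fin K) :
    F.dCol k < ‖F.rel x k‖ ∧ ‖F.rel x k‖ < F.dCon k := by
  obtain ⟨h1, h2⟩ := h.e_bounds hD hF k
  have hC1 := hF.CCol_pos k
  have hC2 := hF.CCon_pos k
  have hρ := hD.rhoE_pos hF k t
  have hρ1 := hD.rhoE_le hF k ht
  have hd := hF.dCol_pos k
  have hd' := hd.trans ((hF.dCol_lt k).trans (hF.lt_dCon k))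
  rw [Formation.e] at h1 h2
  have g1 : F.dCol k ^ 2 < ‖F.rel x k‖ ^ 2 := by
    have : F.CCol k * D.rhoE F k t ≤ F.CCol k := mul_le_of_le_one_right hC1.le hρ1
    have e : F.CCol k = F.dDes k ^ 2 - F.dCol k ^ 2 := rfl
    linarith
  have g2 : ‖F.rel x k‖ ^ 2 < F.dCon k ^ 2 := by
    have : F.CCon k * D.rhoE F k t ≤ F.CCon k := mul_le_of_le_one_right hC2.le hρ1
    have e : F.CCon k = F.dCon k ^ 2 - F.dDes k ^ 2 := rfl
    linarith
  exact ⟨lt_of_pow_lt_pow_left₀ 2 (norm_nonneg _) g1, lt_of_pow_lt_pow_left₀ 2 hd'.le g2⟩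

theorem exists_bound_deriv_vDes (hD : D.Admissible F) (hF : F.Admissible) {κ : ℝ} (hκ : 0 < κ)
    (b : ℝ) : ∃ c, ∀ (τ : ℝ) (x : ℝ → Fin N → SE3) (v : ℝ → Fin N → V6),
      (∀ t ∈ Ico 0 τ, ∀ i, HasBodyVelocity (fun s => x s i) (v t i) t) →
      (∀ t ∈ Ico 0 τ, D.KinMargin F κ (x t) t) → (∀ t ∈ Ico 0 τ, ∀ i, ‖v t i‖ ≤ b) →
      ∀ t ∈ Ico 0 τ, ∀ i, ∃ a, HasDerivWithinAt (fun s => D.vDes F (x s) s i) a (Ici 0) t ∧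
        ‖a‖ ≤ c := by
  -- Indexing by all admissible trajectories at once makes the `BddC1` constants independent of the
  -- trajectory.
  set ι := {p : ℝ × (ℝ → Fin N → SE3) × (ℝ → Fin N → V6) //
    (∀ t ∈ Ico 0 p.1, ∀ i, HasBodyVelocity (fun s => p.2.1 s i) (p.2.2 t i) t) ∧
    (∀ t ∈ Ico 0 p.1, D.KinMargin F κ (p.2.1 t) t) ∧
    (∀ t ∈ Ico 0 p.1, ∀ i, ‖p.2.2 t i‖ ≤ b)} with hι
  set τ : ι → ℝ := fun j => j.1.1 with hτ
  set x : ι → ℝ → Fin N → SE3 := fun j => j.1.2.1 with hx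
  set v : ι → ℝ → Fin N → V6 := fun j => j.1.2.2 with hv
  have hvel : ∀ j, ∀ t ∈ Ico 0 (τ j), ∀ i, HasBodyVelocity (fun s => x j s i) (v j t i) t :=
    fun j => j.2.1
  have hmar : ∀ j, ∀ t ∈ Ico 0 (τ j), D.KinMargin F κ (x j t) t := fun j => j.2.2.1
  have hbd : ∀ j, ∀ t ∈ Ico 0 (τ j), ∀ i, ‖v j t i‖ ≤ b := fun j => j.2.2.2
  have hrot : ∀ i a a', BddC1 τ fun j t => rot (x j t i) a a' := by
    intro i a a'
    exact BddC1.of_bounds 1 (2 * b) fun j t ht => ⟨SO3.abs_apply_le _ _ _, _,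
      SO3.abs_mul_skew_apply_le (x j t i).2 ((norm_ang_le _).trans (hbd j t ht i)) a a',
      (hvel j t ht i).2 a a'⟩
  have hrotT : ∀ i a a', BddC1 τ fun j t => (rot (x j t i))ᵀ a a' := fun i a a' => hrot i a' a
  have hrel : ∀ k a, BddC1 τ fun j t => F.rel (x j t) k a := by
    intro k a
    refine BddC1.of_bounds (F.dCon k) (b + b) fun j t ht => ⟨?_, _, ?_,
      hasDerivWithinAt_euclidean_iff.1
        ((hvel j t ht (F.head k)).1.sub (hvel j t ht (F.tail k)).1) a⟩
    · exact (PiLp.norm_apply_le _ a).trans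
        (((hmar j t ht).mono hκ.le).rel_bounds hD hF ht.1 k).2.le
    · refine (PiLp.norm_apply_le (p := 2) (β := fun _ : Fin 3 => ℝ) _ a).trans
        ((norm_sub_le (E := E3) _ _).trans (add_le_add ?_ ?_))
      · exact (SO3.norm_act (x j t (F.head k)).2 _).trans_le
          ((norm_lin_le _).trans (hbd j t ht (F.head k)))
      · exact (SO3.norm_act (x j t (F.tail k)).2 _).trans_le
          ((norm_lin_le _).trans (hbd j t ht (F.tail k)))
  have hρE : ∀ k, BddC1 τ fun _ t => (D.rhoE F k t)⁻¹ := fun k =>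
    BddC1.inv_perf (hD.rhoEMin_pos hF k) (hD.rhoEMin_lt hF k) (hD.lE_pos k) τ
  have hρψ : ∀ k, BddC1 τ fun _ t => (D.rhoPsi k t)⁻¹ := fun k =>
    BddC1.inv_perf (hD.rhoPsiInf_pos k) (hD.rhoPsiInf_lt k) (hD.lPsi_pos k) τ
  have hξE : ∀ k, BddC1 τ fun j t => D.xiE F (x j t) t k := by
    intro k
    refine (hρE k).mul ?_
    simp only [Formation.e, EuclideanSpace.norm_sq_eq, Real.norm_eq_abs, sq_abs]
    simp only [pow_two]
    exact (BddC1.sum fun a => (hrel k a).mul (hrel k a)).sub (BddC1.const τ _)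
  have hQ : ∀ k a a', BddC1 τ fun j t => ((F.RDes k).1ᵀ * (rot (x j t (F.head k)))ᵀ *
      rot (x j t (F.tail k))) a a' := fun k =>
    BddC1.matrix_mul (BddC1.matrix_mul (fun a a' => BddC1.const τ _) (hrotT _)) (hrot _)
  have hξψ : ∀ k, BddC1 τ fun j t => D.xiPsi F (x j t) t k := by
    intro k
    refine (hρψ k).mul ((BddC1.const τ _).mul ?_)
    simp only [Matrix.trace_sub]
    exact (BddC1.const τ _).sub (BddC1.sum fun a => hQ k a a)
  have heR : ∀ k a, BddC1 τ fun j t => F.eR (x j t) k a := by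
    intro k
    have hA : ∀ a a', BddC1 τ fun j t => ((rot (x j t (F.tail k)))ᵀ * rot (x j t (F.head k)) *
        (F.RDes k).1 - (F.RDes k).1ᵀ * (rot (x j t (F.head k)))ᵀ * rot (x j t (F.tail k))) a a' :=
      fun a a' => (BddC1.matrix_mul (BddC1.matrix_mul (hrotT _) (hrot _))
        (fun a a' => BddC1.const τ ((F.RDes k).1 a a')) a a').sub (hQ k a a')
    intro a
    fin_cases a
    · exact hA 2 1
    · exact hA 0 2
    · exact hA 1 0
  have halpha : ∀ i k a a', BddC1 τ fun j t => F.alpha (x j t) i k a a' := by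
    intro i k a a'
    simp only [Formation.alpha]
    split_ifs
    · exact BddC1.const τ _
    · exact BddC1.matrix_mul (hrotT _) (hrot _) a a'
    · exact BddC1.const τ _
  have hεE : ∀ k, BddC1 τ fun j t => D.epsE F (x j t) t k := by
    intro k
    obtain ⟨c, hc⟩ := exists_bound_logRatio (hF.CCol_pos k) (hF.CCon_pos k) hκ
    refine (hξE k).comp (c := c) (d := c) (φ' := deriv (F.TE k)) fun j t ht => ?_
    obtain ⟨m1, m2, -⟩ := hmar j t ht k
    exact ⟨(hc _ m1 m2).1, (hc _ m1 m2).2, (hasDerivAt_logRatio (hF.CCol_pos k) (hF.CCon_pos k)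
      (hκ.trans m1) (hκ.trans m2)).differentiableAt.hasDerivAt⟩
  have hrE : ∀ k, BddC1 τ fun j t => F.rE k (D.xiE F (x j t) t k) := by
    intro k
    obtain ⟨c, hc⟩ := exists_bound_logRatio (hF.CCol_pos k) (hF.CCon_pos k) hκ
    refine (hξE k).comp (c := c) (d := 1 / (F.CCol k * κ) ^ 2 + 1 / (F.CCon k * κ) ^ 2)
      (φ' := fun y => -(1 / (F.CCol k + y) ^ 2) + 1 / (F.CCon k - y) ^ 2) fun j t ht => ?_
    obtain ⟨m1, m2, -⟩ := hmar j t ht k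
    exact ⟨(hc _ m1 m2).2, abs_deriv_deriv_logRatio_le (hF.CCol_pos k) (hF.CCon_pos k) hκ m1 m2,
      hasDerivAt_deriv_logRatio (hF.CCol_pos k) (hF.CCon_pos k) (hκ.trans m1) (hκ.trans m2)⟩
  have hrψ : ∀ k, BddC1 τ fun j t => rPsi (D.xiPsi F (x j t) t k) := by
    intro k
    obtain ⟨c, hc⟩ := exists_bound_TPsi hκ
    refine (hξψ k).comp (c := c) (d := 1 / κ ^ 2) (φ' := fun y => 1 / (1 - y) ^ 2)
      fun j t ht => ?_
    obtain ⟨-, -, m3⟩ := hmar j t ht k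
    refine ⟨(hc _ (xiPsi_nonneg hD _ _ _) m3).2, ?_, hasDerivAt_rPsi (hκ.trans m3)⟩
    rw [abs_of_nonneg (by positivity)]
    exact one_div_le_one_div_of_le (by positivity) (by gcongr)
  have hcomp : ∀ i l, BddC1 τ fun j t => D.vDes F (x j t) t i l := by
    rintro i (a | a)
    · have e : ∀ j t, D.vDes F (x j t) t i (Sum.inl a) = -(D.delta i) * (2 * ∑ k,
          (F.rE k (D.xiE F (x j t) t k) * (D.rhoE F k t)⁻¹ * D.epsE F (x j t) t k) *
          act (F.alpha (x j t) i k) (act (rot (x j t (F.tail k)))ᵀ (F.rel (x j t) k)) a) := by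
        intro j t
        simp [vDes, stack, vLDes, div_eq_mul_inv]
      simp only [e]
      exact (BddC1.const τ _).mul ((BddC1.const τ _).mul (BddC1.sum fun k =>
        (((hrE k).mul (hρE k)).mul (hεE k)).mul
          (BddC1.act (halpha i k) (BddC1.act (hrotT _) (hrel k)) a)))
    · have e : ∀ j t, D.vDes F (x j t) t i (Sum.inr a) = -(D.delta i) * ∑ k,
          (rPsi (D.xiPsi F (x j t) t k) * (D.rhoPsi k t)⁻¹) *
          act (F.alpha (x j t) i k) (F.eR (x j t) k) a := by
        intro j t
        simp [vDes, stack, omegaDes, div_eq_mul_inv]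
      simp only [e]
      exact (BddC1.const τ _).mul (BddC1.sum fun k =>
        ((hrψ k).mul (hρψ k)).mul (BddC1.act (halpha i k) (heR k) a))
  choose c hc using hcomp
  refine ⟨∑ p : Fin N × Idx6, |c p.1 p.2|, fun τ₀ x₀ v₀ h1 h2 h3 t ht i => ?_⟩
  have := fun l => (hc i l ⟨⟨τ₀, x₀, v₀⟩, h1, h2, h3⟩ t ht).2
  choose f' hf' hd using this
  refine ⟨WithLp.toLp 2 f', ?_, ?_⟩
  · exact hasDerivWithinAt_euclidean_iff.2 hd
  · refine (norm_le_sum_abs _).trans ?_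
    rw [Fintype.sum_prod_type]
    refine (Finset.sum_le_sum fun l _ => (hf' l).trans (le_abs_self (c i l))).trans ?_
    exact Finset.single_le_sum (f := fun i => ∑ l, |c i l|)
      (fun i _ => Finset.sum_nonneg fun l _ => abs_nonneg _) (Finset.mem_univ i)

end Design

/-! ### Bounds for matrices and for the drift of a rigid body. -/

section LinearAlgebra

variable {ι : Type} [Fintype ι]

theorem exists_norm_act_le (A : Matrix ι ι ℝ) :
    ∃ c, 0 ≤ c ∧ ∀ y : EuclideanSpace ℝ ι, ‖act A y‖ ≤ c * ‖y‖ := by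
  let L : EuclideanSpace ℝ ι →ₗ[ℝ] EuclideanSpace ℝ ι :=
    { toFun := act A, map_add' := act_add A, map_smul' := act_smul A }
  exact ⟨‖LinearMap.toContinuousLinearMap L‖, norm_nonneg _,
    (LinearMap.toContinuousLinearMap L).le_opNorm⟩

theorem continuous_act_of {X : Type*} [TopologicalSpace X] {A : X → Matrix ι ι ℝ}
    {y : X → EuclideanSpace ℝ ι} {s : Set X} (hA : ContinuousOn A s) (hy : ContinuousOn y s) :
    ContinuousOn (fun q => act (A q) (y q)) s := by
  have h1 : ContinuousOn (fun q => (y q).ofLp) s :=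
    (PiLp.continuous_ofLp 2 _).comp_continuousOn hy
  refine (PiLp.continuous_toLp 2 _).comp_continuousOn ?_
  rw [continuousOn_iff_continuous_domRestrict] at hA h1 ⊢
  exact hA.matrix_mulVec h1

theorem exists_inner_act_ge [DecidableEq ι] {A : Matrix ι ι ℝ} (hA : A.PosDef) :
    ∃ c > 0, ∀ y : EuclideanSpace ℝ ι, c * ‖y‖ ^ 2 ≤ inner ℝ y (act A y) := by
  have hpos : ∀ y : EuclideanSpace ℝ ι, y ≠ 0 → 0 < inner ℝ y (act A y) := by
    intro y hy
    have h := (Matrix.posDef_iff_dotProduct_mulVec.1 hA).2 (x := y.ofLp)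
      (fun h => hy (by ext i; simp [h]))
    simpa [PiLp.inner_apply, dotProduct, act, mul_comm] using h
  have hcont : Continuous fun y : EuclideanSpace ℝ ι => inner ℝ y (act A y) := by
    refine continuous_id.inner ?_
    rw [← continuousOn_univ]
    exact continuous_act_of continuousOn_const continuousOn_id
  -- The constant is the minimum of the form on the unit sphere, extended by homogeneity. The sphere
  -- is empty when `ι` is.
  by_cases hne : (Metric.sphere (0 : EuclideanSpace ℝ ι) 1).Nonempty
  · obtain ⟨z, hz, hmin⟩ := (isCompact_sphere (0 : EuclideanSpace ℝ ι) 1).exists_isMinOn hne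
      hcont.continuousOn
    have hz1 : ‖z‖ = 1 := by simpa using hz
    refine ⟨_, hpos z (fun h => by simp [h] at hz1), fun y => ?_⟩
    by_cases hy : y = 0
    · simp [hy]
    · have hy' : 0 < ‖y‖ := norm_pos_iff.2 hy
      have := hmin (a := ‖y‖⁻¹ • y) (by simp [norm_smul, hy'.ne'])
      simp only [mem_ofPred_eq] at this
      rw [act_smul, real_inner_smul_left, real_inner_smul_right] at this
      calc _ ≤ ‖y‖⁻¹ * (‖y‖⁻¹ * inner ℝ y (act A y)) * ‖y‖ ^ 2 := by gcongr
        _ = _ := by field_simp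
  · refine ⟨1, one_pos, fun y => ?_⟩
    by_cases hy : y = 0
    · simp [hy]
    · exact absurd ⟨‖y‖⁻¹ • y, by simp [norm_smul, hy]⟩ hne

end LinearAlgebra

theorem RigidBody.Admissible.exists_bound_drift {B : RigidBody} (hB : B.Admissible) (b : ℝ) :
    ∃ c, ∀ x v t, 0 ≤ t → ‖v‖ ≤ b → ‖act (B.C v) v + B.g x + B.w x v t‖ ≤ c := by
  obtain ⟨c₁, h₁⟩ := hB.g_bdd
  obtain ⟨c₂, h₂⟩ := hB.w_bdd b
  obtain ⟨c₃, h₃⟩ := (isCompact_closedBall (0 : V6) b).exists_bound_of_continuousOn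
    (continuous_act_of hB.C_cont.continuousOn continuousOn_id)
  refine ⟨c₃ + c₁ + c₂, fun x v t ht hv => (norm_add₃_le).trans ?_⟩
  exact add_le_add (add_le_add (h₃ v (by simpa using hv)) (h₁ x)) (h₂ x v t ht hv)

/-! ### Signals bounded in terms of the margin, and the Lyapunov estimate for the velocity errors.
-/

section

variable {N K : ℕ} (B : Fin N → RigidBody) (D : Design N K) (F : Formation N K)

/-- The normalized errors keep distance `κ` from the boundary of the domain of the
transformations. -/
def Margin (κ : ℝ) (x : Fin N → SE3) (v : Fin N → V6) (t : ℝ) : Prop :=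
  D.KinMargin F κ x t ∧ ∀ i l,
    κ < 1 + D.xiV F x ((B i).meas (x i) (v i) t) t i l ∧
    κ < 1 - D.xiV F x ((B i).meas (x i) (v i) t) t i l

/-- The closed-loop acceleration of agent `i`. -/
def accel (x : Fin N → SE3) (v : Fin N → V6) (t : ℝ) (i : Fin N) : V6 :=
  act (B i).M⁻¹ (D.u F x ((B i).meas (x i) (v i) t) t i -
    (act ((B i).C (v i)) (v i) + (B i).g (x i) + (B i).w (x i) (v i) t))

variable {B D F}

theorem Margin.mono {κ κ' : ℝ} {x : Fin N → SE3} {v : Fin N → V6} {t : ℝ}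
    (h : Margin B D F κ x v t) (hκ : κ' ≤ κ) : Margin B D F κ' x v t :=
  ⟨h.1.mono hκ, fun i l => ⟨hκ.trans_lt (h.2 i l).1, hκ.trans_lt (h.2 i l).2⟩⟩

theorem Margin.abs_xiV_lt {x : Fin N → SE3} {v : Fin N → V6} {t : ℝ}
    (h : Margin B D F 0 x v t) (i : Fin N) (l : Idx6) :
    |D.xiV F x ((B i).meas (x i) (v i) t) t i l| < 1 := by
  obtain ⟨h1, h2⟩ := h.2 i l
  exact abs_lt.2 ⟨by linarith, by linarith⟩

theorem Margin.abs_eV_lt (hD : D.Admissible F) {x : Fin N → SE3} {v : Fin N → V6} {t : ℝ}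
    (h : Margin B D F 0 x v t) (i : Fin N) (l : Idx6) :
    |D.eV F x ((B i).meas (x i) (v i) t) t i l| < D.rhoV i l t := by
  have hρ := hD.rhoV_pos i l t
  have h1 := h.abs_xiV_lt i l
  rw [Design.xiV, abs_mul, abs_of_pos (inv_pos.2 hρ), inv_mul_lt_iff₀ hρ, mul_one] at h1
  exact h1

theorem act_M_eq_iff (hB : ∀ i, (B i).Admissible) (x : Fin N → SE3) (v : Fin N → V6) (t : ℝ)
    (i : Fin N) (a : V6) :
    D.u F x ((B i).meas (x i) (v i) t) t i =
        act (B i).M a + act ((B i).C (v i)) (v i) + (B i).g (x i) + (B i).w (x i) (v i) t ↔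
      a = accel B D F x v t i := by
  have hdet : IsUnit (B i).M.det := (hB i).M_posDef.det_pos.ne'.isUnit
  rw [accel]
  constructor
  · intro h
    rw [h]
    have : ∀ p q r s : V6, p + q + r + s - (q + r + s) = p := fun p q r s => by abel
    rw [this, act_act, Matrix.nonsing_inv_mul _ hdet, act_one]
  · rintro rfl
    rw [act_act, Matrix.mul_nonsing_inv _ hdet, act_one]
    abel

theorem IsClosedLoopSolution.hasDerivWithinAt_vel (hB : ∀ i, (B i).Admissible) {J : Set ℝ}
    {x : ℝ → Fin N → SE3} {v : ℝ → Fin N → V6} (h : IsClosedLoopSolution B F D J x v) {t : ℝ}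
    (ht : t ∈ J) (i : Fin N) :
    HasDerivWithinAt (fun s => v s i) (accel B D F (x t) (v t) t i) (Ici 0) t := by
  obtain ⟨-, a, ha, he⟩ := h t ht i
  rwa [(act_M_eq_iff hB _ _ _ _ _).1 he] at ha

theorem exists_bound_kin (hD : D.Admissible F) (hF : F.Admissible) {G : SimpleGraph (Fin N)}
    (hFG : F.Orients G) {κ : ℝ} (hκ : 0 < κ) :
    ∃ c, ∀ x t, 0 ≤ t → D.KinMargin F κ x t →
      (∀ k, |D.epsE F x t k| ≤ c ∧ |F.rE k (D.xiE F x t k)| ≤ c ∧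
        |D.epsPsi F x t k| ≤ c ∧ |rPsi (D.xiPsi F x t k)| ≤ c) ∧ ∀ i, ‖D.vDes F x t i‖ ≤ c := by
  have h1 : ∀ k, ∃ c, ∀ y, κ < 1 + y / F.CCol k → κ < 1 - y / F.CCon k →
      |F.TE k y| ≤ c ∧ |F.rE k y| ≤ c := fun k =>
    exists_bound_logRatio (hF.CCol_pos k) (hF.CCon_pos k) hκ
  choose c₁ hc₁ using h1
  obtain ⟨c₂, hc₂⟩ := exists_forall_le c₁
  obtain ⟨c₃, hc₃⟩ := exists_bound_TPsi hκ
  set c := max c₂ c₃ with hc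
  have hk : ∀ x t, 0 ≤ t → D.KinMargin F κ x t → ∀ k, |D.epsE F x t k| ≤ c ∧
      |F.rE k (D.xiE F x t k)| ≤ c ∧ |D.epsPsi F x t k| ≤ c ∧ |rPsi (D.xiPsi F x t k)| ≤ c := by
    intro x t ht h k
    obtain ⟨m1, m2, m3⟩ := h k
    obtain ⟨p1, p2⟩ := hc₁ k _ m1 m2
    obtain ⟨p3, p4⟩ := hc₃ _ (Design.xiPsi_nonneg hD x t k) m3
    exact ⟨le_max_of_le_left (p1.trans (hc₂ k)), le_max_of_le_left (p2.trans (hc₂ k)),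
      le_max_of_le_right p3, le_max_of_le_right p4⟩
  set b₁ : Fin N → ℝ := fun i => 2 * D.delta i *
    ∑ k, |F.inc i k| * (c / D.rhoEMin F k * c * F.dCon k) with hb₁
  set b₂ : Fin N → ℝ := fun i => D.delta i *
    ∑ k, |F.inc i k| * (c / D.rhoPsiInf k * 2) with hb₂
  have hv : ∀ x t, 0 ≤ t → D.KinMargin F κ x t → ∀ i, ‖D.vDes F x t i‖ ≤ b₁ i + b₂ i := by
    intro x t ht h i
    have hδ := hD.delta_pos i
    have n1 : ‖D.vLDes F x t i‖ ≤ b₁ i := by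
      rw [← SO3.norm_act (x i).2, Design.act_rot_vLDes hFG, norm_smul, norm_neg,
        Real.norm_of_nonneg (by positivity)]
      refine mul_le_mul_of_nonneg_left ?_ (by positivity)
      refine (norm_sum_le _ _).trans (Finset.sum_le_sum fun k _ => ?_)
      obtain ⟨p1, p2, -⟩ := hk x t ht h k
      have hc0 : 0 ≤ c := (abs_nonneg _).trans p1
      rw [norm_smul, norm_smul, Real.norm_eq_abs, Real.norm_eq_abs]
      refine mul_le_mul_of_nonneg_left ?_ (abs_nonneg _)
      have hr := ((h.mono hκ.le).rel_bounds hD hF ht k).2.le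
      have hm := hD.rhoEMin_pos hF k
      refine mul_le_mul ?_ hr (norm_nonneg _) (by positivity)
      rw [Design.cE, abs_mul, abs_div, abs_of_pos (hD.rhoE_pos hF k t)]
      refine mul_le_mul ?_ p1 (abs_nonneg _) (by positivity)
      exact div_le_div₀ hc0 p2 hm (le_perf (hD.rhoEMin_lt hF k)).le
    have n2 : ‖D.omegaDes F x t i‖ ≤ b₂ i := by
      rw [← SO3.norm_act (x i).2, Design.act_rot_omegaDes hFG, norm_smul, norm_neg,
        Real.norm_of_nonneg hδ.le]
      refine mul_le_mul_of_nonneg_left ?_ hδ.le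
      refine (norm_sum_le _ _).trans (Finset.sum_le_sum fun k _ => ?_)
      obtain ⟨-, -, -, p4⟩ := hk x t ht h k
      have hc0 : 0 ≤ c := (abs_nonneg _).trans p4
      rw [norm_smul, norm_smul, Real.norm_eq_abs, Real.norm_eq_abs,
        SO3.norm_act (x (F.tail k)).2]
      refine mul_le_mul_of_nonneg_left ?_ (abs_nonneg _)
      have hm := hD.rhoPsiInf_pos k
      have hr : ‖F.eR x k‖ ≤ 2 := by
        refine le_of_sq_le_sq ?_ zero_le_two
        rw [F.norm_sq_eR]
        nlinarith [sq_nonneg (F.psi x k - 1)]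
      refine mul_le_mul ?_ hr (norm_nonneg _) (by positivity)
      rw [Design.cPsi, abs_div, abs_of_pos (hD.rhoPsi_pos k t)]
      exact div_le_div₀ hc0 p4 hm (le_perf (hD.rhoPsiInf_lt k)).le
    have := norm_sq_V6 (D.vDes F x t i)
    rw [Design.lin_vDes, Design.ang_vDes] at this
    have q1 := norm_nonneg (D.vLDes F x t i)
    have q2 := norm_nonneg (D.omegaDes F x t i)
    refine le_of_sq_le_sq ?_ (by linarith)
    rw [this]
    nlinarith
  obtain ⟨d, hd⟩ := exists_forall_le fun i => b₁ i + b₂ i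
  refine ⟨max c d, fun x t ht h => ⟨fun k => ?_, fun i =>
    (hv x t ht h i).trans (le_max_of_le_right (hd i))⟩⟩
  obtain ⟨p1, p2, p3, p4⟩ := hk x t ht h k
  exact ⟨le_max_of_le_left p1, le_max_of_le_left p2, le_max_of_le_left p3, le_max_of_le_left p4⟩

/-- The velocity funnel and the bounded noise alone give the deviation bound `b` that the kinematic
estimates need, so those can be proved before the dynamics are examined. -/
theorem exists_bound_near (hB : ∀ i, (B i).Admissible) (hD : D.Admissible F) :
    ∃ b, ∀ x v t, 0 ≤ t → Margin B D F 0 x v t → ∀ i,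
      ‖(B i).meas (x i) (v i) t - D.vDes F x t i‖ ≤ b ∧ ‖(B i).n (x i) t‖ ≤ b ∧
      ‖v i - D.vDes F x t i‖ ≤ b := by
  choose c hc using fun i => (hB i).n_bdd
  set d : Fin N → ℝ := fun i => |c i| + ∑ l, D.rhoV0 i l with hd
  obtain ⟨b, hb⟩ := exists_forall_le d
  refine ⟨b, fun x v t ht h i => ?_⟩
  have h1 : ‖(B i).meas (x i) (v i) t - D.vDes F x t i‖ ≤ ∑ l, D.rhoV0 i l :=
    (norm_le_sum_abs _).trans (Finset.sum_le_sum fun l _ =>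
      (h.abs_eV_lt hD i l).le.trans (hD.rhoV_le i l ht))
  have h2 : ‖(B i).n (x i) t‖ ≤ |c i| := (hc i _ _ ht).trans (le_abs_self _)
  have h3 := hb i
  simp only [hd] at h3
  refine ⟨by linarith [abs_nonneg (c i)], by 
    linarith [norm_nonneg ((B i).meas (x i) (v i) t - D.vDes F x t i)], ?_⟩
  have e : v i - D.vDes F x t i =
      ((B i).meas (x i) (v i) t - D.vDes F x t i) - (B i).n (x i) t := by
    rw [RigidBody.meas]; abel
  rw [e]
  refine (norm_sub_le _ _).trans ?_
  linarith

theorem exists_bound_vel (hB : ∀ i, (B i).Admissible) (hD : D.Admissible F) (hF : F.Admissible)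
    {G : SimpleGraph (Fin N)} (hFG : F.Orients G) {κ : ℝ} (hκ : 0 < κ) :
    ∃ c, ∀ x v t, 0 ≤ t → Margin B D F κ x v t → ∀ i,
      ‖v i‖ ≤ c ∧ ‖(B i).meas (x i) (v i) t‖ ≤ c ∧
      (∀ l, |D.epsV F x ((B i).meas (x i) (v i) t) t i l| ≤ c ∧
        |rV (D.xiV F x ((B i).meas (x i) (v i) t) t i l)| ≤ c) ∧
      ‖D.u F x ((B i).meas (x i) (v i) t) t i‖ ≤ c ∧ ‖accel B D F x v t i‖ ≤ c := by
  obtain ⟨c₁, hc₁⟩ := exists_bound_kin hD hF hFG hκ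
  obtain ⟨c₂, hc₂⟩ := exists_bound_near hB hD
  obtain ⟨c₃, hc₃⟩ := exists_bound_logRatio one_pos one_pos hκ
  choose c₄ hc₄ using fun i => (hB i).exists_bound_drift (c₁ + c₂)
  choose c₅ hc₅0 hc₅ using fun i => exists_norm_act_le ((B i).M⁻¹)
  set U : Fin N → ℝ := fun i => ∑ l, D.gamma i * ((D.rhoVInf i l)⁻¹ * (c₃ * c₃)) with hU
  obtain ⟨d₁, hd₁⟩ := exists_forall_le U
  obtain ⟨d₂, hd₂⟩ := exists_forall_le fun i => c₅ i * (U i + c₄ i)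
  refine ⟨max (max (c₁ + c₂) (c₁ + c₂)) (max c₃ (max d₁ d₂)), fun x v t ht h i => ?_⟩
  have hv : ‖v i‖ ≤ c₁ + c₂ := by
    have h1 := (hc₁ x t ht h.1).2 i
    have h2 := (hc₂ x v t ht (h.mono hκ.le) i).2.2
    calc ‖v i‖ = ‖D.vDes F x t i + (v i - D.vDes F x t i)‖ := by rw [add_sub_cancel]
      _ ≤ _ := (norm_add_le _ _).trans (add_le_add h1 h2)
  have hm : ‖(B i).meas (x i) (v i) t‖ ≤ c₁ + c₂ := by
    have h1 := (hc₁ x t ht h.1).2 i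
    have h2 := (hc₂ x v t ht (h.mono hκ.le) i).1
    calc ‖(B i).meas (x i) (v i) t‖ =
        ‖D.vDes F x t i + ((B i).meas (x i) (v i) t - D.vDes F x t i)‖ := by rw [add_sub_cancel]
      _ ≤ _ := (norm_add_le _ _).trans (add_le_add h1 h2)
  have hl : ∀ l, |D.epsV F x ((B i).meas (x i) (v i) t) t i l| ≤ c₃ ∧
      |rV (D.xiV F x ((B i).meas (x i) (v i) t) t i l)| ≤ c₃ := by
    intro l
    obtain ⟨m1, m2⟩ := h.2 i l
    have := hc₃ (D.xiV F x ((B i).meas (x i) (v i) t) t i l) (by simpa using m1) (by simpa using m2)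
    rwa [← TV_eq] at this
  have hu : ‖D.u F x ((B i).meas (x i) (v i) t) t i‖ ≤ U i := by
    refine (norm_le_sum_abs _).trans (Finset.sum_le_sum fun l _ => ?_)
    obtain ⟨l1, l2⟩ := hl l
    have hc0 : 0 ≤ c₃ := (abs_nonneg _).trans l1
    have hγ := hD.gamma_pos i
    have hρ := hD.rhoV_pos i l t
    have hρ' := hD.rhoVInf_pos i l
    simp only [Design.u]
    rw [abs_mul, abs_neg, abs_of_pos hγ, abs_mul, abs_of_pos (inv_pos.2 hρ), abs_mul]
    refine mul_le_mul_of_nonneg_left ?_ hγ.le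
    exact mul_le_mul (inv_anti₀ hρ' (le_perf (hD.rhoVInf_lt i l)).le)
      (mul_le_mul l2 l1 (abs_nonneg _) hc0) (by positivity) (by positivity)
  have ha : ‖accel B D F x v t i‖ ≤ c₅ i * (U i + c₄ i) :=
    (hc₅ i _).trans (mul_le_mul_of_nonneg_left
      ((norm_sub_le _ _).trans (add_le_add hu (hc₄ i _ _ _ ht hv))) (hc₅0 i))
  have hr : ∀ {y z : ℝ}, y ≤ z → z ≤ max c₃ (max d₁ d₂) →
      y ≤ max (max (c₁ + c₂) (c₁ + c₂)) (max c₃ (max d₁ d₂)) := fun h1 h2 =>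
    le_max_of_le_right (h1.trans h2)
  refine ⟨le_max_of_le_left (le_max_of_le_left hv), le_max_of_le_left (le_max_of_le_left hm),
    fun l => ⟨hr (hl l).1 (le_max_left _ _), hr (hl l).2 (le_max_left _ _)⟩,
    hr (hu.trans (hd₁ i)) (le_max_of_le_right (le_max_left _ _)),
    hr (ha.trans (hd₂ i)) (le_max_of_le_right (le_max_right _ _))⟩

variable (B D F)

/-- A closed-loop trajectory on `[0, τ)` with initial state `(x₀, v₀)` that stays in the domain of
the transformations. -/
structure Traj (x₀ : Fin N → SE3) (v₀ : Fin N → V6) (τ : ℝ) (x : ℝ → Fin N → SE3)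
    (v : ℝ → Fin N → V6) : Prop where
  sol : IsClosedLoopSolution B F D (Ico 0 τ) x v
  init_x : x 0 = x₀
  init_v : v 0 = v₀
  margin : ∀ t ∈ Ico 0 τ, Margin B D F 0 (x t) (v t) t

variable {B D F}

theorem Traj.exists_bound_kin (hB : ∀ i, (B i).Admissible) (hD : D.Admissible F)
    (hF : F.Admissible) {G : SimpleGraph (Fin N)} (hG : G.IsAcyclic) (hFG : F.Orients G)
    (hρ2 : ∀ k, D.rhoPsi0 k < 2) (x₀ : Fin N → SE3) (v₀ : Fin N → V6) :
    ∃ κ > 0, ∃ c, ∀ τ x v, Traj B D F x₀ v₀ τ x v → ∀ t ∈ Ico 0 τ,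
      D.KinMargin F κ (x t) t ∧ ∀ i, ‖v t i‖ ≤ c ∧
        ∃ a, HasDerivWithinAt (fun s => D.vDes F (x s) s i) a (Ici 0) t ∧ ‖a‖ ≤ c := by
  obtain ⟨b, hb⟩ := exists_bound_near hB hD
  obtain ⟨κ, hκ, hm⟩ := Design.exists_kinMargin hD hF hG hFG hρ2 x₀ b
  obtain ⟨c₁, hc₁⟩ := _root_.exists_bound_kin hD hF hFG hκ
  obtain ⟨c₂, hc₂⟩ := Design.exists_bound_deriv_vDes hD hF hκ (c₁ + b)
  refine ⟨κ, hκ, max (c₁ + b) c₂, fun τ x v h => ?_⟩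
  have hk : D.KinTraj F x₀ b τ x v :=
    ⟨h.init_x, fun t ht i => (h.sol t ht i).1, fun t ht => (h.margin t ht).1,
      fun t ht i => (hb _ _ t ht.1 (h.margin t ht) i).2.2⟩
  have hkm := hm τ x v hk
  have hv : ∀ t ∈ Ico 0 τ, ∀ i, ‖v t i‖ ≤ c₁ + b := by
    intro t ht i
    have h1 := (hc₁ (x t) t ht.1 (hkm t ht)).2 i
    have h2 := hk.near t ht i
    calc ‖v t i‖ = ‖D.vDes F (x t) t i + (v t i - D.vDes F (x t) t i)‖ := by rw [add_sub_cancel]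
      _ ≤ _ := (norm_add_le _ _).trans (add_le_add h1 h2)
  intro t ht
  refine ⟨hkm t ht, fun i => ⟨le_max_of_le_left (hv t ht i), ?_⟩⟩
  obtain ⟨a, ha, ha'⟩ := hc₂ τ x v hk.vel hkm hv t ht i
  exact ⟨a, ha, le_max_of_le_right ha'⟩

/-- The input is `-γ y`, where `y` is the gradient of `½ ∑ ε_v²` in the velocity error. It
contributes `-γ ⟨y, M⁻¹ y⟩ ≤ -γ μ ‖y‖²`, while drift, noise rate, derivative of the desired velocity
and drift of the funnel are bounded by `m`. -/
theorem Traj.exists_bound_epsV (hB : ∀ i, (B i).Admissible) (hD : D.Admissible F)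
    (hF : F.Admissible) {G : SimpleGraph (Fin N)} (hG : G.IsAcyclic) (hFG : F.Orients G)
    (hρ2 : ∀ k, D.rhoPsi0 k < 2) (x₀ : Fin N → SE3) (v₀ : Fin N → V6) (i : Fin N) :
    ∃ c, ∀ τ x v, Traj B D F x₀ v₀ τ x v → ∀ t ∈ Ico 0 τ, ∀ l,
      |D.epsV F (x t) ((B i).meas (x t i) (v t i) t) t i l| ≤ c := by
  obtain ⟨κ, hκ, b, hb⟩ := Traj.exists_bound_kin hB hD hF hG hFG hρ2 x₀ v₀
  obtain ⟨c₁, hc₁⟩ := (hB i).exists_bound_drift b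
  obtain ⟨c₂, hc₂0, hc₂⟩ := exists_norm_act_le ((B i).M⁻¹)
  obtain ⟨nd, hnd, -, hndb⟩ := (hB i).n_deriv
  obtain ⟨c₃, hc₃⟩ := hndb b
  obtain ⟨μ, hμ, hμM⟩ := exists_inner_act_ge (hB i).M_posDef.inv
  have hγ := hD.gamma_pos i
  have hρ0 : ∀ l, 0 < D.rhoV0 i l := fun l => (hD.rhoVInf_pos i l).trans (hD.rhoVInf_lt i l)
  -- Half of the dissipation `γ μ ‖y‖²` absorbs `‖y‖ m`; the other half bounds `a W`, since `r_v ≥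
  -- 1/2` and `ρ_v ≤ ρ_v⁰`.
  set q : ℝ := D.gamma i * μ / 2 with hq
  have hq0 : 0 < q := by positivity
  set A : Idx6 → ℝ := fun l => 2 * q * (1 / 2 / D.rhoV0 i l) ^ 2 with hA
  obtain ⟨a, ha, haA⟩ := exists_pos_forall_le A fun l => by have := hρ0 l; positivity
  set m : ℝ := c₂ * c₁ + (c₃ + b) + ∑ l, D.lV i l * D.rhoV0 i l with hm
  set β : ℝ := m ^ 2 / (4 * q) with hβ
  set W : (Fin N → SE3) → (Fin N → V6) → ℝ → ℝ := fun x v t =>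
    ∑ l, 1 / 2 * D.epsV F x ((B i).meas (x i) (v i) t) t i l ^ 2 with hW
  set M := max (W x₀ v₀ 0) (β / a) + 1 with hM
  refine ⟨2 * M + 1, fun τ x v h => ?_⟩
  choose! vd hvd hvdb using fun t (ht : t ∈ Ico 0 τ) => ((hb τ x v h t ht).2 i).2
  set ξ : ℝ → Idx6 → ℝ := fun t l => D.xiV F (x t) ((B i).meas (x t i) (v t i) t) t i l with hξ
  set ρ' : ℝ → Idx6 → ℝ := fun t l => -D.lV i l * (D.rhoV i l t - D.rhoVInf i l) with hρ'
  set y : ℝ → V6 := fun t => WithLp.toLp 2 fun l =>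
    (D.rhoV i l t)⁻¹ * (rV (ξ t l) * TV (ξ t l)) with hy
  set z : ℝ → V6 := fun t => WithLp.toLp 2 fun l => ρ' t l * ξ t l with hz
  set e' : ℝ → V6 := fun t => accel B D F (x t) (v t) t i + nd (x t i) (v t i) t - vd t with he'
  have hdom : ∀ t ∈ Ico 0 τ, ∀ l, 0 < 1 + ξ t l / 1 ∧ 0 < 1 - ξ t l / 1 := fun t ht l => by
    simpa using (h.margin t ht).2 i l
  have hder : ∀ t ∈ Ico 0 τ, HasDerivWithinAt (fun s => W (x s) (v s) s)
      (inner ℝ (y t) (e' t - z t)) (Ici 0) t := by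
    intro t ht
    rw [PiLp.inner_apply]
    refine HasDerivWithinAt.fun_sum fun l _ => ?_
    have h0 : HasDerivWithinAt (fun s => D.eV F (x s) ((B i).meas (x s i) (v s i) s) s i)
        (e' t) (Ici 0) t :=
      ((h.sol.hasDerivWithinAt_vel hB ht i).add
        (hnd _ _ t ht.1 (h.sol t ht i).1)).sub (hvd t ht)
    have h1 := Design.hasDerivWithinAt_inv_mul
      (hasDerivAt_perf (D.rhoV0 i l) (D.rhoVInf i l) (D.lV i l) t).hasDerivWithinAt
      (hasDerivWithinAt_euclidean_iff.1 h0 l) (hD.rhoV_pos i l t).ne'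
    have h2 : HasDerivAt TV (rV (ξ t l)) (ξ t l) := by
      have := (hasDerivAt_logRatio one_pos one_pos (hdom t ht l).1
        (hdom t ht l).2).differentiableAt.hasDerivAt
      rwa [← TV_eq] at this
    have h3 := HasDerivAt.comp_hasDerivWithinAt (h := fun s => ξ s l) t h2 h1
    refine ((h3.pow 2).const_mul (1 / 2)).congr_deriv ?_
    change 1 / 2 * (_ * TV (ξ t l) ^ (2 - 1) * (rV (ξ t l) *
      ((D.rhoV i l t)⁻¹ * (e' t l - ρ' t l * ξ t l)))) =
      (e' t l - ρ' t l * ξ t l) * ((D.rhoV i l t)⁻¹ * (rV (ξ t l) * TV (ξ t l)))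
    push_cast
    ring
  have hle : ∀ t ∈ Ico 0 τ, inner ℝ (y t) (e' t - z t) ≤ -a * W (x t) (v t) t + β := by
    intro t ht
    set drift := act ((B i).C (v t i)) (v t i) + (B i).g (x t i) + (B i).w (x t i) (v t i) t
      with hdrift
    have hu : D.u F (x t) ((B i).meas (x t i) (v t i) t) t i = -D.gamma i • y t := by
      ext l; rfl
    set r : V6 := -act (B i).M⁻¹ drift + (nd (x t i) (v t i) t - vd t) - z t with hr
    have hsplit : e' t - z t = -D.gamma i • act (B i).M⁻¹ (y t) + r := by
      simp only [he', accel, hr]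
      rw [hu, ← hdrift, act_sub, act_smul]
      abel
    have hvb := ((hb τ x v h t ht).2 i).1
    have hzb : ‖z t‖ ≤ ∑ l, D.lV i l * D.rhoV0 i l := by
      refine (norm_le_sum_abs _).trans (Finset.sum_le_sum fun l _ => ?_)
      change |ρ' t l * ξ t l| ≤ _
      have h1 : |ξ t l| ≤ 1 := ((h.margin t ht).abs_xiV_lt i l).le
      have h2 : |ρ' t l| ≤ D.lV i l * D.rhoV0 i l := by
        have g1 := hD.rhoV_le i l ht.1
        have g2 : D.rhoVInf i l < D.rhoV i l t := le_perf (hD.rhoVInf_lt i l)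
        have g3 := hD.lV_pos i l
        have g4 := hD.rhoVInf_pos i l
        simp only [hρ']
        rw [abs_mul, abs_neg, abs_of_pos g3, abs_of_pos (by linarith)]
        exact mul_le_mul_of_nonneg_left (by linarith) g3.le
      rw [abs_mul]
      simpa using mul_le_mul h2 h1 (abs_nonneg _) ((abs_nonneg _).trans h2)
    have hrb : ‖r‖ ≤ m := by
      refine (norm_sub_le _ _).trans (add_le_add ((norm_add_le _ _).trans (add_le_add ?_ ?_)) hzb)
      · rw [norm_neg]
        exact (hc₂ _).trans (mul_le_mul_of_nonneg_left (hc₁ _ _ _ ht.1 hvb) hc₂0)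
      · exact (norm_sub_le _ _).trans (add_le_add (hc₃ _ _ _ ht.1 hvb) (hvdb t ht))
    have hyy : a * W (x t) (v t) t ≤ q * ‖y t‖ ^ 2 := by
      simp only [hW]
      rw [EuclideanSpace.norm_sq_eq, Finset.mul_sum, Finset.mul_sum]
      refine Finset.sum_le_sum fun l _ => ?_
      change a * (1 / 2 * TV (ξ t l) ^ 2) ≤
        q * |(D.rhoV i l t)⁻¹ * (rV (ξ t l) * TV (ξ t l))| ^ 2
      rw [sq_abs]
      have h1 : 1 / 2 ≤ rV (ξ t l) := by
        have := le_deriv_logRatio one_pos one_pos (hdom t ht l).1 (hdom t ht l).2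
        rw [← TV_eq] at this
        norm_num at this ⊢
        exact this
      have h2 : 1 / 2 / D.rhoV0 i l ≤ (D.rhoV i l t)⁻¹ * rV (ξ t l) := by
        rw [mul_comm, ← div_eq_mul_inv]
        exact div_le_div₀ (by linarith) h1 (hD.rhoV_pos i l t) (hD.rhoV_le i l ht.1)
      have h3 : (1 / 2 / D.rhoV0 i l) ^ 2 ≤ ((D.rhoV i l t)⁻¹ * rV (ξ t l)) ^ 2 := by
        have := hρ0 l
        gcongr
      have h4 := mul_le_mul_of_nonneg_right (haA l) (sq_nonneg (TV (ξ t l)))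
      have h5 := mul_le_mul_of_nonneg_left (mul_le_mul_of_nonneg_right h3
        (sq_nonneg (TV (ξ t l)))) hq0.le
      simp only [hA] at h4
      have e : ((D.rhoV i l t)⁻¹ * (rV (ξ t l) * TV (ξ t l))) ^ 2 =
        ((D.rhoV i l t)⁻¹ * rV (ξ t l)) ^ 2 * TV (ξ t l) ^ 2 := by ring
      rw [e]
      linarith
    rw [hsplit, inner_add_right, real_inner_smul_right]
    have i1 := mul_le_mul_of_nonneg_left (hμM (y t)) hγ.le
    have i2 : inner ℝ (y t) r ≤ ‖y t‖ * m :=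
      (real_inner_le_norm _ _).trans (mul_le_mul_of_nonneg_left hrb (norm_nonneg _))
    have i3 : ‖y t‖ * m ≤ q * ‖y t‖ ^ 2 + m ^ 2 / (4 * q) := by
      have : q * ‖y t‖ ^ 2 + m ^ 2 / (4 * q) - ‖y t‖ * m = (2 * q * ‖y t‖ - m) ^ 2 / (4 * q) := by
        field_simp; ring
      have h3 : 0 ≤ (2 * q * ‖y t‖ - m) ^ 2 / (4 * q) := by positivity
      linarith
    have i4 : D.gamma i * (μ * ‖y t‖ ^ 2) = 2 * (q * ‖y t‖ ^ 2) := by rw [hq]; ring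
    linarith
  have hmain := le_max_of_deriv_le ha hder hle
  rw [h.init_x, h.init_v] at hmain
  intro t ht l
  have h1 := hmain t ht
  set ε := D.epsV F (x t) ((B i).meas (x t i) (v t i) t) t i l with hε
  have h2 : 1 / 2 * ε ^ 2 ≤ W (x t) (v t) t :=
    Finset.single_le_sum
      (f := fun l => 1 / 2 * D.epsV F (x t) ((B i).meas (x t i) (v t i) t) t i l ^ 2)
      (fun l _ => by positivity) (Finset.mem_univ l)
  rw [abs_le]
  constructor <;> nlinarith [sq_nonneg (ε - 1), sq_nonneg (ε + 1)]

theorem Traj.exists_margin (hB : ∀ i, (B i).Admissible) (hD : D.Admissible F)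
    (hF : F.Admissible) {G : SimpleGraph (Fin N)} (hG : G.IsAcyclic) (hFG : F.Orients G)
    (hρ2 : ∀ k, D.rhoPsi0 k < 2) (x₀ : Fin N → SE3) (v₀ : Fin N → V6) :
    ∃ κ > 0, ∀ τ x v, Traj B D F x₀ v₀ τ x v → ∀ t ∈ Ico 0 τ,
      Margin B D F κ (x t) (v t) t := by
  obtain ⟨κ, hκ, _, hb⟩ := Traj.exists_bound_kin hB hD hF hG hFG hρ2 x₀ v₀
  choose c hc using fun i => Traj.exists_bound_epsV hB hD hF hG hFG hρ2 x₀ v₀ i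
  obtain ⟨d, hd⟩ := exists_forall_le c
  have hpos := Real.exp_pos (-d)
  refine ⟨min κ (Real.exp (-d) / 2), by positivity, fun τ x v h t ht =>
    ⟨(hb τ x v h t ht).1.mono (min_le_left _ _), fun i l => ?_⟩⟩
  have h1 := (hc i τ x v h t ht l).trans (hd i)
  obtain ⟨m1, m2⟩ := (h.margin t ht).2 i l
  rw [Design.epsV, TV_eq] at h1
  obtain ⟨g1, g2⟩ := logRatio_margin one_pos one_pos (by simpa using m1) (by simpa using m2) h1
  rw [div_one] at g1 g2
  have := min_le_right κ (Real.exp (-d) / 2)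
  constructor <;> linarith

end

/-! ### Continuity of the closed loop and propagation of margins. -/

section Continuity

variable {N K : ℕ} {B : Fin N → RigidBody} {D : Design N K} {F : Formation N K}

theorem continuous_rot (i : Fin N) : Continuous fun x : Fin N → SE3 => rot (x i) :=
  continuous_subtype_val.comp (continuous_snd.comp (continuous_apply i))

theorem continuous_rel (k : Fin K) : Continuous fun x : Fin N → SE3 => F.rel x k :=
  (continuous_fst.comp (continuous_apply _)).sub (continuous_fst.comp (continuous_apply _))

theorem continuous_e (k : Fin K) : Continuous fun x : Fin N → SE3 => F.e x k :=
  ((continuous_rel k).norm.pow 2).sub continuous_const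

theorem continuous_psi (k : Fin K) : Continuous fun x : Fin N → SE3 => F.psi x k :=
  continuous_const.mul (Continuous.matrix_trace (continuous_const.sub
    ((continuous_const.matrix_mul (continuous_rot (F.head k)).matrix_transpose).matrix_mul
      (continuous_rot (F.tail k)))))

theorem continuous_vee : Continuous vee := by
  unfold vee
  refine (PiLp.continuous_toLp 2 _).comp (continuous_pi fun i => ?_)
  fin_cases i
  · exact continuous_apply_apply (2 : Fin 3) (1 : Fin 3)
  · exact continuous_apply_apply (0 : Fin 3) (2 : Fin 3)
  · exact continuous_apply_apply (1 : Fin 3) (0 : Fin 3)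

theorem continuous_eR (k : Fin K) : Continuous fun x : Fin N → SE3 => F.eR x k :=
  continuous_vee.comp
    ((((continuous_rot (F.tail k)).matrix_transpose.matrix_mul
      (continuous_rot (F.head k))).matrix_mul continuous_const).sub
    ((continuous_const.matrix_mul (continuous_rot (F.head k)).matrix_transpose).matrix_mul
      (continuous_rot (F.tail k))))

theorem continuous_alpha (i : Fin N) (k : Fin K) :
    Continuous fun x : Fin N → SE3 => F.alpha x i k := by
  unfold Formation.alpha
  split_ifs
  · exact continuous_const
  · exact (continuous_rot (F.head k)).matrix_transpose.matrix_mul (continuous_rot (F.tail k))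
  · exact continuous_const

theorem continuous_xiE (hD : D.Admissible F) (hF : F.Admissible) (k : Fin K) :
    Continuous fun q : (Fin N → SE3) × ℝ => D.xiE F q.1 q.2 k :=
  ((continuous_perf.comp continuous_snd).inv₀ fun q => (hD.rhoE_pos hF k q.2).ne').mul
    ((continuous_e k).comp continuous_fst)

theorem continuous_xiPsi (hD : D.Admissible F) (k : Fin K) :
    Continuous fun q : (Fin N → SE3) × ℝ => D.xiPsi F q.1 q.2 k :=
  ((continuous_perf.comp continuous_snd).inv₀ fun q => (hD.rhoPsi_pos k q.2).ne').mul
    ((continuous_psi k).comp continuous_fst)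

theorem isOpen_kinMargin (hD : D.Admissible F) (hF : F.Admissible) (κ : ℝ) :
    IsOpen {q : (Fin N → SE3) × ℝ | D.KinMargin F κ q.1 q.2} := by
  simp only [Design.KinMargin, ofPred_forall]
  refine isOpen_iInter_of_finite fun k => ?_
  have h1 := continuous_xiE hD hF k
  have h2 := continuous_xiPsi (D := D) hD k
  exact (isOpen_lt continuous_const (continuous_const.add (h1.div_const _))).inter
    ((isOpen_lt continuous_const (continuous_const.sub (h1.div_const _))).inter
      (isOpen_lt continuous_const (continuous_const.sub h2)))

theorem continuousOn_vDes (hD : D.Admissible F) (hF : F.Admissible) (i : Fin N) :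
    ContinuousOn (fun q : (Fin N → SE3) × ℝ => D.vDes F q.1 q.2 i)
      {q | D.KinMargin F 0 q.1 q.2} := by
  have hrE : ∀ k, ContinuousOn (fun q : (Fin N → SE3) × ℝ => F.rE k (D.xiE F q.1 q.2 k))
      {q | D.KinMargin F 0 q.1 q.2} := fun k q hq =>
    ((hasDerivAt_deriv_logRatio (hF.CCol_pos k) (hF.CCon_pos k) (hq k).1
      (hq k).2.1).continuousAt.comp (f := fun q : (Fin N → SE3) × ℝ => D.xiE F q.1 q.2 k)
        (continuous_xiE hD hF k).continuousAt).continuousWithinAt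
  have hεE : ∀ k, ContinuousOn (fun q : (Fin N → SE3) × ℝ => D.epsE F q.1 q.2 k)
      {q | D.KinMargin F 0 q.1 q.2} := fun k q hq =>
    ((hasDerivAt_logRatio (hF.CCol_pos k) (hF.CCon_pos k) (hq k).1
      (hq k).2.1).continuousAt.comp (f := fun q : (Fin N → SE3) × ℝ => D.xiE F q.1 q.2 k)
        (continuous_xiE hD hF k).continuousAt).continuousWithinAt
  have hrψ : ∀ k, ContinuousOn (fun q : (Fin N → SE3) × ℝ => rPsi (D.xiPsi F q.1 q.2 k))
      {q | D.KinMargin F 0 q.1 q.2} := fun k q hq =>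
    ((hasDerivAt_rPsi (hq k).2.2).continuousAt.comp
      (f := fun q : (Fin N → SE3) × ℝ => D.xiPsi F q.1 q.2 k)
      (continuous_xiPsi hD k).continuousAt).continuousWithinAt
  have hρE : ∀ k, Continuous fun q : (Fin N → SE3) × ℝ => D.rhoE F k q.2 := fun k =>
    continuous_perf.comp continuous_snd
  have hρψ : ∀ k, Continuous fun q : (Fin N → SE3) × ℝ => D.rhoPsi k q.2 := fun k =>
    continuous_perf.comp continuous_snd
  have hα : ∀ k, Continuous fun q : (Fin N → SE3) × ℝ => F.alpha q.1 i k := fun k =>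
    (continuous_alpha i k).comp continuous_fst
  have h1 : ContinuousOn (fun q : (Fin N → SE3) × ℝ => D.vLDes F q.1 q.2 i)
      {q | D.KinMargin F 0 q.1 q.2} := by
    simp only [Design.vLDes]
    refine ContinuousOn.fun_const_smul (ContinuousOn.fun_const_smul
      (continuousOn_finsetSum _ fun k _ => ?_) _) _
    refine (((hrE k).div (hρE k).continuousOn fun q _ => (hD.rhoE_pos hF k q.2).ne').mul
      (hεE k)).smul (continuous_act_of (hα k).continuousOn (continuous_act_of ?_ ?_))
    · exact (((continuous_rot _).comp continuous_fst).matrix_transpose).continuousOn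
    · exact ((continuous_rel k).comp continuous_fst).continuousOn
  have h2 : ContinuousOn (fun q : (Fin N → SE3) × ℝ => D.omegaDes F q.1 q.2 i)
      {q | D.KinMargin F 0 q.1 q.2} := by
    simp only [Design.omegaDes]
    refine ContinuousOn.fun_const_smul (continuousOn_finsetSum _ fun k _ => ?_) _
    exact ((hrψ k).div (hρψ k).continuousOn fun q _ => (hD.rhoPsi_pos k q.2).ne').smul
      (continuous_act_of (hα k).continuousOn ((continuous_eR k).comp continuous_fst).continuousOn)
  refine (PiLp.continuous_toLp 2 _).comp_continuousOn (continuousOn_pi.2 ?_)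
  rintro (a | a)
  · exact (PiLp.continuous_apply 2 _ a).comp_continuousOn h1
  · exact (PiLp.continuous_apply 2 _ a).comp_continuousOn h2

/-- Time together with the full state of all agents. -/
abbrev TimeState (N : ℕ) : Type := ℝ × (Fin N → SE3) × (Fin N → V6)

theorem continuousOn_xiV (hB : ∀ i, (B i).Admissible) (hD : D.Admissible F) (hF : F.Admissible)
    (i : Fin N) (l : Idx6) :
    ContinuousOn (fun q : TimeState N =>
      D.xiV F q.2.1 ((B i).meas (q.2.1 i) (q.2.2 i) q.1) q.1 i l)
      {q | 0 ≤ q.1 ∧ D.KinMargin F 0 q.2.1 q.1} := by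
  have hρ : Continuous fun q : TimeState N => D.rhoV i l q.1 := continuous_perf.comp continuous_fst
  refine ((hρ.inv₀ fun q => (hD.rhoV_pos i l q.1).ne').continuousOn).mul
    ((PiLp.continuous_apply 2 _ l).comp_continuousOn (ContinuousOn.sub (ContinuousOn.add ?_ ?_) ?_))
  · exact ((continuous_apply i).comp (continuous_snd.comp continuous_snd)).continuousOn
  · refine (hB i).n_cont.comp (g := fun q : SE3 × ℝ => (B i).n q.1 q.2)
      (f := fun q : TimeState N => (q.2.1 i, q.1)) (Continuous.continuousOn ?_) fun q hq => hq.1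
    fun_prop
  · refine (continuousOn_vDes hD hF i).comp (f := fun q : TimeState N => (q.2.1, q.1))
      (Continuous.continuousOn ?_) fun q hq => hq.2
    fun_prop

theorem continuousOn_accel (hB : ∀ i, (B i).Admissible) (hD : D.Admissible F) (hF : F.Admissible)
    (i : Fin N) :
    ContinuousOn (fun q : TimeState N => accel B D F q.2.1 q.2.2 q.1 i)
      {q | 0 ≤ q.1 ∧ Margin B D F 0 q.2.1 q.2.2 q.1} := by
  have hx : Continuous fun q : TimeState N => q.2.1 i := by fun_prop
  have hv : Continuous fun q : TimeState N => q.2.2 i := by fun_prop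
  refine continuous_act_of continuousOn_const (ContinuousOn.sub ?_ (ContinuousOn.add
    (ContinuousOn.add ?_ ?_) ?_))
  · refine (PiLp.continuous_toLp 2 _).comp_continuousOn (continuousOn_pi.2 fun l => ?_)
    have hρ : Continuous fun q : TimeState N => D.rhoV i l q.1 :=
      continuous_perf.comp continuous_fst
    have hξ : ContinuousOn (fun q : TimeState N =>
        D.xiV F q.2.1 ((B i).meas (q.2.1 i) (q.2.2 i) q.1) q.1 i l)
        {q | 0 ≤ q.1 ∧ Margin B D F 0 q.2.1 q.2.2 q.1} :=
      (continuousOn_xiV hB hD hF i l).mono fun q hq => ⟨hq.1, hq.2.1⟩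
    refine continuousOn_const.mul
      (((hρ.inv₀ fun q => (hD.rhoV_pos i l q.1).ne').continuousOn).mul (ContinuousOn.mul ?_ ?_))
    · intro q hq
      obtain ⟨m1, m2⟩ := hq.2.2 i l
      have := (hasDerivAt_deriv_logRatio one_pos one_pos (by simpa using m1)
        (by simpa using m2)).continuousAt
      rw [← TV_eq] at this
      exact this.comp_continuousWithinAt (f := fun q : TimeState N =>
        D.xiV F q.2.1 ((B i).meas (q.2.1 i) (q.2.2 i) q.1) q.1 i l) (hξ q hq)
    · intro q hq
      obtain ⟨m1, m2⟩ := hq.2.2 i l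
      have := (hasDerivAt_logRatio one_pos one_pos (by simpa using m1)
        (by simpa using m2)).continuousAt
      rw [← TV_eq] at this
      exact this.comp_continuousWithinAt (f := fun q : TimeState N =>
        D.xiV F q.2.1 ((B i).meas (q.2.1 i) (q.2.2 i) q.1) q.1 i l) (hξ q hq)
  · exact continuous_act_of ((hB i).C_cont.comp hv).continuousOn hv.continuousOn
  · exact ((hB i).g_cont.comp hx).continuousOn
  · refine (hB i).w_cont.comp (g := fun q : SE3 × V6 × ℝ => (B i).w q.1 q.2.1 q.2.2)
      (f := fun q : TimeState N => (q.2.1 i, q.2.2 i, q.1)) (Continuous.continuousOn ?_)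
      fun q hq => hq.1
    fun_prop

variable (B D F)

/-- The states at which the normalized errors keep distance at least `κ` from the boundary of the
domain of the transformations. -/
def safeSet (κ : ℝ) : Set (TimeState N) :=
  {q | (0 ≤ q.1 ∧ ∀ k, κ ≤ 1 + D.xiE F q.2.1 q.1 k / F.CCol k ∧
    κ ≤ 1 - D.xiE F q.2.1 q.1 k / F.CCon k ∧ κ ≤ 1 - D.xiPsi F q.2.1 q.1 k) ∧
    ∀ i l, κ ≤ 1 + D.xiV F q.2.1 ((B i).meas (q.2.1 i) (q.2.2 i) q.1) q.1 i l ∧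
      κ ≤ 1 - D.xiV F q.2.1 ((B i).meas (q.2.1 i) (q.2.2 i) q.1) q.1 i l}

variable {B D F}

theorem margin_of_mem_safeSet {κ κ' : ℝ} (hκ : κ' < κ) {q : TimeState N}
    (hq : q ∈ safeSet B D F κ) : Margin B D F κ' q.2.1 q.2.2 q.1 :=
  ⟨fun k => ⟨hκ.trans_le (hq.1.2 k).1, hκ.trans_le (hq.1.2 k).2.1, hκ.trans_le (hq.1.2 k).2.2⟩,
    fun i l => ⟨hκ.trans_le (hq.2 i l).1, hκ.trans_le (hq.2 i l).2⟩⟩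

theorem mem_safeSet_of_margin {κ t : ℝ} (ht : 0 ≤ t) {x : Fin N → SE3} {v : Fin N → V6}
    (h : Margin B D F κ x v t) : (t, x, v) ∈ safeSet B D F κ :=
  ⟨⟨ht, fun k => ⟨(h.1 k).1.le, (h.1 k).2.1.le, (h.1 k).2.2.le⟩⟩,
    fun i l => ⟨(h.2 i l).1.le, (h.2 i l).2.le⟩⟩

/-- The normalized velocity error is known to be continuous only where the kinematic errors lie in
their domains, so closedness is obtained relative to the closed set `S` of times and poses with
kinematic margin. -/
theorem isClosed_safeSet (hB : ∀ i, (B i).Admissible) (hD : D.Admissible F) (hF : F.Admissible)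
    {κ : ℝ} (hκ : 0 < κ) : IsClosed (safeSet B D F κ) := by
  set S : Set (TimeState N) := {q | 0 ≤ q.1 ∧ ∀ k, κ ≤ 1 + D.xiE F q.2.1 q.1 k / F.CCol k ∧
    κ ≤ 1 - D.xiE F q.2.1 q.1 k / F.CCon k ∧ κ ≤ 1 - D.xiPsi F q.2.1 q.1 k} with hS
  have hc : Continuous fun q : TimeState N => (q.2.1, q.1) := by fun_prop
  have hSc : IsClosed S := by
    refine (isClosed_le continuous_const continuous_fst).inter ?_
    change IsClosed {q : TimeState N | ∀ k, κ ≤ 1 + D.xiE F q.2.1 q.1 k / F.CCol k ∧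
      κ ≤ 1 - D.xiE F q.2.1 q.1 k / F.CCon k ∧ κ ≤ 1 - D.xiPsi F q.2.1 q.1 k}
    simp only [ofPred_forall]
    refine isClosed_iInter fun k => ?_
    have h1 := (continuous_xiE hD hF k).comp hc
    have h2 := (continuous_xiPsi (D := D) hD k).comp hc
    exact (isClosed_le continuous_const (continuous_const.add (h1.div_const _))).inter
      ((isClosed_le continuous_const (continuous_const.sub (h1.div_const _))).inter
        (isClosed_le continuous_const (continuous_const.sub h2)))
  have hξ : ∀ i l, ContinuousOn (fun q : TimeState N =>
      D.xiV F q.2.1 ((B i).meas (q.2.1 i) (q.2.2 i) q.1) q.1 i l) S := fun i l =>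
    (continuousOn_xiV hB hD hF i l).mono fun q hq => ⟨hq.1, fun k =>
      ⟨hκ.trans_le (hq.2 k).1, hκ.trans_le (hq.2 k).2.1, hκ.trans_le (hq.2 k).2.2⟩⟩
  have e : safeSet B D F κ = S ∩ ⋂ i, ⋂ l,
      ((S ∩ (fun q => 1 + D.xiV F q.2.1 ((B i).meas (q.2.1 i) (q.2.2 i) q.1) q.1 i l) ⁻¹' Ici κ) ∩
      (S ∩ (fun q => 1 - D.xiV F q.2.1 ((B i).meas (q.2.1 i) (q.2.2 i) q.1) q.1 i l) ⁻¹' Ici κ)) := by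
    ext q
    simp only [mem_inter_iff, mem_iInter, Set.mem_preimage, mem_Ici]
    exact ⟨fun h => ⟨h.1, fun i l => ⟨⟨h.1, (h.2 i l).1⟩, ⟨h.1, (h.2 i l).2⟩⟩⟩,
      fun h => ⟨h.1, fun i l => ⟨(h.2 i l).1.2, (h.2 i l).2.2⟩⟩⟩
  rw [e]
  refine hSc.inter (isClosed_iInter fun i => isClosed_iInter fun l => ?_)
  exact ((continuousOn_const.add (hξ i l)).preimage_isClosed_of_isClosed hSc isClosed_Ici).inter
    ((continuousOn_const.sub (hξ i l)).preimage_isClosed_of_isClosed hSc isClosed_Ici)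

/-- A strict margin becomes weak in the limit, hence the slightly smaller `κ'`. -/
theorem margin_at_of_forall_lt (hB : ∀ i, (B i).Admissible) (hD : D.Admissible F)
    (hF : F.Admissible) {κ κ' τ : ℝ} (hκ : 0 < κ) (hκ' : κ' < κ) (hτ : 0 < τ)
    {x : ℝ → Fin N → SE3} {v : ℝ → Fin N → V6} (hx : ContinuousWithinAt x (Ici 0) τ)
    (hv : ContinuousWithinAt v (Ici 0) τ) (h : ∀ t ∈ Ico 0 τ, Margin B D F κ (x t) (v t) t) :
    Margin B D F κ' (x τ) (v τ) τ := by
  have hxv : Tendsto (fun t => ((t, x t, v t) : TimeState N)) (𝓝[Ico 0 τ] τ) (𝓝 (τ, x τ, v τ)) :=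
    Tendsto.prodMk_nhds (tendsto_id.mono_left nhdsWithin_le_nhds)
      (Tendsto.prodMk_nhds (hx.mono Ico_subset_Ici_self) (hv.mono Ico_subset_Ici_self))
  have : (𝓝[Ico 0 τ] τ).NeBot := by
    rw [← mem_closure_iff_nhdsWithin_neBot, closure_Ico hτ.ne]
    exact ⟨hτ.le, le_rfl⟩
  have hmem : (τ, x τ, v τ) ∈ safeSet B D F κ :=
    (isClosed_safeSet hB hD hF hκ).mem_of_tendsto hxv (by
      filter_upwards [self_mem_nhdsWithin] with t ht
      exact mem_safeSet_of_margin ht.1 (h t ht))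
  exact margin_of_mem_safeSet hκ' hmem

theorem eventually_margin (hB : ∀ i, (B i).Admissible) (hD : D.Admissible F) (hF : F.Admissible)
    {κ t : ℝ} (hκ : 0 ≤ κ) (ht : 0 ≤ t) {x : ℝ → Fin N → SE3} {v : ℝ → Fin N → V6}
    (hx : ContinuousWithinAt x (Ici 0) t) (hv : ContinuousWithinAt v (Ici 0) t)
    (h : Margin B D F κ (x t) (v t) t) :
    ∀ᶠ s in 𝓝[Ici 0] t, Margin B D F κ (x s) (v s) s := by
  have hxt : Tendsto (fun s => (x s, s)) (𝓝[Ici 0] t) (𝓝 (x t, t)) :=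
    Tendsto.prodMk_nhds hx (tendsto_id.mono_left nhdsWithin_le_nhds)
  have hxv : Tendsto (fun s => ((s, x s, v s) : TimeState N)) (𝓝[Ici 0] t) (𝓝 (t, x t, v t)) :=
    Tendsto.prodMk_nhds (tendsto_id.mono_left nhdsWithin_le_nhds) (Tendsto.prodMk_nhds hx hv)
  have hk : ∀ᶠ s in 𝓝[Ici 0] t, D.KinMargin F κ (x s) s :=
    hxt.eventually ((isOpen_kinMargin hD hF κ).mem_nhds h.1)
  have hw : Tendsto (fun s => ((s, x s, v s) : TimeState N)) (𝓝[Ici 0] t)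
      (𝓝[{q | 0 ≤ q.1 ∧ D.KinMargin F 0 q.2.1 q.1}] (t, x t, v t)) :=
    tendsto_nhdsWithin_iff.2 ⟨hxv, by
      filter_upwards [hk, self_mem_nhdsWithin] with s hs hs0 using ⟨hs0, hs.mono hκ⟩⟩
  have hξ : ∀ i l, Tendsto (fun s => D.xiV F (x s) ((B i).meas (x s i) (v s i) s) s i l)
      (𝓝[Ici 0] t) (𝓝 (D.xiV F (x t) ((B i).meas (x t i) (v t i) t) t i l)) := fun i l =>
    Tendsto.comp (continuousOn_xiV hB hD hF i l (t, x t, v t) ⟨ht, h.1.mono hκ⟩) hw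
  refine hk.and (eventually_all.2 fun i => eventually_all.2 fun l => ?_)
  exact (((hξ i l).const_add 1).eventually (lt_mem_nhds (h.2 i l).1)).and
    (((hξ i l).const_sub 1).eventually (lt_mem_nhds (h.2 i l).2))

theorem Margin.exists_pos {x : Fin N → SE3} {v : Fin N → V6} {t : ℝ}
    (h : Margin B D F 0 x v t) : ∃ κ > 0, Margin B D F κ x v t := by
  have hev : ∀ {a : ℝ}, 0 < a → ∀ᶠ κ in 𝓝[>] (0 : ℝ), κ < a := fun ha =>
    nhdsWithin_le_nhds (gt_mem_nhds ha)
  have : ∀ᶠ κ in 𝓝[>] (0 : ℝ), Margin B D F κ x v t := by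
    refine (eventually_all.2 fun k => ?_).and
      (eventually_all.2 fun i => eventually_all.2 fun l => ?_)
    · exact (hev (h.1 k).1).and ((hev (h.1 k).2.1).and (hev (h.1 k).2.2))
    · exact (hev (h.2 i l).1).and (hev (h.2 i l).2)
  obtain ⟨κ, hκ, hκ0⟩ := (this.and self_mem_nhdsWithin).exists
  exact ⟨κ, hκ0, hκ⟩

theorem HasBodyVelocity.continuousWithinAt {x : ℝ → SE3} {v : V6} {t : ℝ}
    (h : HasBodyVelocity x v t) : ContinuousWithinAt x (Ici 0) t := by
  refine ContinuousWithinAt.prodMk (f := fun s => (x s).1) (g := fun s => (x s).2)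
    h.1.continuousWithinAt ?_
  rw [Topology.IsInducing.subtypeVal.continuousWithinAt_iff]
  exact continuousWithinAt_pi.2 fun a => continuousWithinAt_pi.2 fun b =>
    (h.2 a b).continuousWithinAt

theorem IsClosedLoopSolution.continuousWithinAt {J : Set ℝ} {x : ℝ → Fin N → SE3}
    {v : ℝ → Fin N → V6} (h : IsClosedLoopSolution B F D J x v) {t : ℝ} (ht : t ∈ J) :
    ContinuousWithinAt x (Ici 0) t ∧ ContinuousWithinAt v (Ici 0) t := by
  refine ⟨continuousWithinAt_pi.2 fun i => (h t ht i).1.continuousWithinAt,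
    continuousWithinAt_pi.2 fun i => ?_⟩
  obtain ⟨-, a, ha, -⟩ := h t ht i
  exact ha.continuousWithinAt

/-- A solution might a priori leave the domains, where `Real.log` and `deriv` still have values.
Before a first exit it satisfies the uniform margin, which persists in the limit and so excludes the
exit. -/
theorem IsClosedLoopSolution.exists_margin (hB : ∀ i, (B i).Admissible) (hD : D.Admissible F)
    (hF : F.Admissible) {G : SimpleGraph (Fin N)} (hG : G.IsAcyclic) (hFG : F.Orients G)
    (hρ2 : ∀ k, D.rhoPsi0 k < 2) {x₀ : Fin N → SE3} {v₀ : Fin N → V6}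
    (h₀ : Margin B D F 0 x₀ v₀ 0) :
    ∃ κ > 0, ∀ τ x v, IsClosedLoopSolution B F D (Ico 0 τ) x v → x 0 = x₀ → v 0 = v₀ →
      ∀ t ∈ Ico 0 τ, Margin B D F κ (x t) (v t) t := by
  obtain ⟨κ, hκ, H⟩ := Traj.exists_margin hB hD hF hG hFG hρ2 x₀ v₀
  refine ⟨κ, hκ, fun τ x v h hx hv => H τ x v ⟨h, hx, hv, ?_⟩⟩
  refine forall_Ico_of_continuous_induction (by rwa [hx, hv]) (fun t ht hlt => ?_)
    (fun t ht hm => ?_)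
  · have hc := h.continuousWithinAt ⟨ht.1.le, ht.2⟩
    exact margin_at_of_forall_lt hB hD hF hκ hκ ht.1 hc.1 hc.2
      (H t x v ⟨fun s hs => h s ⟨hs.1, hs.2.trans ht.2⟩, hx, hv, hlt⟩)
  · have hc := h.continuousWithinAt ht
    exact eventually_margin hB hD hF le_rfl ht.1 hc.1 hc.2 hm

end Continuity

/-! ### Invariance and closedness of the rotation group. -/

theorem mem_SO3_of_deriv {R : ℝ → Matrix (Fin 3) (Fin 3) ℝ} {σ : ℝ → ℝ} {w : ℝ → E3}
    (h : ∀ t, 0 ≤ t → ∀ a b,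
      HasDerivWithinAt (fun s => R s a b) ((σ t • (R t * skew (w t))) a b) (Ici 0) t)
    (h0 : R 0 ∈ Matrix.specialOrthogonalGroup (Fin 3) ℝ) {t : ℝ} (ht : 0 ≤ t) :
    R t ∈ Matrix.specialOrthogonalGroup (Fin 3) ℝ := by
  have hRT : ∀ t, 0 ≤ t → ∀ a b, HasDerivWithinAt (fun s => (R s)ᵀ a b)
      ((σ t • (R t * skew (w t)))ᵀ a b) (Ici 0) t := fun t ht a b => h t ht b a
  -- The two terms of the derivative of `R Rᵀ` cancel by skewness, whatever the factor `σ`; this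
  -- leaves room for a scalar cutoff.
  have horth : ∀ t, 0 ≤ t → R t * (R t)ᵀ = 1 := by
    intro t ht
    have hd : ∀ s, 0 ≤ s → ∀ a b,
        HasDerivWithinAt (fun s => (R s * (R s)ᵀ) a b) 0 (Ici 0) s := by
      intro s hs a b
      refine (hasDerivWithinAt_mul_apply (h s hs) (hRT s hs) a b).congr_deriv ?_
      rw [Matrix.transpose_smul, Matrix.transpose_mul, transpose_skew, Matrix.smul_mul,
        Matrix.mul_smul, Matrix.neg_mul, Matrix.mul_neg, ← mul_assoc, smul_neg, add_neg_cancel]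
      rfl
    have h00 : R 0 * (R 0)ᵀ = 1 := SO3.mul_transpose ⟨R 0, h0⟩
    rw [← h00]
    ext a b
    exact constant_of_has_deriv_right_zero (f := fun s => (R s * (R s)ᵀ) a b)
      (fun s hs => ((hd s hs.1 a b).continuousWithinAt).mono Icc_subset_Ici_self)
      (fun s hs => (hd s hs.1 a b).mono (Ici_subset_Ici.2 hs.1)) t ⟨ht, le_rfl⟩
  have hdet : ∀ t, 0 ≤ t → (R t).det ^ 2 = 1 := by
    intro t ht
    have := congrArg Matrix.det (horth t ht)
    rwa [Matrix.det_mul, Matrix.det_transpose, Matrix.det_one, ← sq] at this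
  have hcont : ContinuousOn (fun s => (R s).det) (Ici 0) := by
    have hR : ContinuousOn R (Ici 0) := fun s hs =>
      continuousWithinAt_pi.2 fun a => continuousWithinAt_pi.2 fun b =>
        (h s hs a b).continuousWithinAt
    exact (continuous_id.matrix_det).comp_continuousOn hR
  refine Matrix.mem_specialOrthogonalGroup_iff.2
    ⟨(Matrix.mem_orthogonalGroup_iff (Fin 3) ℝ).2 (horth t ht), ?_⟩
  -- The determinant is `±1` and continuous, so it keeps its initial value `1`.
  by_contra hne
  have hneg : (R t).det = -1 := (sq_eq_one_iff.1 (hdet t ht)).resolve_left hne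
  have hone : (R 0).det = 1 := (Matrix.mem_specialOrthogonalGroup_iff.1 h0).2
  obtain ⟨s, hs, hs0⟩ := intermediate_value_Icc' ht (hcont.mono Icc_subset_Ici_self)
    (show (0 : ℝ) ∈ Icc (R t).det (R 0).det by rw [hneg, hone]; constructor <;> norm_num)
  have := hdet s hs.1
  simp only at hs0
  rw [hs0] at this
  norm_num at this

theorem isClosed_SO3 :
    IsClosed {A : Matrix (Fin 3) (Fin 3) ℝ | A ∈ Matrix.specialOrthogonalGroup (Fin 3) ℝ} := by
  have e : {A : Matrix (Fin 3) (Fin 3) ℝ | A ∈ Matrix.specialOrthogonalGroup (Fin 3) ℝ} =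
      {A | A * Aᵀ = 1} ∩ {A | A.det = 1} := by
    ext A
    exact Matrix.mem_specialOrthogonalGroup_iff.trans
      (and_congr_left fun _ => Matrix.mem_orthogonalGroup_iff (Fin 3) ℝ)
  rw [e]
  exact (isClosed_eq (continuous_id.matrix_mul continuous_id.matrix_transpose)
    continuous_const).inter (isClosed_eq continuous_id.matrix_det continuous_const)

/-- The vector space containing the states of all agents. -/
abbrev FlatState (N : ℕ) : Type := (Fin N → E3 × (Fin 3 → Fin 3 → ℝ)) × (Fin N → V6)

/-! ### The closed loop in a vector space: truncation, existence and extension. -/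

section Flat

variable {N K : ℕ} {B : Fin N → RigidBody} {D : Design N K} {F : Formation N K}

/-- The state of all agents as a vector. -/
def flat (x : Fin N → SE3) (v : Fin N → V6) : FlatState N :=
  (fun i => ((x i).1, (x i).2.1), v)

/-- The right-hand side of the equations of motion with accelerations `A`. -/
def flatField (A : ℝ × FlatState N → Fin N → V6) (q : ℝ × FlatState N) : FlatState N :=
  (fun i => (act (Matrix.of (q.2.1 i).2) (lin (q.2.2 i)),
    Matrix.of.symm (Matrix.of (q.2.1 i).2 * skew (ang (q.2.2 i)))), A q)

theorem isClosedEmbedding_flat :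
    IsClosedEmbedding fun q : TimeState N => (q.1, flat q.2.1 q.2.2) := by
  have h1 : IsClosedEmbedding fun R : SO3 => (R.1 : Fin 3 → Fin 3 → ℝ) :=
    isClosed_SO3.isClosedEmbedding_subtypeVal
  have hprod : ∀ {X Y X' Y' : Type} [TopologicalSpace X] [TopologicalSpace Y]
      [TopologicalSpace X'] [TopologicalSpace Y'] {f : X → X'} {g : Y → Y'},
      IsClosedEmbedding f → IsClosedEmbedding g → IsClosedEmbedding (Prod.map f g) :=
    fun hf hg => ⟨hf.1.prodMap hg.1, by rw [range_prodMap]; exact hf.2.prod hg.2⟩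
  exact hprod IsClosedEmbedding.id (hprod (IsClosedEmbedding.piMap fun _ : Fin N =>
    hprod IsClosedEmbedding.id h1) IsClosedEmbedding.id)

theorem continuous_lin : Continuous lin :=
  (PiLp.continuous_toLp 2 _).comp (continuous_pi fun a => PiLp.continuous_apply 2 _ (Sum.inl a))

theorem continuous_ang : Continuous ang :=
  (PiLp.continuous_toLp 2 _).comp (continuous_pi fun a => PiLp.continuous_apply 2 _ (Sum.inr a))

theorem continuous_skew : Continuous skew := by
  have h : ∀ a : Fin 3, Continuous fun x : E3 => x a := fun a => PiLp.continuous_apply 2 _ a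
  refine continuous_matrix fun a b => ?_
  fin_cases a <;> fin_cases b <;> simp [skew] <;> fun_prop

theorem continuous_flatField {A : ℝ × FlatState N → Fin N → V6} (hA : Continuous A) :
    Continuous (flatField A) := by
  refine Continuous.prodMk (continuous_pi fun i => Continuous.prodMk ?_ ?_) hA
  · rw [← continuousOn_univ]
    refine continuous_act_of (Continuous.continuousOn ?_) (Continuous.continuousOn ?_)
    · exact continuous_snd.comp ((continuous_apply i).comp (continuous_fst.comp continuous_snd))
    · exact continuous_lin.comp ((continuous_apply i).comp (continuous_snd.comp continuous_snd))
  · have h1 : Continuous fun q : ℝ × FlatState N =>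
        (Matrix.of (q.2.1 i).2 : Matrix (Fin 3) (Fin 3) ℝ) :=
      continuous_snd.comp ((continuous_apply i).comp (continuous_fst.comp continuous_snd))
    have h2 : Continuous fun q : ℝ × FlatState N => skew (ang (q.2.2 i)) :=
      continuous_skew.comp
        (continuous_ang.comp ((continuous_apply i).comp (continuous_snd.comp continuous_snd)))
    exact h1.matrix_mul h2

theorem hasDerivWithinAt_fst {V W : Type*} [NormedAddCommGroup V] [NormedSpace ℝ V]
    [NormedAddCommGroup W] [NormedSpace ℝ W] {f : ℝ → V × W} {f' : V × W} {s : Set ℝ} {t : ℝ}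
    (h : HasDerivWithinAt f f' s t) : HasDerivWithinAt (fun r => (f r).1) f'.1 s t :=
  (ContinuousLinearMap.fst ℝ V W).hasFDerivAt.comp_hasDerivWithinAt t h

theorem hasDerivWithinAt_snd {V W : Type*} [NormedAddCommGroup V] [NormedSpace ℝ V]
    [NormedAddCommGroup W] [NormedSpace ℝ W] {f : ℝ → V × W} {f' : V × W} {s : Set ℝ} {t : ℝ}
    (h : HasDerivWithinAt f f' s t) : HasDerivWithinAt (fun r => (f r).2) f'.2 s t :=
  (ContinuousLinearMap.snd ℝ V W).hasFDerivAt.comp_hasDerivWithinAt t h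

theorem hasDerivWithinAt_flatState {z : ℝ → FlatState N} {z' : FlatState N} {s : Set ℝ} {t : ℝ} :
    HasDerivWithinAt z z' s t ↔ ∀ i,
      HasDerivWithinAt (fun r => ((z r).1 i).1) (z'.1 i).1 s t ∧
      (∀ a b, HasDerivWithinAt (fun r => ((z r).1 i).2 a b) ((z'.1 i).2 a b) s t) ∧
      HasDerivWithinAt (fun r => (z r).2 i) (z'.2 i) s t := by
  constructor
  · intro h i
    have h1 : HasDerivWithinAt (fun r => (z r).1) z'.1 s t := hasDerivWithinAt_fst h
    have h2 : HasDerivWithinAt (fun r => (z r).2) z'.2 s t := hasDerivWithinAt_snd h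
    have h3 : HasDerivWithinAt (fun r => (z r).1 i) (z'.1 i) s t := hasDerivWithinAt_pi.1 h1 i
    have h4 : HasDerivWithinAt (fun r => ((z r).1 i).1) (z'.1 i).1 s t := hasDerivWithinAt_fst h3
    have h5 : HasDerivWithinAt (fun r => ((z r).1 i).2) (z'.1 i).2 s t := hasDerivWithinAt_snd h3
    exact ⟨h4, fun a b => hasDerivWithinAt_pi.1 (hasDerivWithinAt_pi.1 h5 a) b,
      hasDerivWithinAt_pi.1 h2 i⟩
  · intro h
    exact (hasDerivWithinAt_pi.2 fun i => (h i).1.prodMk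
      (hasDerivWithinAt_pi.2 fun a => hasDerivWithinAt_pi.2 fun b => (h i).2.1 a b)).prodMk
      (hasDerivWithinAt_pi.2 fun i => (h i).2.2)

/-- Only the acceleration needs an extension; the kinematic part is defined on the whole vector
space. Boundedness comes from a scalar factor on the entire field, since truncating components
separately would destroy the form `R S(ω)`. -/
theorem exists_flatField (hB : ∀ i, (B i).Admissible) (hD : D.Admissible F) (hF : F.Admissible)
    {G : SimpleGraph (Fin N)} (hFG : F.Orients G) {κ : ℝ} (hκ : 0 < κ) :
    ∃ (A : ℝ × FlatState N → Fin N → V6) (σ : ℝ × FlatState N → ℝ) (M : ℝ),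
      Continuous (fun q => σ q • flatField A q) ∧ (∀ q, ‖σ q • flatField A q‖ ≤ M) ∧
      ∀ t x v, 0 ≤ t → Margin B D F κ x v t →
        σ (t, flat x v) = 1 ∧ A (t, flat x v) = accel B D F x v t := by
  set S := safeSet B D F κ with hS
  have hSc : IsClosed S := isClosed_safeSet hB hD hF hκ
  have he : IsClosedEmbedding fun q : S => (q.1.1, flat q.1.2.1 q.1.2.2) :=
    isClosedEmbedding_flat.comp hSc.isClosedEmbedding_subtypeVal
  have hac : ContinuousOn (fun q : TimeState N => accel B D F q.2.1 q.2.2 q.1) S :=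
    continuousOn_pi.2 fun i => (continuousOn_accel hB hD hF i).mono fun q hq =>
      ⟨hq.1.1, margin_of_mem_safeSet hκ hq⟩
  obtain ⟨g, hg⟩ := ContinuousMap.exists_extension' he
    ⟨_, continuousOn_iff_continuous_domRestrict.1 hac⟩
  obtain ⟨c, hc⟩ := exists_bound_vel hB hD hF hFG (half_pos hκ)
  -- On safe states all parts of the field are bounded by `b`; the factor `2` is for the entries of
  -- `R S(ω)`. The cutoff is `1` up to norm `b` and `0` from norm `b + 1` on.
  set b : ℝ := 2 * |c| with hb
  have hb0 : 0 ≤ b := by positivity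
  set σ : ℝ × FlatState N → ℝ := fun q => max 0 (min 1 (b + 1 - ‖flatField g q‖)) with hσ
  have hW := continuous_flatField (N := N) g.continuous
  refine ⟨g, σ, b + 1, ?_, fun q => ?_, fun t x v ht hm => ?_⟩
  · exact (continuous_const.max (continuous_const.min (continuous_const.sub hW.norm))).smul hW
  · have hσ0 : 0 ≤ σ q := le_max_left _ _
    have hσ1 : σ q ≤ 1 := max_le zero_le_one (min_le_left _ _)
    rw [norm_smul, Real.norm_of_nonneg hσ0]
    rcases le_total (‖flatField g q‖) (b + 1) with h | h
    · exact (mul_le_of_le_one_left (norm_nonneg _) hσ1).trans h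
    · have : σ q = 0 := max_eq_left ((min_le_right _ _).trans (by linarith))
      rw [this, zero_mul]
      linarith
  · have hq := mem_safeSet_of_margin ht hm
    have hA : g (t, flat x v) = accel B D F x v t := congrFun hg ⟨(t, x, v), hq⟩
    refine ⟨?_, hA⟩
    have hbd := hc x v t ht (hm.mono (half_le_self hκ.le))
    have hn : ‖flatField g (t, flat x v)‖ ≤ b := by
      have hcb : |c| ≤ b := by rw [hb]; linarith [abs_nonneg c]
      refine max_le ((pi_norm_le_iff_of_nonneg hb0).2 fun i => max_le ?_ ?_)
        ((pi_norm_le_iff_of_nonneg hb0).2 fun i => ?_)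
      · exact (SO3.norm_act (x i).2 _).trans_le (((norm_lin_le _).trans (hbd i).1).trans
          ((le_abs_self c).trans hcb))
      · refine (pi_norm_le_iff_of_nonneg hb0).2 fun a => (pi_norm_le_iff_of_nonneg hb0).2 fun a' => ?_
        exact SO3.abs_mul_skew_apply_le (x i).2
          ((norm_ang_le _).trans ((hbd i).1.trans (le_abs_self c))) a a'
      · change ‖g (t, flat x v) i‖ ≤ b
        rw [hA]
        exact (hbd i).2.2.2.2.trans ((le_abs_self c).trans hcb)
    exact (max_eq_right (by simp; linarith)).trans (min_eq_left (by linarith))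

theorem exists_closedLoopSolution_extension (hB : ∀ i, (B i).Admissible) (hD : D.Admissible F)
    (hF : F.Admissible) {G : SimpleGraph (Fin N)} (hG : G.IsAcyclic) (hFG : F.Orients G)
    (hρ2 : ∀ k, D.rhoPsi0 k < 2) {x₀ : Fin N → SE3} {v₀ : Fin N → V6}
    (h₀ : Margin B D F 0 x₀ v₀ 0) {T : ℝ} (hT : 0 ≤ T) {x : ℝ → Fin N → SE3}
    {v : ℝ → Fin N → V6} (hsol : IsClosedLoopSolution B F D (Ico 0 T) x v) (hx0 : x 0 = x₀)
    (hv0 : v 0 = v₀) :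
    ∃ x' v', IsClosedLoopSolution B F D (Ici 0) x' v' ∧ x' 0 = x₀ ∧ v' 0 = v₀ ∧
      EqOn x' x (Ico 0 T) ∧ EqOn v' v (Ico 0 T) := by
  obtain ⟨κ₁, hκ₁, hmar⟩ := IsClosedLoopSolution.exists_margin hB hD hF hG hFG hρ2 h₀
  obtain ⟨κ₂, hκ₂, hinit⟩ := h₀.exists_pos
  -- The field is modified only where margin `κ` fails. Genuine solutions have the larger margin
  -- `κ₁`, and the initial state has `κ₂`.
  set κ := min κ₁ κ₂ / 2 with hκd
  have hκ : 0 < κ := by positivity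
  have hκ1 : κ < κ₁ := by linarith [min_le_left κ₁ κ₂]
  have hκ2 : κ < κ₂ := by linarith [min_le_right κ₁ κ₂]
  obtain ⟨A, σ, M, hfc, hfM, hA⟩ := exists_flatField hB hD hF hFG hκ
  have hz₁ : ∀ t ∈ Ico 0 T, HasDerivWithinAt (fun s => flat (x s) (v s))
      (σ (t, flat (x t) (v t)) • flatField A (t, flat (x t) (v t))) (Ici 0) t := by
    intro t ht
    obtain ⟨e1, e2⟩ := hA t (x t) (v t) ht.1 ((hmar T x v hsol hx0 hv0 t ht).mono hκ1.le)
    rw [e1, one_smul, hasDerivWithinAt_flatState]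
    intro i
    refine ⟨(hsol t ht i).1.1, (hsol t ht i).1.2, ?_⟩
    change HasDerivWithinAt (fun s => v s i) (A (t, flat (x t) (v t)) i) (Ici 0) t
    rw [e2]
    exact hsol.hasDerivWithinAt_vel hB ht i
  obtain ⟨z, hz0, hzT, hz⟩ := exists_extension_of_bounded hfc hfM hT hz₁
  have hSO : ∀ t, 0 ≤ t → ∀ i,
      (Matrix.of ((z t).1 i).2) ∈ Matrix.specialOrthogonalGroup (Fin 3) ℝ := by
    intro t ht i
    refine mem_SO3_of_deriv (R := fun s => Matrix.of ((z s).1 i).2) (σ := fun s => σ (s, z s))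
      (w := fun s => ang ((z s).2 i)) (fun s hs a b => ?_) ?_ ht
    · exact ((hasDerivWithinAt_flatState.1 (hz s hs)) i).2.1 a b
    · rw [hz0]
      exact (x 0 i).2.2
  -- For negative times `z` need not consist of rotations, so the pose is frozen at its value at
  -- `0`.
  set x' : ℝ → Fin N → SE3 := fun t i => (((z (max t 0)).1 i).1,
    ⟨Matrix.of ((z (max t 0)).1 i).2, hSO _ (le_max_right _ _) i⟩) with hx'
  set v' : ℝ → Fin N → V6 := fun t => (z t).2 with hv'
  have hzf : ∀ t, 0 ≤ t → z t = flat (x' t) (v' t) := by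
    intro t ht
    simp only [flat, hx', hv', max_eq_left ht]
    rfl
  have hinj : ∀ {p q : Fin N → SE3} {u w : Fin N → V6}, flat p u = flat q w → p = q ∧ u = w := by
    intro p q u w h
    have := isClosedEmbedding_flat.injective
      (show (fun q : TimeState N => (q.1, flat q.2.1 q.2.2)) (0, p, u) =
        (fun q : TimeState N => (q.1, flat q.2.1 q.2.2)) (0, q, w) from by simp only [h])
    simpa using this
  have heq : ∀ t ∈ Ico 0 T, x' t = x t ∧ v' t = v t := fun t ht =>
    hinj ((hzf t ht.1).symm.trans (hzT ht))
  have hi : x' 0 = x 0 ∧ v' 0 = v 0 := hinj ((hzf 0 le_rfl).symm.trans hz0)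
  have hx'c : ∀ t, 0 ≤ t → ContinuousWithinAt x' (Ici 0) t ∧ ContinuousWithinAt v' (Ici 0) t := by
    intro t ht
    have hd := hasDerivWithinAt_flatState.1 (hz t ht)
    refine ⟨continuousWithinAt_pi.2 fun i => ?_,
      continuousWithinAt_pi.2 fun i => (hd i).2.2.continuousWithinAt⟩
    refine ContinuousWithinAt.prodMk (f := fun s => (x' s i).1) (g := fun s => (x' s i).2) ?_ ?_
    · refine (hd i).1.continuousWithinAt.congr (fun s hs => ?_) ?_
      · rw [hzf s hs]; rfl
      · rw [hzf t ht]; rfl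
    · rw [Topology.IsInducing.subtypeVal.continuousWithinAt_iff]
      refine continuousWithinAt_pi.2 fun a => continuousWithinAt_pi.2 fun b => ?_
      refine ((hd i).2.1 a b).continuousWithinAt.congr (fun s hs => ?_) ?_
      · rw [hzf s hs]; rfl
      · rw [hzf t ht]; rfl
  have hpt : ∀ t, 0 ≤ t → Margin B D F κ (x' t) (v' t) t →
      IsClosedLoopSolution B F D {t} x' v' := by
    rintro t ht hm _ rfl i
    obtain ⟨e1, e2⟩ := hA _ _ _ ht hm
    have hd := hz _ ht
    rw [hzf _ ht, e1, one_smul] at hd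
    have hd' := hasDerivWithinAt_flatState.1
      (hd.congr (fun s hs => (hzf s hs).symm) (hzf _ ht).symm) i
    refine ⟨⟨hd'.1, hd'.2.1⟩, _, hd'.2.2, (act_M_eq_iff hB _ _ _ _ _).2 ?_⟩
    exact congrFun e2 i
  -- Bootstrap: margin `κ` on `[0, t)` makes the curve a genuine solution there by `hpt`, so it has
  -- margin `κ₁ > κ` there, and margin `κ` holds at `t` as well.
  have hall : ∀ T', ∀ t ∈ Ico 0 T', Margin B D F κ (x' t) (v' t) t := by
    intro T'
    refine forall_Ico_of_continuous_induction ?_ (fun t ht hlt => ?_) (fun t ht hm => ?_)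
    · rw [hi.1, hi.2, hx0, hv0]
      exact hinit.mono hκ2.le
    · obtain ⟨c1, c2⟩ := hx'c t ht.1.le
      refine margin_at_of_forall_lt hB hD hF hκ₁ hκ1 ht.1 c1 c2 ?_
      exact hmar t x' v' (fun s hs => hpt s hs.1 (hlt s hs) s rfl)
        (hi.1.trans hx0) (hi.2.trans hv0)
    · obtain ⟨c1, c2⟩ := hx'c t ht.1
      exact eventually_margin hB hD hF hκ.le ht.1 c1 c2 hm
  exact ⟨x', v', fun t ht => hpt t ht (hall (t + 1) t ⟨ht, lt_add_one t⟩) t rfl,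
    hi.1.trans hx0, hi.2.trans hv0, fun t ht => (heq t ht).1, fun t ht => (heq t ht).2⟩

end Flat

/-! ### Relative positions, the initial margin and the conclusion. -/

theorem exists_bound_pos_sub {N K : ℕ} {F : Formation N K} {G : SimpleGraph (Fin N)}
    (hG : G.Connected) (hFG : F.Orients G) :
    ∃ b, ∀ x : Fin N → SE3, (∀ k, ‖F.rel x k‖ ≤ F.dCon k) → ∀ i j,
      ‖pos (x i) - pos (x j)‖ ≤ b := by
  have key : ∀ i j, ∃ b, ∀ x : Fin N → SE3, (∀ k, ‖F.rel x k‖ ≤ F.dCon k) →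
      ‖pos (x i) - pos (x j)‖ ≤ b := by
    intro i j
    obtain ⟨p⟩ := hG.preconnected i j
    -- The connectivity distances are added up along a walk in the connected sensing graph.
    induction p with
    | nil => exact ⟨0, fun x _ => by simp⟩
    | @cons i l j hadj p ih =>
      obtain ⟨b, hb⟩ := ih
      have hmem : s(i, l) ∈ Set.range fun k => s(F.tail k, F.head k) := by
        rw [hFG.2]; exact hadj
      obtain ⟨k, hk⟩ := hmem
      refine ⟨F.dCon k + b, fun x hx => ?_⟩
      have h1 : ‖pos (x i) - pos (x l)‖ ≤ F.dCon k := by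
        have := hx k
        rw [Formation.rel] at this
        rcases Sym2.eq_iff.1 hk with ⟨e1, e2⟩ | ⟨e1, e2⟩
        · rwa [e1, e2, norm_sub_rev] at this
        · rwa [e1, e2] at this
      calc ‖pos (x i) - pos (x j)‖ =
          ‖(pos (x i) - pos (x l)) + (pos (x l) - pos (x j))‖ := by rw [sub_add_sub_cancel]
        _ ≤ _ := (norm_add_le _ _).trans (add_le_add h1 (hb x hx))
  choose b hb using key
  obtain ⟨c, hc⟩ := exists_forall_le fun p : Fin N × Fin N => b p.1 p.2
  exact ⟨c, fun x hx i j => (hb i j x hx).trans (hc (i, j))⟩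

theorem margin_init {N K : ℕ} {B : Fin N → RigidBody} {D : Design N K} {F : Formation N K}
    (hD : D.Admissible F) (hF : F.Admissible) {x₀ : Fin N → SE3} {v₀ : Fin N → V6}
    (hdist : ∀ k, F.dCol k < ‖F.rel x₀ k‖ ∧ ‖F.rel x₀ k‖ < F.dCon k)
    (hrhoPsi : ∀ k, F.psi x₀ k < D.rhoPsi0 k)
    (hrhoV : ∀ i l, |D.eV F x₀ ((B i).meas (x₀ i) (v₀ i) 0) 0 i l| < D.rhoV0 i l) :
    Margin B D F 0 x₀ v₀ 0 := by
  have hperf : ∀ a b l, perf a b l 0 = a := fun a b l => by simp [perf]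
  refine ⟨fun k => ?_, fun i l => ?_⟩
  · have hC1 := hF.CCol_pos k
    have hC2 := hF.CCon_pos k
    have hd := hF.dCol_pos k
    obtain ⟨d1, d2⟩ := hdist k
    have e1 : D.xiE F x₀ 0 k = F.e x₀ k := by
      rw [Design.xiE, Design.rhoE_eq, hperf, inv_one, one_mul]
    have e2 : D.xiPsi F x₀ 0 k = (D.rhoPsi0 k)⁻¹ * F.psi x₀ k := by
      rw [Design.xiPsi, Design.rhoPsi_eq, hperf]
    have he : F.e x₀ k = ‖F.rel x₀ k‖ ^ 2 - F.dDes k ^ 2 := rfl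
    have c1 : F.CCol k = F.dDes k ^ 2 - F.dCol k ^ 2 := rfl
    have c2 : F.CCon k = F.dCon k ^ 2 - F.dDes k ^ 2 := rfl
    have g1 : -F.CCol k < F.e x₀ k := by rw [he, c1]; nlinarith
    have g2 : F.e x₀ k < F.CCon k := by
      rw [he, c2]; nlinarith [norm_nonneg (F.rel x₀ k)]
    have hρ := (hD.rhoPsiInf_pos k).trans (hD.rhoPsiInf_lt k)
    rw [e1, e2]
    refine ⟨?_, ?_, ?_⟩
    · have : -1 < F.e x₀ k / F.CCol k := by rw [lt_div_iff₀ hC1]; linarith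
      linarith
    · have : F.e x₀ k / F.CCon k < 1 := by rw [div_lt_iff₀ hC2]; linarith
      linarith
    · have : (D.rhoPsi0 k)⁻¹ * F.psi x₀ k < 1 := by
        rw [inv_mul_lt_iff₀ hρ, mul_one]; exact hrhoPsi k
      linarith
  · have hρ := (hD.rhoVInf_pos i l).trans (hD.rhoVInf_lt i l)
    have h : |D.xiV F x₀ ((B i).meas (x₀ i) (v₀ i) 0) 0 i l| < 1 := by
      rw [Design.xiV, Design.rhoV_eq, hperf, abs_mul, abs_of_pos (inv_pos.2 hρ),
        inv_mul_lt_iff₀ hρ, mul_one]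
      exact hrhoV i l
    obtain ⟨h1, h2⟩ := abs_lt.1 h
    constructor <;> linarith

theorem mainTheorem1 {N K : ℕ} (B : Fin N → RigidBody) (hB : ∀ i, (B i).Admissible)
    (F : Formation N K) (hF : F.Admissible)
    (G : SimpleGraph (Fin N)) (hG : G.IsTree) (hFG : F.Orients G)
    (D : Design N K) (hD : D.Admissible F)
    (x₀ : Fin N → SE3) (v₀ : Fin N → V6)
    (hdist : ∀ k, F.dCol k < ‖F.rel x₀ k‖ ∧ ‖F.rel x₀ k‖ < F.dCon k)
    (hpsi : ∀ k, F.psi x₀ k < 2)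
    (hrhoPsi : ∀ k, F.psi x₀ k < D.rhoPsi0 k ∧ D.rhoPsi0 k < 2)
    (hrhoV : ∀ i l, |D.eV F x₀ ((B i).meas (x₀ i) (v₀ i) 0) 0 i l| < D.rhoV0 i l) :
    -- a closed-loop solution exists for all times
    (∃ x v, IsClosedLoopSolution B F D (Ici 0) x v ∧ x 0 = x₀ ∧ v 0 = v₀) ∧
    -- every local closed-loop solution extends to all times
    (∀ T : ℝ, 0 < T → ∀ x v, IsClosedLoopSolution B F D (Ico 0 T) x v → x 0 = x₀ → v 0 = v₀ →
      ∃ x' v', IsClosedLoopSolution B F D (Ici 0) x' v' ∧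
        EqOn x' x (Ico 0 T) ∧ EqOn v' v (Ico 0 T)) ∧
    -- every closed-loop solution has the prescribed performance
    (∀ x v, IsClosedLoopSolution B F D (Ici 0) x v → x 0 = x₀ → v 0 = v₀ →
      (∀ t, 0 ≤ t → ∀ k,
        (-F.CCol k * D.rhoE F k t < F.e (x t) k ∧ F.e (x t) k < F.CCon k * D.rhoE F k t) ∧
        (0 ≤ F.psi (x t) k ∧ F.psi (x t) k < D.rhoPsi k t) ∧
        (F.dCol k < ‖F.rel (x t) k‖ ∧ ‖F.rel (x t) k‖ < F.dCon k) ∧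
        F.psi (x t) k < 2) ∧
      (∀ t, 0 ≤ t → ∀ i l,
        |D.eV F (x t) ((B i).meas (x t i) (v t i) t) t i l| < D.rhoV i l t) ∧
      (∀ k, ∀ η > 0, ∀ᶠ t in atTop,
        |F.e (x t) k| < D.rhoEInf k + η ∧ F.psi (x t) k < D.rhoPsiInf k + η) ∧
      -- all closed-loop signals are bounded
      ∃ b : ℝ, ∀ t, 0 ≤ t →
        (∀ i j, ‖pos (x t i) - pos (x t j)‖ ≤ b) ∧
        (∀ k, |D.epsE F (x t) t k| ≤ b ∧ |F.rE k (D.xiE F (x t) t k)| ≤ b ∧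
          |D.epsPsi F (x t) t k| ≤ b ∧ |rPsi (D.xiPsi F (x t) t k)| ≤ b) ∧
        (∀ i, ‖v t i‖ ≤ b ∧ ‖(B i).meas (x t i) (v t i) t‖ ≤ b ∧
          ‖D.vDes F (x t) t i‖ ≤ b ∧
          (∀ l, |D.epsV F (x t) ((B i).meas (x t i) (v t i) t) t i l| ≤ b ∧
            |rV (D.xiV F (x t) ((B i).meas (x t i) (v t i) t) t i l)| ≤ b) ∧
          ‖D.u F (x t) ((B i).meas (x t i) (v t i) t) t i‖ ≤ b ∧
          (∃ a, HasDerivWithinAt (fun s => v s i) a (Ici 0) t ∧ ‖a‖ ≤ b) ∧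
          (∃ a, HasDerivWithinAt (fun s => D.vDes F (x s) s i) a (Ici 0) t ∧ ‖a‖ ≤ b))) := by
  have hρ2 : ∀ k, D.rhoPsi0 k < 2 := fun k => (hrhoPsi k).2
  have h₀ : Margin B D F 0 x₀ v₀ 0 :=
    margin_init hD hF hdist (fun k => (hrhoPsi k).1) hrhoV
  have hac := hG.isAcyclic
  refine ⟨?_, fun T hT x v h hx hv => ?_, fun x v h hx hv => ?_⟩
  -- Existence is extension from the empty interval `[0, 0)`, where any curves with the right
  -- initial values qualify.
  · obtain ⟨x, v, h, hx, hv, -⟩ := exists_closedLoopSolution_extension hB hD hF hac hFG hρ2 h₀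
      le_rfl (x := fun _ => x₀) (v := fun _ => v₀) (fun t ht => by simp at ht) rfl rfl
    exact ⟨x, v, h, hx, hv⟩
  · obtain ⟨x', v', h', -, -, e1, e2⟩ :=
      exists_closedLoopSolution_extension hB hD hF hac hFG hρ2 h₀ hT.le h hx hv
    exact ⟨x', v', h', e1, e2⟩
  · obtain ⟨κ, hκ, hm⟩ := IsClosedLoopSolution.exists_margin hB hD hF hac hFG hρ2 h₀
    have hsol : ∀ τ, IsClosedLoopSolution B F D (Ico 0 τ) x v := fun τ t ht => h t ht.1
    have hmκ : ∀ t, 0 ≤ t → Margin B D F κ (x t) (v t) t := fun t ht =>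
      hm (t + 1) x v (hsol _) hx hv t ⟨ht, lt_add_one t⟩
    have hm0 : ∀ t, 0 ≤ t → Margin B D F 0 (x t) (v t) t := fun t ht => (hmκ t ht).mono hκ.le
    refine ⟨fun t ht k => ⟨(hm0 t ht).1.e_bounds hD hF k,
      ⟨F.psi_nonneg _ k, (hm0 t ht).1.psi_lt hD k⟩, (hm0 t ht).1.rel_bounds hD hF ht k,
      ((hm0 t ht).1.psi_lt hD k).trans_le ((hD.rhoPsi_le k ht).trans (hρ2 k).le)⟩,
      fun t ht i l => (hm0 t ht).abs_eV_lt hD i l, fun k η hη => ?_, ?_⟩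
    · have hC : 0 < max (F.CCon k) (F.CCol k) := lt_max_of_lt_left (hF.CCon_pos k)
      -- The funnel width is at most `C_k ρ_e`, and the normalization of `ρ_e` by `C_k` makes the
      -- limit exactly `ρ_{e,∞}`.
      have l1 : Tendsto (fun t => max (F.CCon k) (F.CCol k) * D.rhoE F k t) atTop
          (𝓝 (D.rhoEInf k)) := by
        have := (tendsto_perf (a := 1) (b := D.rhoEMin F k) (hD.lE_pos k)).const_mul
          (max (F.CCon k) (F.CCol k))
        rwa [show max (F.CCon k) (F.CCol k) * D.rhoEMin F k = D.rhoEInf k by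
          rw [Design.rhoEMin]; field_simp] at this
      have l2 : Tendsto (D.rhoPsi k) atTop (𝓝 (D.rhoPsiInf k)) := tendsto_perf (hD.lPsi_pos k)
      filter_upwards [l1.eventually (gt_mem_nhds (lt_add_of_pos_right _ hη)),
        l2.eventually (gt_mem_nhds (lt_add_of_pos_right _ hη)), eventually_ge_atTop 0]
        with t h1 h2 ht
      obtain ⟨b1, b2⟩ := (hm0 t ht).1.e_bounds hD hF k
      have hρ := hD.rhoE_pos hF k t
      have m1 := mul_le_mul_of_nonneg_right (le_max_left (F.CCon k) (F.CCol k)) hρ.le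
      have m2 := mul_le_mul_of_nonneg_right (le_max_right (F.CCon k) (F.CCol k)) hρ.le
      exact ⟨abs_lt.2 ⟨by linarith, by linarith⟩, ((hm0 t ht).1.psi_lt hD k).trans h2⟩
    · obtain ⟨c₁, hc₁⟩ := exists_bound_pos_sub hG.connected hFG
      obtain ⟨c₂, hc₂⟩ := exists_bound_kin hD hF hFG hκ
      obtain ⟨c₃, hc₃⟩ := exists_bound_vel hB hD hF hFG hκ
      obtain ⟨_, _, c₄, hc₄⟩ := Traj.exists_bound_kin hB hD hF hac hFG hρ2 x₀ v₀
      refine ⟨max (max c₁ c₂) (max c₃ c₄), fun t ht => ?_⟩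
      have le₁ : ∀ {y}, y ≤ c₁ → y ≤ max (max c₁ c₂) (max c₃ c₄) := fun h =>
        le_max_of_le_left (le_max_of_le_left h)
      have le₂ : ∀ {y}, y ≤ c₂ → y ≤ max (max c₁ c₂) (max c₃ c₄) := fun h =>
        le_max_of_le_left (le_max_of_le_right h)
      have le₃ : ∀ {y}, y ≤ c₃ → y ≤ max (max c₁ c₂) (max c₃ c₄) := fun h =>
        le_max_of_le_right (le_max_of_le_left h)
      have le₄ : ∀ {y}, y ≤ c₄ → y ≤ max (max c₁ c₂) (max c₃ c₄) := fun h =>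
        le_max_of_le_right (le_max_of_le_right h)
      obtain ⟨k1, k2⟩ := hc₂ (x t) t ht (hmκ t ht).1
      refine ⟨fun i j => le₁ (hc₁ (x t) (fun k => ((hm0 t ht).1.rel_bounds hD hF ht k).2.le) i j),
        fun k => ⟨le₂ (k1 k).1, le₂ (k1 k).2.1, le₂ (k1 k).2.2.1, le₂ (k1 k).2.2.2⟩,
        fun i => ?_⟩
      obtain ⟨w1, w2, w3, w4, w5⟩ := hc₃ (x t) (v t) t ht (hmκ t ht) i
      obtain ⟨a, ha, ha'⟩ := ((hc₄ (t + 1) x v ⟨hsol _, hx, hv, fun s hs => hm0 s hs.1⟩ t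
        ⟨ht, lt_add_one t⟩).2 i).2
      exact ⟨le₃ w1, le₃ w2, le₂ (k2 i), fun l => ⟨le₃ (w3 l).1, le₃ (w3 l).2⟩, le₃ w4,
        ⟨_, h.hasDerivWithinAt_vel hB ht i, le₃ w5⟩, a, ha, le₄ ha'⟩

end
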